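/- There are a randomised algorithm and an absolute constant $C$ such that the following holds. Let $G$ be a finite undirected graph with $n\ge 2$ vertices and $m$ edges, not necessarily simple (parallel edges and loops are allowed; a loop counts twice in the degree of its vertex and, like every edge, has two directions), in which every vertex has degree at least $3$, stored as an adjacency list in which the edges at each vertex are arbitrarily ordered. Let $0<\varepsilon<1$ be rational, given as $\varepsilon=a/b$ with positive integers $a<b$. Let $Z$ be the number of sink-free orientations of $G$, i.e. of the ways to direct every edge so that every vertex has at least one outgoing edge. Then, on input $(G,a,b)$, the algorithm always halts within $C\,(n/\varepsilon)^2\log(n/\varepsilon)$ steps, and with probability at least $3/4$ it outputs a number $\widetilde Z$ with $$(1-\varepsilon)\,Z\le\widetilde Z\le(1+\varepsilon)\,Z .$$ Here an algorithm is a program for a random access machine whose unit-cost instructions are loading and storing words, $+$, truncated $-$, $\times$, integer division, tests, and tossing a fair coin. All words that occur are non-negative integers of at most $(n+m+b)^{C}$, and $\widetilde Z$ is output in binary floating point, as $M\cdot 2^{e-e'}$ with three words $M,e,e'$. -/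

import Mathlib

/-! ## Multigraphs, orientations, sink-free orientations -/

namespace SFO

/-- An undirected graph with vertex type `V` and edge type `E`; parallel edges and loops are
allowed.  `ends e false` and `ends e true` are the two end vertices of the edge `e`
(in an arbitrary order). -/
structure Multigraph (V E : Type) where
  ends : E → Bool → V

namespace Multigraph

variable {V E : Type}

/-- An orientation chooses a direction for each edge: under `σ : E → Bool` the edge `e` is
directed from `ends e (σ e)` to `ends e (!(σ e))`.  This is the vertex the edge points away from. -/
def tail (G : Multigraph V E) (σ : E → Bool) (e : E) : V := G.ends e (σ e)

/-- The vertex the edge points to. -/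
def head (G : Multigraph V E) (σ : E → Bool) (e : E) : V := G.ends e (!(σ e))

/-- The orientation `σ` is sink-free: every vertex has at least one outgoing edge. -/
def IsSinkFree (G : Multigraph V E) (σ : E → Bool) : Prop :=
  ∀ v : V, ∃ e : E, G.tail σ e = v

/-- The number of sink-free orientations (for a finite graph). -/
noncomputable def numSinkFree (G : Multigraph V E) : ℕ :=
  Nat.card {σ : E → Bool // G.IsSinkFree σ}

/-- The degree of `v`: the number of edge ends at `v` (so a loop counts twice). -/
noncomputable def degree (G : Multigraph V E) (v : V) : ℕ :=
  Nat.card {d : E × Bool // G.ends d.1 d.2 = v}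

end Multigraph

/-! ## Adjacency lists and the input words -/

/-- An adjacency list of a graph with vertices `0, …, n - 1` and edges `0, …, m - 1`: for each
vertex, the edge ends at that vertex, each once, in an arbitrary order. -/
structure AdjList {n m : ℕ} (G : Multigraph (Fin n) (Fin m)) where
  list : Fin n → List (Fin m × Bool)
  nodup : ∀ v, (list v).Nodup
  mem_iff : ∀ v d, d ∈ list v ↔ G.ends d.1 d.2 = v

namespace AdjList

variable {n m : ℕ} {G : Multigraph (Fin n) (Fin m)}

/-- The address in the input at which the list of vertex `v` starts; for `v = n` the address
just after the last list. -/
def start (L : AdjList G) (v : ℕ) : ℕ :=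
  (n + 4) + ∑ u : Fin n with u.val < v, 2 * (L.list u).length

/-- The input words: the number `n` of vertices, the accuracy as a numerator `a` and
a denominator `b`, then `n + 1` pointers (the list of vertex `v` occupies the addresses from
`start v` up to `start (v + 1)`, exclusive), then the adjacency lists one after the other; each
entry of the list of `v` consists of two words, the neighbour of `v` along an edge and the number
of that edge. -/
def encode (L : AdjList G) (a b : ℕ) : List ℕ :=
  [n, a, b] ++ (List.range (n + 1)).map L.start ++
    (List.finRange n).flatMap fun v =>
      (L.list v).flatMap fun d => [(G.ends d.1 (!d.2)).val, d.1.val]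

end AdjList

/-! ## A randomised random access machine with unit-cost instructions -/

/-- The contents of the registers and of the memory. -/
structure Store where
  reg : ℕ → ℕ
  mem : ℕ → ℕ

namespace Store

/-- Initially all registers and memory cells hold `0`. -/
def zero : Store := ⟨fun _ => 0, fun _ => 0⟩

/-- Write the value `x` to register `d`. -/
def setReg (s : Store) (d x : ℕ) : Store := { s with reg := Function.update s.reg d x }

/-- Write the value `x` to the memory cell with address `i`. -/
def setMem (s : Store) (i x : ℕ) : Store := { s with mem := Function.update s.mem i x }

/-- All words in the registers and in the memory are at most `W`. -/
def BoundedBy (s : Store) (W : ℕ) : Prop := (∀ i, s.reg i ≤ W) ∧ ∀ i, s.mem i ≤ W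

/-- The output of the machine, a binary floating point number: mantissa in register `0`,
exponent the difference of the contents of registers `1` and `2`. -/
noncomputable def output (s : Store) : ℝ := (s.reg 0 : ℝ) * 2 ^ (s.reg 1) / 2 ^ (s.reg 2)

end Store

/-- Elementary instructions; `d s t` are names of registers, `r[d]` is the content of `d`. -/
inductive Instr where
  /-- `r[d] := c` for a fixed number `c`. -/
  | const (d c : ℕ)
  /-- `r[d] := r[s] + r[t]`. -/
  | add (d s t : ℕ)
  /-- `r[d] := max (r[s] - r[t]) 0`. -/
  | sub (d s t : ℕ)
  /-- `r[d] := r[s] * r[t]`. -/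
  | mul (d s t : ℕ)
  /-- `r[d] := ⌊r[s] / r[t]⌋` (and `0` if `r[t] = 0`). -/
  | div (d s t : ℕ)
  /-- `r[d] :=` the content of the memory cell with address `r[s]`. -/
  | load (d s : ℕ)
  /-- The memory cell with address `r[d]` receives the value `r[s]`. -/
  | store (d s : ℕ)
  /-- `r[d] :=` the input word with address `r[s]` (and `0` beyond the end of the input). -/
  | read (d s : ℕ)
  /-- `r[d] :=` a fair random bit, independent of everything so far. -/
  | flip (d : ℕ)

/-- The effect of an instruction on the store, on the input `x`. -/
noncomputable def Instr.exec (x : List ℕ) : Instr → Store → PMF Store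
  | .const d c, σ => PMF.pure (σ.setReg d c)
  | .add d s t, σ => PMF.pure (σ.setReg d (σ.reg s + σ.reg t))
  | .sub d s t, σ => PMF.pure (σ.setReg d (σ.reg s - σ.reg t))
  | .mul d s t, σ => PMF.pure (σ.setReg d (σ.reg s * σ.reg t))
  | .div d s t, σ => PMF.pure (σ.setReg d (σ.reg s / σ.reg t))
  | .load d s, σ => PMF.pure (σ.setReg d (σ.mem (σ.reg s)))
  | .store d s, σ => PMF.pure (σ.setMem (σ.reg d) (σ.reg s))
  | .read d s, σ => PMF.pure (σ.setReg d (x.getD (σ.reg s) 0))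
  | .flip d, σ => (PMF.uniformOfFintype Bool).map fun c => σ.setReg d c.toNat

/-- Programs: finite texts built from instructions by sequencing, branching and loops. -/
inductive Program where
  /-- A single instruction. -/
  | instr (i : Instr)
  /-- First `p`, then `q`. -/
  | seq (p q : Program)
  /-- `p` if `r[s] ≠ 0`, otherwise `q`. -/
  | branch (s : ℕ) (p q : Program)
  /-- Repeat `p` as long as `r[s] ≠ 0`. -/
  | loop (s : ℕ) (p : Program)

/-- A configuration: what remains to be executed, and the store.  The machine has halted when
nothing remains to be executed. -/
structure Config where
  todo : List Program
  store : Store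

/-- One step of the machine on the input `x`: one instruction, one test, or the unfolding of one
sequential composition.  A configuration that has halted does not change any more. -/
noncomputable def Config.step (x : List ℕ) : Config → PMF Config
  | ⟨[], σ⟩ => PMF.pure ⟨[], σ⟩
  | ⟨.instr i :: k, σ⟩ => (i.exec x σ).map fun τ => ⟨k, τ⟩
  | ⟨.seq p q :: k, σ⟩ => PMF.pure ⟨p :: q :: k, σ⟩
  | ⟨.branch s p q :: k, σ⟩ => PMF.pure ⟨(if σ.reg s ≠ 0 then p else q) :: k, σ⟩
  | ⟨.loop s p :: k, σ⟩ => PMF.pure ⟨if σ.reg s ≠ 0 then p :: .loop s p :: k else k, σ⟩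

/-- The distribution of the configuration after `t` steps from the configuration `c`. -/
noncomputable def Config.run (x : List ℕ) : ℕ → Config → PMF Config
  | 0, c => PMF.pure c
  | t + 1, c => (c.step x).bind (Config.run x t)

/-- The distribution of the configuration of the machine with program `P` on the input `x`
after `t` steps. -/
noncomputable def Program.runFor (P : Program) (x : List ℕ) (t : ℕ) : PMF Config :=
  Config.run x t ⟨[P], Store.zero⟩

/-- Whatever the random bits are, `P` halts on the input `x` within `T` steps. -/
def Program.HaltsWithin (P : Program) (x : List ℕ) (T : ℕ) : Prop :=
  ∀ c ∈ (P.runFor x T).support, c.todo = []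

/-- Whatever the random bits are, no word that occurs while `P` runs on `x` exceeds `W`. -/
def Program.WordsBoundedBy (P : Program) (x : List ℕ) (W : ℕ) : Prop :=
  ∀ t, ∀ c ∈ (P.runFor x t).support, c.store.BoundedBy W

/-- The probability that `P`, on the input `x`, has halted after `T` steps with an output
in the set `A`. -/
noncomputable def Program.probOutput (P : Program) (x : List ℕ) (T : ℕ) (A : Set ℝ) : ENNReal :=
  (P.runFor x T).toOuterMeasure {c | c.todo = [] ∧ c.store.output ∈ A}

/-- `y` is an `ε`-approximation of `z`, for `z > 0`: the ratio `y / z` lies between `1 - ε` and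
`1 + ε`. -/
def IsApprox (ε z y : ℝ) : Prop := (1 - ε) * z ≤ y ∧ y ≤ (1 + ε) * z

end SFO

/-!
Under a uniformly random orientation, the probability that no vertex is a sink is the product, over
the vertices in order, of the probabilities `p i` that `i` is not a sink given that no earlier
vertex is.  All of these are at least `1 / 2`: by a local lemma, conditioned on other vertices not
being sinks, `d` given edges at a vertex all point to it with probability at most `(5 / 8) ^ d`.

All `p i` are estimated by the same `N` runs of sink popping.  A run treats the vertices one after
the other.  It scans the edges at a vertex for one directed away from it; if there is none, then the
directions of these edges are forgotten and the affected earlier vertices are scanned again.  After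
such a reset the orientation is again uniform among those in which the settled vertices are not
sinks, so whether the first scan of `i` succeeds is a trial with success probability `p i`, whatever
has happened before.  Directions are tossed only when they are looked at, which does not change
expectations.

A potential, the sum of the expected squared relative error of the product of the estimates and of a
multiple of the number of vertices that remain to be settled, is non-increasing in expectation.  For
`N` of the order of `n / ε ^ 2` it bounds, by Markov's inequality, both the probability of an error
above `ε / 2` and that of not finishing within a number of steps of the order of `(n / ε) ^ 2`.
-/

namespace SFO

open Finset

/-! ### The machine -/

theorem toOuterMeasure_uniformOfFintype_bool_bind {α : Type*} (f : Bool → PMF α) (s : Set α) :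
    ((PMF.uniformOfFintype Bool).bind f).toOuterMeasure s =
      2⁻¹ * ((f true).toOuterMeasure s + (f false).toOuterMeasure s) := by
  rw [PMF.toOuterMeasure_bind_apply, tsum_bool, add_comm, mul_add]
  simp only [PMF.uniformOfFintype_apply, Fintype.card_bool, Nat.cast_ofNat]

namespace Config

theorem run_succ (x : List ℕ) (t : ℕ) (c : Config) :
    run x (t + 1) c = (c.step x).bind (run x t) := rfl

theorem run_succ' (x : List ℕ) (t : ℕ) (c : Config) :
    run x (t + 1) c = (run x t c).bind (step x) := by
  induction t generalizing c with
  | zero => simp only [run, PMF.bind_pure, PMF.pure_bind]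
  | succ t ih =>
    rw [run_succ, run_succ, PMF.bind_bind]
    exact congrArg _ (funext ih)

theorem step_of_todo_eq_nil {x : List ℕ} : ∀ {c : Config}, c.todo = [] → c.step x = PMF.pure c
  | ⟨[], _⟩, _ => rfl

theorem run_succ_of_halted {x : List ℕ} {t : ℕ} {c : Config}
    (h : ∀ d ∈ (run x t c).support, d.todo = []) : run x (t + 1) c = run x t c := by
  have hstep : ∀ d, ∀ e, run x t c d * step x d e = run x t c d * PMF.pure d e := by
    intro d e
    by_cases hd : d ∈ (run x t c).support
    · rw [step_of_todo_eq_nil (h d hd)]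
    · rw [PMF.mem_support_iff, not_not] at hd
      rw [hd, zero_mul, zero_mul]
  calc run x (t + 1) c = (run x t c).bind PMF.pure := by
        ext e
        rw [run_succ', PMF.bind_apply, PMF.bind_apply]
        exact tsum_congr fun d => hstep d e
    _ = run x t c := PMF.bind_pure _

theorem run_of_todo_eq_nil {x : List ℕ} {c : Config} (h : c.todo = []) (t : ℕ) :
    run x t c = PMF.pure c := by
  induction t with
  | zero => rfl
  | succ t ih => rw [run_succ, step_of_todo_eq_nil h, PMF.pure_bind, ih]

theorem run_flip (x : List ℕ) (t r : ℕ) (k : List Program) (σ : Store) :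
    run x (t + 1) ⟨.instr (.flip r) :: k, σ⟩ =
      (PMF.uniformOfFintype Bool).bind fun c => run x t ⟨k, σ.setReg r c.toNat⟩ := by
  simp only [run_succ, step, Instr.exec, PMF.map, PMF.bind_bind, Function.comp_apply,
    PMF.pure_bind]

/-- From the configuration `c` the machine halts within `T` steps, all words stay at most `W`,
and the output lies in `A` with probability at least `q`: the judgement of a program logic for
randomised programs. -/
structure Reaches (x : List ℕ) (A : Set ℝ) (W T : ℕ) (q : ℝ) (c : Config) : Prop where
  halts : ∀ d ∈ (run x T c).support, d.todo = []
  bounded : ∀ t, ∀ d ∈ (run x t c).support, d.store.BoundedBy W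
  prob : ENNReal.ofReal q ≤
    (run x T c).toOuterMeasure {d | d.todo = [] ∧ d.store.output ∈ A}

namespace Reaches

variable {x : List ℕ} {A : Set ℝ} {W T : ℕ} {q : ℝ} {c : Config}

theorem mono {T' : ℕ} (h : c.Reaches x A W T q) (hT : T ≤ T') : c.Reaches x A W T' q := by
  induction hT with
  | refl => exact h
  | step _ ih =>
    refine ⟨?_, ih.bounded, ?_⟩ <;> rw [run_succ_of_halted ih.halts]
    exacts [ih.halts, ih.prob]

theorem mono_prob {q' : ℝ} (h : c.Reaches x A W T q) (hq : q' ≤ q) : c.Reaches x A W T q' :=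
  ⟨h.halts, h.bounded, (ENNReal.ofReal_le_ofReal hq).trans h.prob⟩

theorem of_halted {σ : Store} (hσ : σ.BoundedBy W) (hq : q ≤ A.indicator 1 σ.output) :
    Reaches x A W 0 q ⟨[], σ⟩ := by
  have hrun : ∀ t, run x t ⟨[], σ⟩ = PMF.pure ⟨[], σ⟩ := run_of_todo_eq_nil rfl
  refine ⟨?_, ?_, ?_⟩
  · rintro d hd
    rw [hrun, PMF.support_pure, Set.mem_singleton_iff] at hd
    rw [hd]
  · intro t d hd
    rw [hrun, PMF.support_pure, Set.mem_singleton_iff] at hd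
    rwa [hd]
  · rw [hrun, PMF.toOuterMeasure_pure_apply]
    by_cases hA : σ.output ∈ A
    · rw [if_pos ⟨rfl, hA⟩, ENNReal.ofReal_le_one]
      simpa only [Set.indicator_of_mem hA, Pi.one_apply] using hq
    · rw [Set.indicator_of_notMem hA] at hq
      rw [ENNReal.ofReal_of_nonpos hq]
      exact zero_le

theorem of_step {d : Config} (hs : c.step x = PMF.pure d) (hc : c.store.BoundedBy W)
    (h : d.Reaches x A W T q) : c.Reaches x A W (T + 1) q := by
  have hrun : ∀ t, run x (t + 1) c = run x t d := fun t => by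
    rw [run_succ, hs, PMF.pure_bind]
  refine ⟨?_, ?_, ?_⟩
  · rw [hrun]; exact h.halts
  · rintro (_ | t) e he
    · rwa [(PMF.mem_support_pure_iff c e).1 he]
    · exact h.bounded t e (hrun t ▸ he)
  · rw [hrun]; exact h.prob

theorem of_loop_zero {r : ℕ} {p : Program} {k : List Program} {σ : Store}
    (h : Reaches x A W T q ⟨k, σ⟩) (hr : σ.reg r = 0) (hσ : σ.BoundedBy W) :
    Reaches x A W (T + 1) q ⟨.loop r p :: k, σ⟩ :=
  of_step (by rw [step, if_neg (not_not.2 hr)]) hσ h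

theorem of_loop_ne_zero {r : ℕ} {p : Program} {k : List Program} {σ : Store}
    (h : Reaches x A W T q ⟨p :: .loop r p :: k, σ⟩) (hr : σ.reg r ≠ 0) (hσ : σ.BoundedBy W) :
    Reaches x A W (T + 1) q ⟨.loop r p :: k, σ⟩ :=
  of_step (by rw [step, if_pos hr]) hσ h

theorem of_flip {r : ℕ} {k : List Program} {σ : Store} {q' : ℝ} (hσ : σ.BoundedBy W)
    (hq : 0 ≤ q) (hq' : 0 ≤ q')
    (h1 : Reaches x A W T q ⟨k, σ.setReg r 1⟩) (h0 : Reaches x A W T q' ⟨k, σ.setReg r 0⟩) :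
    Reaches x A W (T + 1) ((q + q') / 2) ⟨.instr (.flip r) :: k, σ⟩ := by
  refine ⟨fun d hd => ?_, ?_, ?_⟩
  · rw [run_flip, PMF.mem_support_bind_iff] at hd
    obtain ⟨_ | _, -, hd⟩ := hd
    exacts [h0.halts d hd, h1.halts d hd]
  · rintro (_ | t) d hd
    · rwa [(PMF.mem_support_pure_iff _ d).1 hd]
    · rw [run_flip, PMF.mem_support_bind_iff] at hd
      obtain ⟨_ | _, -, hd⟩ := hd
      exacts [h0.bounded t d hd, h1.bounded t d hd]
  · rw [run_flip, toOuterMeasure_uniformOfFintype_bool_bind, div_eq_inv_mul,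
      ENNReal.ofReal_mul (by norm_num), ENNReal.ofReal_add hq hq',
      ENNReal.ofReal_inv_of_pos zero_lt_two, ENNReal.ofReal_ofNat]
    gcongr
    exacts [h1.prob, h0.prob]

end Reaches

end Config

/-! ### Straight-line programs -/

/-- The effect of an instruction other than a coin toss (a coin toss is treated as having no
effect). -/
def Instr.eval (x : List ℕ) : Instr → Store → Store
  | .const d c, σ => σ.setReg d c
  | .add d s t, σ => σ.setReg d (σ.reg s + σ.reg t)
  | .sub d s t, σ => σ.setReg d (σ.reg s - σ.reg t)
  | .mul d s t, σ => σ.setReg d (σ.reg s * σ.reg t)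
  | .div d s t, σ => σ.setReg d (σ.reg s / σ.reg t)
  | .load d s, σ => σ.setReg d (σ.mem (σ.reg s))
  | .store d s, σ => σ.setMem (σ.reg d) (σ.reg s)
  | .read d s, σ => σ.setReg d (x.getD (σ.reg s) 0)
  | .flip _, σ => σ

/-- The instruction is deterministic, i.e. not a coin toss, and its constant is at most `K`. -/
def Instr.IsDet (K : ℕ) : Instr → Prop
  | .const _ c => c ≤ K
  | .flip _ => False
  | _ => True

namespace Program

/-- The effect of a program without loops and coin tosses. -/
def eval (x : List ℕ) : Program → Store → Store
  | .instr i, σ => i.eval x σ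
  | .seq p q, σ => q.eval x (p.eval x σ)
  | .branch s p q, σ => if σ.reg s ≠ 0 then p.eval x σ else q.eval x σ
  | .loop _ _, σ => σ

/-- The program has no loops and no coin tosses, and its constants are at most `K`. -/
def IsStraight (K : ℕ) : Program → Prop
  | .instr i => i.IsDet K
  | .seq p q => p.IsStraight K ∧ q.IsStraight K
  | .branch _ p q => p.IsStraight K ∧ q.IsStraight K
  | .loop _ _ => False

/-- A bound for the number of steps of a program without loops. -/
def cost : Program → ℕ
  | .instr _ => 1
  | .seq p q => 1 + p.cost + q.cost
  | .branch _ p q => 1 + max p.cost q.cost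
  | .loop _ _ => 0

end Program

theorem Instr.exec_eq_pure {x : List ℕ} {K : ℕ} {i : Instr} (hi : i.IsDet K) (σ : Store) :
    i.exec x σ = PMF.pure (i.eval x σ) := by
  cases i <;> first | rfl | exact hi.elim

namespace Store.BoundedBy

variable {σ : Store} {W d y : ℕ}

theorem zero (W : ℕ) : Store.zero.BoundedBy W := ⟨fun _ => Nat.zero_le _, fun _ => Nat.zero_le _⟩

theorem mono {W' : ℕ} (h : σ.BoundedBy W) (hW : W ≤ W') : σ.BoundedBy W' :=
  ⟨fun i => (h.1 i).trans hW, fun i => (h.2 i).trans hW⟩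

theorem setReg (h : σ.BoundedBy W) (hy : y ≤ W) : (σ.setReg d y).BoundedBy W :=
  ⟨(Function.forall_update_iff σ.reg fun _ z => z ≤ W).2 ⟨hy, fun i _ => h.1 i⟩, h.2⟩

theorem setMem (h : σ.BoundedBy W) (hy : y ≤ W) : (σ.setMem d y).BoundedBy W :=
  ⟨h.1, (Function.forall_update_iff σ.mem fun _ z => z ≤ W).2 ⟨hy, fun i _ => h.2 i⟩⟩

end Store.BoundedBy

/-- The number `B` bounds all words of the input and of the store, and the number `K`, which itself
stands for the constants of a program. -/
structure Store.Fits (x : List ℕ) (K B : ℕ) (σ : Store) : Prop where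
  two_le : 2 ≤ B
  const_le : K ≤ B
  input_le : ∀ a, x.getD a 0 ≤ B
  bounded : σ.BoundedBy B

namespace Store.Fits

variable {x : List ℕ} {K B B' : ℕ} {σ : Store}

theorem mono (h : σ.Fits x K B) (hB : B ≤ B') : σ.Fits x K B' :=
  ⟨h.two_le.trans hB, h.const_le.trans hB, fun a => (h.input_le a).trans hB, h.bounded.mono hB⟩

theorem pow_le_pow (h : σ.Fits x K B) {i j : ℕ} (hij : i ≤ j) : B ^ 2 ^ i ≤ B ^ 2 ^ j :=
  Nat.pow_le_pow_right (by linarith [h.two_le]) (Nat.pow_le_pow_right two_pos hij)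

theorem le_pow (h : σ.Fits x K B) (i : ℕ) : B ≤ B ^ 2 ^ i := by
  simpa using h.pow_le_pow (Nat.zero_le i)

theorem instr_eval (h : σ.Fits x K B) {i : Instr} (hi : i.IsDet K) :
    (i.eval x σ).Fits x K (B ^ 2) := by
  have h2 := h.two_le
  have hB : B ≤ B ^ 2 := Nat.le_self_pow two_ne_zero B
  have hσ := h.bounded
  have hσ' := hσ.mono hB
  refine { h.mono hB with bounded := ?_ }
  cases i with
  | const d c => exact hσ'.setReg ((show c ≤ K from hi).trans (h.const_le.trans hB))
  | add d s t =>
    refine hσ'.setReg ?_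
    calc σ.reg s + σ.reg t ≤ B + B := add_le_add (hσ.1 s) (hσ.1 t)
      _ = 2 * B := (two_mul B).symm
      _ ≤ B ^ 2 := by rw [sq]; gcongr
  | sub d s t => exact hσ'.setReg ((Nat.sub_le _ _).trans (hσ'.1 s))
  | mul d s t => exact hσ'.setReg (sq B ▸ Nat.mul_le_mul (hσ.1 s) (hσ.1 t))
  | div d s t => exact hσ'.setReg ((Nat.div_le_self _ _).trans (hσ'.1 s))
  | load d s => exact hσ'.setReg (hσ'.2 _)
  | store d s => exact hσ'.setMem (hσ'.1 _)
  | read d s => exact hσ'.setReg ((h.input_le _).trans hB)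
  | flip d => exact hσ'

/-- Each instruction at most squares the largest word. -/
theorem eval {p : Program} (hp : p.IsStraight K) :
    ∀ {B : ℕ} {σ : Store}, σ.Fits x K B → (p.eval x σ).Fits x K (B ^ 2 ^ p.cost) := by
  induction p with
  | instr i => exact fun h => h.instr_eval hp
  | seq p q ihp ihq =>
    intro B σ h
    have hq := ihq hp.2 (ihp hp.1 h)
    rw [← pow_mul, ← pow_add] at hq
    exact hq.mono (h.pow_le_pow (by rw [Program.cost]; omega))
  | branch s p q ihp ihq =>
    intro B σ h
    rw [Program.eval]
    split_ifs
    · exact (ihp hp.1 h).mono (h.pow_le_pow (by rw [Program.cost]; omega))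
    · exact (ihq hp.2 h).mono (h.pow_le_pow (by rw [Program.cost]; omega))
  | loop s p => exact hp.elim

end Store.Fits

theorem Config.Reaches.of_eval {x : List ℕ} {A : Set ℝ} {W : ℕ} {q : ℝ} {K : ℕ} {p : Program}
    (hp : p.IsStraight K) : ∀ {B T : ℕ} {k : List Program} {σ : Store},
      σ.Fits x K B → B ^ 2 ^ p.cost ≤ W → Config.Reaches x A W T q ⟨k, p.eval x σ⟩ →
      Config.Reaches x A W (T + p.cost) q ⟨p :: k, σ⟩ := by
  induction p with
  | instr i =>
    intro B T k σ hσ hW h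
    refine .of_step ?_ (hσ.bounded.mono ((hσ.le_pow _).trans hW)) h
    rw [Config.step, Instr.exec_eq_pure hp, PMF.pure_map]
    rfl
  | seq p r ihp ihr =>
    intro B T k σ hσ hW h
    have hWr : (B ^ 2 ^ p.cost) ^ 2 ^ r.cost ≤ W := by
      rw [← pow_mul, ← pow_add]
      exact (hσ.pow_le_pow (by rw [Program.cost]; omega)).trans hW
    have hWp : B ^ 2 ^ p.cost ≤ W := (hσ.pow_le_pow (by rw [Program.cost]; omega)).trans hW
    have hr := ihr hp.2 (hσ.eval hp.1) hWr h
    have hpr := ihp hp.1 hσ hWp hr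
    refine (Reaches.of_step rfl (hσ.bounded.mono ((hσ.le_pow _).trans hW)) hpr).mono ?_
    rw [Program.cost]; omega
  | branch s p r ihp ihr =>
    intro B T k σ hσ hW h
    have hbranch {p' : Program} (hp' : p'.cost ≤ max p.cost r.cost)
        (hs : (if σ.reg s ≠ 0 then p else r) = p')
        (h' : Config.Reaches x A W (T + p'.cost) q ⟨p' :: k, σ⟩) :
        Config.Reaches x A W (T + (Program.branch s p r).cost) q ⟨.branch s p r :: k, σ⟩ := by
      have hσW := hσ.bounded.mono ((hσ.le_pow _).trans hW)
      refine (Reaches.of_step (by rw [Config.step, hs]) hσW h').mono ?_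
      rw [Program.cost]; omega
    rw [Program.eval] at h
    split_ifs at h with hs
    · refine hbranch (le_max_left _ _) (if_pos hs) (ihp hp.1 hσ ?_ h)
      exact (hσ.pow_le_pow (by rw [Program.cost]; omega)).trans hW
    · refine hbranch (le_max_right _ _) (if_neg hs) (ihr hp.2 hσ ?_ h)
      exact (hσ.pow_le_pow (by rw [Program.cost]; omega)).trans hW
  | loop s p => exact hp.elim

/-! ### A local lemma for sinks -/

namespace Multigraph

variable {V E : Type} {G : Multigraph V E}

theorem tail_update_of_ne [DecidableEq E] {σ : E → Bool} {e e' : E} (h : e' ≠ e) (c : Bool) :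
    G.tail (Function.update σ e c) e' = G.tail σ e' := by
  rw [tail, tail, Function.update_of_ne h]

/-- The list `l` consists of distinct edge ends at the vertex `v`. -/
structure EndsAt (G : Multigraph V E) (v : V) (l : List (E × Bool)) : Prop where
  nodup : l.Nodup
  ends_eq : ∀ d ∈ l, G.ends d.1 d.2 = v

namespace EndsAt

variable {v : V} {l l' : List (E × Bool)} {e : E} {b : Bool}

theorem sublist (h : G.EndsAt v l) (hl : l'.Sublist l) : G.EndsAt v l' :=
  ⟨h.nodup.sublist hl, fun d hd => h.ends_eq d (hl.subset hd)⟩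

theorem perm (h : G.EndsAt v l) (hl : l.Perm l') : G.EndsAt v l' :=
  ⟨hl.nodup_iff.1 h.nodup, fun d hd => h.ends_eq d (hl.mem_iff.2 hd)⟩

theorem init (h : G.EndsAt v (l ++ l')) : G.EndsAt v l := h.sublist (List.sublist_append_left l l')

theorem last (h : G.EndsAt v (l ++ [(e, b)])) : G.ends e b = v := h.ends_eq (e, b) (by simp)

theorem ne_of_mem (h : G.EndsAt v (l ++ [(e, b)])) (he : G.ends e (!b) ≠ v) :
    ∀ d ∈ l, d.1 ≠ e := by
  rintro ⟨e, b'⟩ hd rfl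
  rcases Bool.eq_or_eq_not b' b with rfl | rfl
  · exact (List.nodup_append.1 h.nodup).2.2 _ hd _ (List.mem_singleton_self _) rfl
  · exact he (h.init.ends_eq _ hd)

end EndsAt

theorem exists_endsAt_length_eq_degree [Finite E] (G : Multigraph V E) (v : V) :
    ∃ l, G.EndsAt v l ∧ (∀ d : E × Bool, G.ends d.1 d.2 = v → d ∈ l) ∧
      l.length = G.degree v := by
  classical
  have := Fintype.ofFinite E
  refine ⟨({d | G.ends d.1 d.2 = v} : Finset (E × Bool)).toList,
    ⟨nodup_toList _, fun d hd => by simpa using hd⟩, fun d hd => by simpa using hd, ?_⟩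
  rw [length_toList, degree, Nat.card_eq_fintype_card, Fintype.card_subtype]

theorem five_eighths_pow_degree_mul_le (hdeg : ∀ v, 3 ≤ G.degree v) (v : V) {x : ℝ}
    (hx : 0 ≤ x) : ((5 : ℝ) / 8) ^ G.degree v * x ≤ 125 / 512 * x := by
  gcongr
  calc ((5 : ℝ) / 8) ^ G.degree v ≤ (5 / 8) ^ 3 :=
        pow_le_pow_of_le_one (by norm_num) (by norm_num) (hdeg v)
    _ = 125 / 512 := by norm_num

variable [Fintype E] [DecidableEq E]

theorem sum_update_bool (e : E) (f : (E → Bool) → ℝ) :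
    ∑ σ, (f (Function.update σ e true) + f (Function.update σ e false)) = 2 * ∑ σ, f σ := by
  have flip : Function.Involutive fun σ : E → Bool => Function.update σ e (!σ e) := fun σ => by
    simp only [Function.update_self, Bool.not_not, Function.update_idem, Function.update_eq_self]
  have pair (σ : E → Bool) : f (Function.update σ e true) + f (Function.update σ e false) =
      f σ + f (Function.update σ e (!σ e)) := by
    nth_rewrite 3 [← Function.update_eq_self e σ]
    cases σ e
    · exact add_comm _ _
    · rfl
  have sum_flip : ∑ σ, f (Function.update σ e (!σ e)) = ∑ σ, f σ := Equiv.sum_comp flip.toPerm f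
  rw [sum_congr rfl fun σ _ => pair σ, sum_add_distrib, sum_flip, two_mul]

open Classical in
/-- The orientations in which no vertex of `S` is a sink. -/
noncomputable def noSinkIn (G : Multigraph V E) (S : Finset V) : Finset (E → Bool) :=
  univ.filter fun σ => ∀ u ∈ S, ∃ e, G.tail σ e = u

open Classical in
/-- The orientations in which no vertex of `S` is a sink and no edge from the list `l` is directed
away from `v`.  The list is that of the edge ends at `v` that are known to point to `v`. -/
noncomputable def noSinkInto (G : Multigraph V E) (S : Finset V) (v : V) (l : List (E × Bool)) :
    Finset (E → Bool) :=
  univ.filter fun σ => (∀ u ∈ S, ∃ e, G.tail σ e = u) ∧ ∀ d ∈ l, G.tail σ d.1 ≠ v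

theorem mem_noSinkIn {S : Finset V} {σ : E → Bool} :
    σ ∈ G.noSinkIn S ↔ ∀ u ∈ S, ∃ e, G.tail σ e = u := by
  simp only [noSinkIn, mem_filter_univ]

theorem mem_noSinkInto {S : Finset V} {v : V} {l : List (E × Bool)} {σ : E → Bool} :
    σ ∈ G.noSinkInto S v l ↔ (∀ u ∈ S, ∃ e, G.tail σ e = u) ∧ ∀ d ∈ l, G.tail σ d.1 ≠ v := by
  simp only [noSinkInto, mem_filter_univ]

theorem noSinkInto_nil (S : Finset V) (v : V) : G.noSinkInto S v [] = G.noSinkIn S := by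
  ext σ; simp [mem_noSinkIn, mem_noSinkInto]

theorem noSinkInto_perm {l l' : List (E × Bool)} (h : l.Perm l') (S : Finset V) (v : V) :
    G.noSinkInto S v l = G.noSinkInto S v l' := by
  ext σ; simp only [mem_noSinkInto, h.mem_iff]

theorem noSinkIn_empty : G.noSinkIn ∅ = univ := by
  ext σ; simp [mem_noSinkIn]

theorem card_noSinkIn_univ [Fintype V] : #(G.noSinkIn univ) = G.numSinkFree := by
  classical
  rw [numSinkFree, Nat.card_eq_fintype_card, Fintype.card_of_subtype (G.noSinkIn univ)]
  exact fun σ => by simp only [mem_noSinkIn, mem_univ, true_imp_iff, IsSinkFree]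

variable {S : Finset V} {v u : V} {l : List (E × Bool)} {e : E} {b : Bool}

theorem noSinkInto_append_of_loop (hb : G.ends e b = v) (hu : G.ends e (!b) = v) :
    G.noSinkInto S v (l ++ [(e, b)]) = ∅ := by
  refine eq_empty_of_forall_notMem fun σ hσ => (mem_noSinkInto.1 hσ).2 (e, b) (by simp) ?_
  rcases Bool.eq_or_eq_not (σ e) b with h | h <;> rwa [tail, h]

section DecidableEq

variable [DecidableEq V]

theorem sum_noSinkIn (hl : ∀ d : E × Bool, G.ends d.1 d.2 = v → d ∈ l) (S : Finset V)
    (f : (E → Bool) → ℝ) :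
    ∑ σ ∈ G.noSinkIn S, f σ =
      ∑ σ ∈ G.noSinkIn (insert v S), f σ + ∑ σ ∈ G.noSinkInto S v l, f σ := by
  classical
  have hv : G.noSinkIn (insert v S) = {σ ∈ G.noSinkIn S | ∃ e, G.tail σ e = v} := by
    ext σ
    simp only [mem_filter, mem_noSinkIn, forall_mem_insert]
    exact and_comm
  have hl' : G.noSinkInto S v l = {σ ∈ G.noSinkIn S | ¬ ∃ e, G.tail σ e = v} := by
    ext σ
    simp only [mem_filter, mem_noSinkIn, mem_noSinkInto, not_exists]
    exact and_congr_right fun _ => ⟨fun h e he => h (e, σ e) (hl _ he) he, fun h d _ => h d.1⟩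
  rw [hv, hl', sum_filter_add_sum_filter_not]

theorem card_noSinkIn (hl : ∀ d : E × Bool, G.ends d.1 d.2 = v → d ∈ l) (S : Finset V) :
    (#(G.noSinkIn S) : ℝ) = #(G.noSinkIn (insert v S)) + #(G.noSinkInto S v l) := by
  simpa only [sum_const, nsmul_eq_mul, mul_one] using sum_noSinkIn hl S fun _ => 1

/-- The edge `e` cannot be of use to a vertex of `S` other than `u`. -/
theorem update_mem_noSinkInto (hv : v ∉ S) (hb : G.ends e b = v) (hu : G.ends e (!b) = u)
    (he : ∀ d ∈ l, d.1 ≠ e) (σ : E → Bool) (c : Bool) :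
    Function.update σ e c ∈ G.noSinkInto (S.erase u) v l ↔ σ ∈ G.noSinkInto (S.erase u) v l := by
  have tail_ne (τ : E → Bool) {w : V} (hw : w ∈ S.erase u) : G.tail τ e ≠ w := by
    rintro rfl
    rcases Bool.eq_or_eq_not (τ e) b with h | h <;> rw [tail, h] at hw
    · exact hv (hb ▸ mem_of_mem_erase hw)
    · exact ne_of_mem_erase hw hu
  rw [mem_noSinkInto, mem_noSinkInto]
  refine and_congr (forall₂_congr fun w hw => exists_congr fun e' => ?_)
    (forall₂_congr fun d hd => by rw [tail_update_of_ne (he d hd)])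
  rcases eq_or_ne e' e with rfl | h
  · exact iff_of_false (tail_ne _ hw) (tail_ne _ hw)
  · rw [tail_update_of_ne h]

/-- If `e` points to `v`, then it saves its other end `u` from being a sink. -/
theorem mem_noSinkInto_append (hb : G.ends e b = v) (hu : G.ends e (!b) = u) (huv : u ≠ v)
    (σ : E → Bool) :
    σ ∈ G.noSinkInto S v (l ++ [(e, b)]) ↔ σ ∈ G.noSinkInto (S.erase u) v l ∧ σ e = !b := by
  have tail_ne : G.tail σ e ≠ v ↔ σ e = !b := by
    rcases Bool.eq_or_eq_not (σ e) b with h | h <;> simp [tail, h, hb, hu, huv]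
  simp only [mem_noSinkInto, List.forall_mem_append, List.forall_mem_singleton, tail_ne,
    ← and_assoc]
  refine and_congr_left fun he => and_congr_left fun _ => ⟨fun h w hw => h w (mem_of_mem_erase hw),
    fun h w hw => ?_⟩
  rcases eq_or_ne w u with rfl | hwu
  · exact ⟨e, by rw [tail, he, hu]⟩
  · exact h w (mem_erase.2 ⟨hwu, hw⟩)

theorem sum_noSinkInto_append (hv : v ∉ S) (hl : G.EndsAt v (l ++ [(e, b)]))
    (hu : G.ends e (!b) = u) (huv : u ≠ v) (f : (E → Bool) → ℝ) :
    ∑ σ ∈ G.noSinkInto S v (l ++ [(e, b)]),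
      (f (Function.update σ e true) + f (Function.update σ e false)) =
      ∑ σ ∈ G.noSinkInto (S.erase u) v l, f σ := by
  classical
  set X := G.noSinkInto (S.erase u) v l with hX
  have hupdate := update_mem_noSinkInto hv hl.last hu (hl.ne_of_mem (hu ▸ huv))
  have hfilter : G.noSinkInto S v (l ++ [(e, b)]) = ({σ | σ ∈ X ∧ σ e = !b} : Finset _) := by
    ext σ
    rw [mem_noSinkInto_append hl.last hu huv, mem_filter_univ]
  have hX_sum : ∑ σ ∈ X, f σ = ∑ σ, if σ ∈ X then f σ else 0 := by
    rw [← sum_filter, filter_univ_mem]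
  rw [hfilter, sum_filter, hX_sum]
  refine mul_left_cancel₀ (two_ne_zero' ℝ) ?_
  rw [← sum_update_bool e, ← sum_update_bool e]
  refine sum_congr rfl fun σ _ => ?_
  simp only [hX, hupdate, Function.update_self, Function.update_idem]
  by_cases h : σ ∈ G.noSinkInto (S.erase u) v l <;> cases b <;> simp [h]

theorem two_mul_card_noSinkInto_append (hv : v ∉ S) (hl : G.EndsAt v (l ++ [(e, b)]))
    (hu : G.ends e (!b) = u) (huv : u ≠ v) :
    2 * (#(G.noSinkInto S v (l ++ [(e, b)])) : ℝ) = #(G.noSinkInto (S.erase u) v l) := by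
  have h := sum_noSinkInto_append hv hl hu huv fun _ => 1
  simp only [sum_const, nsmul_eq_mul, mul_one] at h
  rw [← h, one_add_one_eq_two, mul_comm]

/-- Requiring a vertex of `S` with a neighbour outside `S` (or with a loop) not to be a sink costs
at most a factor `4 / 5`: the induction hypothesis of the local lemma. -/
def SinkRatioBound (G : Multigraph V E) (S : Finset V) : Prop :=
  ∀ e b, G.ends e b ∈ S → G.ends e (!b) ∉ S.erase (G.ends e b) →
    (#(G.noSinkIn (S.erase (G.ends e b))) : ℝ) ≤ 5 / 4 * #(G.noSinkIn S)

theorem card_noSinkInto_le_of_sinkRatioBound : ∀ {l : List (E × Bool)}, G.EndsAt v l →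
    ∀ {S : Finset V}, v ∉ S → (∀ S' ⊆ S, G.SinkRatioBound S') →
      (#(G.noSinkInto S v l) : ℝ) ≤ (5 / 8) ^ l.length * #(G.noSinkIn S) := by
  intro l
  induction l using List.reverseRecOn with
  | nil => intro _ S _ _; simp [noSinkInto_nil]
  | append_singleton l d ih =>
    obtain ⟨e, b⟩ := d
    intro hl S hv hS
    by_cases huv : G.ends e (!b) = v
    · rw [noSinkInto_append_of_loop hl.last huv, card_empty, Nat.cast_zero]
      positivity
    have herase : (#(G.noSinkIn (S.erase (G.ends e (!b)))) : ℝ) ≤ 5 / 4 * #(G.noSinkIn S) := by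
      by_cases hu : G.ends e (!b) ∈ S
      · refine hS S subset_rfl e (!b) hu ?_
        rw [Bool.not_not, hl.last]
        exact fun h => hv (mem_of_mem_erase h)
      · rw [erase_eq_of_notMem hu]
        linarith [Nat.cast_nonneg (α := ℝ) #(G.noSinkIn S)]
    have hcard := two_mul_card_noSinkInto_append hv hl rfl huv
    have hrec := ih hl.init (S := S.erase (G.ends e (!b))) (fun h => hv (mem_of_mem_erase h))
      (fun S' h => hS S' (h.trans (erase_subset _ _)))
    have hpow : (0 : ℝ) ≤ (5 / 8) ^ l.length := by positivity
    rw [List.length_append, List.length_singleton, pow_succ]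
    nlinarith [mul_le_mul_of_nonneg_left herase hpow]

/-- An edge from `v` to a vertex outside `S` points to `v` with probability one half, which is
`4 / 5` of the factor `5 / 8` of the other edges. -/
theorem card_noSinkInto_le_of_ends_notMem (hl : G.EndsAt v l) (hv : v ∉ S)
    (hS : ∀ S' ⊆ S, G.SinkRatioBound S') (he : (e, b) ∈ l) (hu : G.ends e (!b) ∉ S) :
    (#(G.noSinkInto S v l) : ℝ) ≤ (5 / 8) ^ l.length * (4 / 5) * #(G.noSinkIn S) := by
  have hperm : l.Perm (l.erase (e, b) ++ [(e, b)]) :=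
    (List.perm_cons_erase he).trans (List.perm_append_singleton _ _).symm
  have hl' := hl.perm hperm
  rw [noSinkInto_perm hperm, hperm.length_eq, List.length_append, List.length_singleton, pow_succ]
  by_cases huv : G.ends e (!b) = v
  · rw [noSinkInto_append_of_loop hl'.last huv, card_empty, Nat.cast_zero]
    positivity
  · have hcard := two_mul_card_noSinkInto_append hv hl' rfl huv
    rw [erase_eq_of_notMem hu] at hcard
    have := card_noSinkInto_le_of_sinkRatioBound hl'.init hv hS
    linarith

theorem sinkRatioBound (hdeg : ∀ v, 3 ≤ G.degree v) (S : Finset V) : G.SinkRatioBound S := by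
  induction S using Finset.strongInduction with
  | H S ih =>
    intro e b hu hv
    obtain ⟨l, hl, hmem, hlen⟩ := G.exists_endsAt_length_eq_degree (G.ends e b)
    have hinto := card_noSinkInto_le_of_ends_notMem hl (notMem_erase _ S)
      (fun S' h => ih S' (h.trans_ssubset (erase_ssubset hu))) (hmem (e, b) rfl) hv
    have hsplit := card_noSinkIn hmem (S.erase (G.ends e b))
    rw [insert_erase hu] at hsplit
    have := five_eighths_pow_degree_mul_le hdeg (G.ends e b)
      (Nat.cast_nonneg (α := ℝ) #(G.noSinkIn (S.erase (G.ends e b))))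
    rw [hlen] at hinto
    linarith

theorem half_card_noSinkIn_le_card_noSinkIn_insert (hdeg : ∀ v, 3 ≤ G.degree v) (hv : v ∉ S) :
    1 / 2 * (#(G.noSinkIn S) : ℝ) ≤ #(G.noSinkIn (insert v S)) := by
  obtain ⟨l, hl, hmem, hlen⟩ := G.exists_endsAt_length_eq_degree v
  have hinto := card_noSinkInto_le_of_sinkRatioBound hl hv fun S' _ => sinkRatioBound hdeg S'
  have hsplit := card_noSinkIn hmem S
  have hnonneg := Nat.cast_nonneg (α := ℝ) #(G.noSinkIn S)
  have := five_eighths_pow_degree_mul_le hdeg v hnonneg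
  rw [hlen] at hinto
  linarith

end DecidableEq

theorem card_noSinkInto_le (hdeg : ∀ v, 3 ≤ G.degree v) (hl : G.EndsAt v l) (hv : v ∉ S) :
    (#(G.noSinkInto S v l) : ℝ) ≤ (5 / 8) ^ l.length * #(G.noSinkIn S) := by
  classical
  exact card_noSinkInto_le_of_sinkRatioBound hl hv fun S' _ => sinkRatioBound hdeg S'

theorem card_noSinkIn_pos (hdeg : ∀ v, 3 ≤ G.degree v) (S : Finset V) :
    0 < (#(G.noSinkIn S) : ℝ) := by
  classical
  induction S using Finset.induction_on with
  | empty =>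
    rw [noSinkIn_empty, Nat.cast_pos]
    exact card_pos.2 univ_nonempty
  | insert v S hv ih => linarith [half_card_noSinkIn_le_card_noSinkIn_insert hdeg hv]

end Multigraph

namespace AdjList

variable {n m : ℕ} {G : Multigraph (Fin n) (Fin m)} (L : AdjList G)

theorem endsAt (v : Fin n) : G.EndsAt v (L.list v) :=
  ⟨L.nodup v, fun d hd => (L.mem_iff v d).1 hd⟩

theorem mem_list {v : Fin n} (d : Fin m × Bool) (hd : G.ends d.1 d.2 = v) : d ∈ L.list v :=
  (L.mem_iff v d).2 hd

theorem length_list (v : Fin n) : (L.list v).length = G.degree v := by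
  rw [Multigraph.degree, Nat.card_eq_fintype_card,
    Fintype.card_of_subtype (L.list v).toFinset fun d => by rw [List.mem_toFinset, L.mem_iff],
    List.toFinset_card_of_nodup (L.nodup v)]

end AdjList

/-! ### The sampler as a Markov chain -/

/-- The control state of the sampler.  The vertices that are known not to be sinks are those up to
`stage` other than `cur` that are not on the stack. -/
@[ext]
structure Ctl (n : ℕ) where
  /-- The number of runs that remain, including the current one. -/
  runs : ℕ
  /-- The vertex whose probability of not being a sink is being sampled. -/
  stage : Fin n
  /-- The vertex whose adjacency list is scanned or reset. -/
  cur : Fin n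
  /-- The vertices that have to be scanned later. -/
  stack : List (Fin n)
  /-- Whether no sink has been met since the stage began. -/
  first : Bool
  /-- Whether the edges at `cur` are being reset. -/
  resetting : Bool
  /-- The position in the adjacency list of `cur`. -/
  pos : ℕ
  /-- The number of successes of each vertex. -/
  count : Fin n → ℕ

namespace Ctl

variable {n : ℕ}

/-- The counts after a success; only a stage in which no sink has been met adds to them. -/
def countSuccess (s : Ctl n) : Fin n → ℕ :=
  Function.update s.count s.stage (s.count s.stage + s.first.toNat)

/-- A success in this state completes the run. -/
def EndsRun (s : Ctl n) : Prop := s.stack = [] ∧ ¬ s.stage.val + 1 < n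

instance (s : Ctl n) : Decidable s.EndsRun := inferInstanceAs (Decidable (_ ∧ _))

/-- The state after an edge directed away from `cur` has been found. -/
def success [NeZero n] (s : Ctl n) : Ctl n :=
  match s.stack with
  | u :: l => ⟨s.runs, s.stage, u, l, s.first, false, 0, s.countSuccess⟩
  | [] =>
    if h : s.stage.val + 1 < n then
      ⟨s.runs, ⟨s.stage.val + 1, h⟩, ⟨s.stage.val + 1, h⟩, [], true, false, 0, s.countSuccess⟩
    else ⟨s.runs - 1, 0, 0, [], true, false, 0, s.countSuccess⟩

/-- The stack after an edge between `cur` and `u` has been reset. -/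
def push (s : Ctl n) (u : Fin n) : List (Fin n) :=
  if u ≤ s.stage ∧ u ∉ s.stack then u :: s.stack else s.stack

/-- The state after `cur` has turned out to be a sink. -/
def sink (s : Ctl n) : Ctl n := { s with resetting := true, first := false }

/-- The state after the edge at position `j` with neighbour `u` has been reset. -/
def resetEdge (s : Ctl n) (u : Fin n) (j : ℕ) : Ctl n := { s with stack := s.push u, pos := j }

end Ctl

section Average

variable {m : ℕ}

/-- The average of a function over all orientations. -/
noncomputable def avg (f : (Fin m → Bool) → ℝ) : ℝ := (∑ σ, f σ) / 2 ^ m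

/-- The orientation `σ` with the revealed directions `π` put in. -/
def complete (π : Fin m → Option Bool) (σ : Fin m → Bool) : Fin m → Bool :=
  fun e => (π e).getD (σ e)

theorem avg_const (a : ℝ) : avg (fun _ : Fin m → Bool => a) = a := by
  simp [avg]

theorem avg_const_add (a : ℝ) (f : (Fin m → Bool) → ℝ) :
    avg (fun σ => a + f σ) = a + avg f := by
  conv_rhs => rw [← avg_const (m := m) a]
  rw [avg, avg, avg, ← add_div, sum_add_distrib]

theorem avg_nonneg {f : (Fin m → Bool) → ℝ} (hf : ∀ σ, 0 ≤ f σ) : 0 ≤ avg f :=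
  div_nonneg (sum_nonneg fun σ _ => hf σ) (by positivity)

theorem avg_mono {f g : (Fin m → Bool) → ℝ} (h : ∀ σ, f σ ≤ g σ) : avg f ≤ avg g :=
  div_le_div_of_nonneg_right (sum_le_sum fun σ _ => h σ) (by positivity)

theorem avg_add_div_two (f g : (Fin m → Bool) → ℝ) :
    avg (fun σ => (f σ + g σ) / 2) = (avg f + avg g) / 2 := by
  rw [avg, avg, avg, ← add_div, ← sum_add_distrib, ← sum_div, div_right_comm]

theorem avg_update (e : Fin m) (f : (Fin m → Bool) → ℝ) :
    avg f = (avg (fun σ => f (Function.update σ e true)) +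
      avg (fun σ => f (Function.update σ e false))) / 2 := by
  rw [avg, avg, avg, ← add_div, ← sum_add_distrib, Multigraph.sum_update_bool]
  ring

theorem complete_none (σ : Fin m → Bool) : complete (fun _ => none) σ = σ := rfl

theorem complete_update_of_eq_none {π : Fin m → Option Bool} {e : Fin m} (h : π e = none)
    (σ : Fin m → Bool) (c : Bool) :
    complete π (Function.update σ e c) = complete (Function.update π e (some c)) σ := by
  funext e'
  rcases eq_or_ne e' e with rfl | h'
  · simp [complete, h]
  · simp [complete, h']

theorem complete_update_none (π : Fin m → Option Bool) (e : Fin m) (σ : Fin m → Bool) (c : Bool) :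
    complete (Function.update π e none) (Function.update σ e c) =
      Function.update (complete π σ) e c := by
  funext e'
  rcases eq_or_ne e' e with rfl | h'
  · simp [complete]
  · simp [complete, h']

theorem avg_complete_of_eq_none {π : Fin m → Option Bool} {e : Fin m} (h : π e = none) (b : Bool)
    (f : (Fin m → Bool) → ℝ) :
    avg (fun σ => f (complete π σ)) =
      (avg (fun σ => f (complete (Function.update π e (some (true == b))) σ)) +
        avg (fun σ => f (complete (Function.update π e (some (false == b))) σ))) / 2 := by
  rw [avg_update e]
  simp only [complete_update_of_eq_none h]
  cases b
  · rw [add_comm]; rfl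
  · rfl

theorem avg_complete_update_none (π : Fin m → Option Bool) (e : Fin m)
    (f : (Fin m → Bool) → ℝ) :
    avg (fun σ => f (complete (Function.update π e none) σ)) =
      avg (fun σ => (f (Function.update (complete π σ) e true) +
        f (Function.update (complete π σ) e false)) / 2) := by
  rw [avg_update e, avg_add_div_two]
  simp only [complete_update_none]

end Average

section Chain

variable {n m : ℕ} [NeZero n]

/-- The state of the sampler after the edge `e` at `cur` has been found to have the direction
`b`. -/
def revealEdge (G : Multigraph (Fin n) (Fin m)) (s : Ctl n) (π : Fin m → Option Bool) (e : Fin m)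
    (b : Bool) : Ctl n × (Fin m → Option Bool) :=
  if G.ends e b = s.cur then
    (s.success, if s.EndsRun then fun _ => none else Function.update π e (some b))
  else ({ s with pos := s.pos + 1 }, Function.update π e (some b))

variable {G : Multigraph (Fin n) (Fin m)} (L : AdjList G)

/-- One step of the sampler; `π` holds the directions of the edges that have been revealed, `c` is
a random bit. -/
def lazyStep (s : Ctl n) (π : Fin m → Option Bool) (c : Bool) :
    Ctl n × (Fin m → Option Bool) :=
  if s.runs = 0 then (s, π)
  else if s.resetting then
    if s.pos = 0 then ({ s with resetting := false }, π)
    else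
      match (L.list s.cur)[s.pos - 1]? with
      | none => (s, π)
      | some d => (s.resetEdge (G.ends d.1 (!d.2)) (s.pos - 1), Function.update π d.1 none)
  else
    match (L.list s.cur)[s.pos]? with
    | none => (s.sink, π)
    | some d => revealEdge G s π d.1 ((π d.1).getD (c == d.2))

/-- The expectation, over `F` steps of the sampler, of `t` of the final control state plus `κ` for
every step that is not idle. -/
noncomputable def lazyValue (t : Ctl n → ℝ) (κ : ℝ) :
    ℕ → Ctl n → (Fin m → Option Bool) → ℝ
  | 0, s, _ => t s
  | F + 1, s, π => (if s.runs = 0 then 0 else κ) +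
      (lazyValue t κ F (lazyStep L s π true).1 (lazyStep L s π true).2 +
        lazyValue t κ F (lazyStep L s π false).1 (lazyStep L s π false).2) / 2

/-- The expectation of `f` after a success, when the directions are drawn at the beginning of every
run. -/
noncomputable def afterSuccess (f : Ctl n → (Fin m → Bool) → ℝ) (s : Ctl n) (σ : Fin m → Bool) :
    ℝ :=
  if s.EndsRun then avg (f s.success) else f s.success σ

/-- The analogue of `revealEdge` when the directions are drawn at the beginning of every run. -/
noncomputable def eagerReveal (G : Multigraph (Fin n) (Fin m)) (f : Ctl n → (Fin m → Bool) → ℝ)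
    (s : Ctl n) (e : Fin m) (σ : Fin m → Bool) : ℝ :=
  if G.tail σ e = s.cur then afterSuccess f s σ else f { s with pos := s.pos + 1 } σ

/-- The expectation of `f` after one step of the sampler, when the directions are drawn at the
beginning of every run. -/
noncomputable def eagerStep (f : Ctl n → (Fin m → Bool) → ℝ) (s : Ctl n) (σ : Fin m → Bool) : ℝ :=
  if s.runs = 0 then f s σ
  else if s.resetting then
    if s.pos = 0 then f { s with resetting := false } σ
    else
      match (L.list s.cur)[s.pos - 1]? with
      | none => f s σ
      | some d =>
        (f (s.resetEdge (G.ends d.1 (!d.2)) (s.pos - 1)) (Function.update σ d.1 true) +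
          f (s.resetEdge (G.ends d.1 (!d.2)) (s.pos - 1)) (Function.update σ d.1 false)) / 2
  else
    match (L.list s.cur)[s.pos]? with
    | none => f s.sink σ
    | some d => eagerReveal G f s d.1 σ

/-- The analogue of `lazyValue` when the directions are drawn at the beginning of every run. -/
noncomputable def eagerValue (t : Ctl n → ℝ) (κ : ℝ) : ℕ → Ctl n → (Fin m → Bool) → ℝ
  | 0, s, _ => t s
  | F + 1, s, σ => (if s.runs = 0 then 0 else κ) + eagerStep L (eagerValue t κ F) s σ

/-- The expectation of `f` when the directions that have not been revealed are drawn now. -/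
noncomputable def completionAvg (f : Ctl n → (Fin m → Bool) → ℝ)
    (x : Ctl n × (Fin m → Option Bool)) : ℝ :=
  avg fun σ => f x.1 (complete x.2 σ)

theorem completionAvg_revealEdge (f : Ctl n → (Fin m → Bool) → ℝ) (s : Ctl n)
    (π : Fin m → Option Bool) (e : Fin m) (b : Bool) :
    completionAvg f (revealEdge G s π e b) =
      avg fun σ => eagerReveal G f s e (complete (Function.update π e (some b)) σ) := by
  have htail (σ : Fin m → Bool) :
      G.tail (complete (Function.update π e (some b)) σ) e = G.ends e b := by
    simp [Multigraph.tail, complete]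
  simp only [completionAvg, revealEdge, eagerReveal, afterSuccess, htail]
  by_cases hout : G.ends e b = s.cur
  · by_cases hend : s.EndsRun
    · simp only [if_pos hout, if_pos hend, complete_none, avg_const]
    · simp only [if_pos hout, if_neg hend]
  · simp only [if_neg hout]

theorem completionAvg_revealEdge_getD (f : Ctl n → (Fin m → Bool) → ℝ) (s : Ctl n)
    (π : Fin m → Option Bool) (e : Fin m) (b : Bool) :
    (completionAvg f (revealEdge G s π e ((π e).getD (true == b))) +
        completionAvg f (revealEdge G s π e ((π e).getD (false == b)))) / 2 =
      avg fun σ => eagerReveal G f s e (complete π σ) := by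
  simp only [completionAvg_revealEdge]
  cases hπ : π e with
  | some c =>
    have hupdate : Function.update π e (some c) = π := by rw [← hπ, Function.update_eq_self]
    rw [Option.getD_some, Option.getD_some, hupdate, add_self_div_two]
  | none =>
    rw [Option.getD_none, Option.getD_none]
    exact (avg_complete_of_eq_none hπ b _).symm

theorem completionAvg_lazyStep (f : Ctl n → (Fin m → Bool) → ℝ) (s : Ctl n)
    (π : Fin m → Option Bool) :
    (completionAvg f (lazyStep L s π true) + completionAvg f (lazyStep L s π false)) / 2 =
      avg fun σ => eagerStep L f s (complete π σ) := by
  by_cases hruns : s.runs = 0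
  · simp only [lazyStep, eagerStep, if_pos hruns, add_self_div_two, completionAvg]
  by_cases hreset : s.resetting
  · by_cases hpos : s.pos = 0
    · simp only [lazyStep, eagerStep, if_neg hruns, if_pos hreset, if_pos hpos,
        add_self_div_two, completionAvg]
    · simp only [lazyStep, eagerStep, if_neg hruns, if_pos hreset, if_neg hpos]
      cases (L.list s.cur)[s.pos - 1]? with
      | none => rw [add_self_div_two, completionAvg]
      | some d => rw [add_self_div_two, completionAvg, avg_complete_update_none π d.1]
  · simp only [lazyStep, eagerStep, if_neg hruns, if_neg hreset]
    cases (L.list s.cur)[s.pos]? with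
    | none => rw [add_self_div_two, completionAvg]
    | some d => exact completionAvg_revealEdge_getD f s π d.1 d.2

theorem lazyValue_eq_completionAvg (t : Ctl n → ℝ) (κ : ℝ) (F : ℕ) : ∀ (s : Ctl n)
    (π : Fin m → Option Bool),
    lazyValue L t κ F s π = completionAvg (eagerValue L t κ F) (s, π) := by
  induction F with
  | zero => exact fun s π => (avg_const _).symm
  | succ F ih =>
    intro s π
    rw [lazyValue, ih, ih, completionAvg_lazyStep, ← avg_const_add]
    rfl

end Chain

/-! ### Mean and second moment of the estimate -/

section Moments

variable {N p r c : ℝ}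

/-- The expectation of `(c + X) / (N * p)` for a binomial `X` with parameters `r` and `p`. -/
noncomputable def moment₁ (N p r c : ℝ) : ℝ := (c + r * p) / (N * p)

/-- The expectation of `((c + X) / (N * p)) ^ 2` for a binomial `X` with parameters `r`, `p`. -/
noncomputable def moment₂ (N p r c : ℝ) : ℝ :=
  ((c + r * p) ^ 2 + r * (p * (1 - p))) / (N * p) ^ 2

theorem moment₁_harmonic (N p r c : ℝ) :
    p * moment₁ N p (r - 1) (c + 1) + (1 - p) * moment₁ N p (r - 1) c = moment₁ N p r c := by
  simp only [moment₁]; ring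

theorem moment₂_harmonic (N p r c : ℝ) :
    p * moment₂ N p (r - 1) (c + 1) + (1 - p) * moment₂ N p (r - 1) c = moment₂ N p r c := by
  simp only [moment₂]; ring

theorem moment₁_sq_le (hp : 0 ≤ p) (hp' : p ≤ 1) (hr : 0 ≤ r) :
    moment₁ N p r c ^ 2 ≤ moment₂ N p r c := by
  rw [moment₁, moment₂, div_pow]
  have : 0 ≤ r * (p * (1 - p)) := mul_nonneg hr (mul_nonneg hp (by linarith))
  gcongr
  linarith

theorem moment₁_zero_left (N p c : ℝ) : moment₁ N p 0 c = c / (N * p) := by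
  rw [moment₁, zero_mul, add_zero]

theorem moment₂_zero_left (N p c : ℝ) : moment₂ N p 0 c = (c / (N * p)) ^ 2 := by
  rw [moment₂, zero_mul, zero_mul, add_zero, add_zero, div_pow]

theorem moment₁_self_zero (hN : 0 < N) (hp : 0 < p) : moment₁ N p N 0 = 1 := by
  rw [moment₁, zero_add, div_self (mul_pos hN hp).ne']

theorem moment₂_self_zero_le_exp (hN : 0 < N) (hp : 1 / 2 ≤ p) :
    moment₂ N p N 0 ≤ Real.exp (1 / N) := by
  have hp0 : 0 < p := by linarith
  have hodds : (1 - p) / p ≤ 1 := by rw [div_le_one hp0]; linarith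
  calc moment₂ N p N 0 = (1 - p) / p * (1 / N) + 1 := by rw [moment₂]; field_simp; ring
    _ ≤ 1 * (1 / N) + 1 := by gcongr
    _ ≤ Real.exp (1 / N) := by rw [one_mul]; exact Real.add_one_le_exp _

end Moments

section ErrorSq

variable {n : ℕ} {N : ℝ} {p r c : Fin n → ℝ}

/-- The expectation of the squared relative error when the vertex `i` has had `c i` successes and
`r i` trials remain. -/
noncomputable def errorSq (N : ℝ) (p r c : Fin n → ℝ) : ℝ :=
  ∏ i, moment₂ N (p i) (r i) (c i) - 2 * ∏ i, moment₁ N (p i) (r i) (c i) + 1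

theorem prod_update_update (f : ℝ → ℝ → ℝ → ℝ) (p r c : Fin n → ℝ) (i : Fin n) (x y : ℝ) :
    ∏ j, f (p j) (Function.update r i x j) (Function.update c i y j) =
      f (p i) x y * ∏ j ∈ univ.erase i, f (p j) (r j) (c j) := by
  rw [← mul_prod_erase univ _ (mem_univ i), Function.update_self, Function.update_self]
  congr 1
  refine prod_congr rfl fun j hj => ?_
  rw [Function.update_of_ne (ne_of_mem_erase hj), Function.update_of_ne (ne_of_mem_erase hj)]

theorem errorSq_harmonic (N : ℝ) (p r c : Fin n → ℝ) (i : Fin n) :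
    p i * errorSq N p (Function.update r i (r i - 1)) (Function.update c i (c i + 1)) +
      (1 - p i) * errorSq N p (Function.update r i (r i - 1)) c = errorSq N p r c := by
  have expand (x y : ℝ) : errorSq N p (Function.update r i x) (Function.update c i y) =
      moment₂ N (p i) x y * ∏ j ∈ univ.erase i, moment₂ N (p j) (r j) (c j) -
        2 * (moment₁ N (p i) x y * ∏ j ∈ univ.erase i, moment₁ N (p j) (r j) (c j)) + 1 := by
    rw [errorSq, prod_update_update, prod_update_update]
  have hstay := expand (r i - 1) (c i)
  have hstart := expand (r i) (c i)
  rw [Function.update_eq_self] at hstay hstart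
  rw [Function.update_eq_self] at hstart
  rw [expand, hstay, hstart, ← moment₁_harmonic N (p i) (r i) (c i),
    ← moment₂_harmonic N (p i) (r i) (c i)]
  ring

theorem errorSq_nonneg (hp : ∀ i, 0 ≤ p i) (hp' : ∀ i, p i ≤ 1) (hr : ∀ i, 0 ≤ r i) :
    0 ≤ errorSq N p r c := by
  have hsq : (∏ i, moment₁ N (p i) (r i) (c i)) ^ 2 ≤ ∏ i, moment₂ N (p i) (r i) (c i) := by
    rw [← prod_pow]
    exact prod_le_prod (fun _ _ => sq_nonneg _) fun i _ => moment₁_sq_le (hp i) (hp' i) (hr i)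
  rw [errorSq]
  linarith [sq_nonneg (∏ i, moment₁ N (p i) (r i) (c i) - 1)]

theorem errorSq_zero (N : ℝ) (p c : Fin n → ℝ) :
    errorSq N p 0 c = (∏ i, c i / (N * p i) - 1) ^ 2 := by
  simp only [errorSq, Pi.zero_apply, moment₁_zero_left, moment₂_zero_left, prod_pow]
  ring

theorem errorSq_start_le (hN : 0 < N) (hp : ∀ i, 1 / 2 ≤ p i) (hp' : ∀ i, p i ≤ 1)
    (hnN : n ≤ N) : errorSq N p (fun _ => N) 0 ≤ 2 * (n / N) := by
  have hp0 (i : Fin n) : 0 < p i := by linarith [hp i]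
  have hmean : ∏ i, moment₁ N (p i) N 0 = 1 :=
    prod_eq_one fun i _ => moment₁_self_zero hN (hp0 i)
  have hmoment₂ : ∏ i, moment₂ N (p i) N 0 ≤ Real.exp (n / N) := by
    calc ∏ i, moment₂ N (p i) N 0 ≤ ∏ _i : Fin n, Real.exp (1 / N) :=
          prod_le_prod (fun i _ => (sq_nonneg _).trans (moment₁_sq_le (hp0 i).le (hp' i) hN.le))
            fun i _ => moment₂_self_zero_le_exp hN (hp i)
      _ = Real.exp (n / N) := by
          rw [prod_const, card_univ, Fintype.card_fin, ← Real.exp_nat_mul, mul_one_div]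
  have hexp : Real.exp (n / N) ≤ 1 + 2 * (n / N) := by
    have hnonneg : (0 : ℝ) ≤ n / N := by positivity
    have := Real.abs_exp_sub_one_le (x := (n : ℝ) / N)
      (by rw [abs_of_nonneg hnonneg]; exact (div_le_one hN).2 hnN)
    rw [abs_of_nonneg hnonneg] at this
    linarith [(abs_le.1 this).2]
  simp only [errorSq, Pi.zero_apply, hmean]
  linarith

end ErrorSq

/-! ### Error and load of a control state -/

namespace Ctl

variable {n : ℕ} {s : Ctl n}

/-- The number of trials of `i` that remain. -/
def trialsLeft (s : Ctl n) (i : Fin n) : ℝ :=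
  s.runs - if i < s.stage ∨ (i = s.stage ∧ s.first = false) then 1 else 0

/-- The vertices that are known not to be sinks. -/
def settled (s : Ctl n) : Finset (Fin n) :=
  univ.filter fun u => u ≤ s.stage ∧ u ∉ s.stack ∧ u ≠ s.cur

/-- The number of vertices that have to be settled in this run or a later one. -/
def load (s : Ctl n) : ℝ :=
  if s.runs = 0 then 0 else s.stack.length + (n - s.stage.val) + n * (s.runs - 1)

/-- The properties of the control state that hold throughout. -/
structure Valid (s : Ctl n) : Prop where
  nodup : s.stack.Nodup
  cur_notMem : s.cur ∉ s.stack
  le_stage : ∀ u ∈ s.stack, u ≤ s.stage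
  cur_le : s.cur ≤ s.stage
  stack_eq_nil : s.first = true → s.stack = []
  cur_eq : s.first = true → s.cur = s.stage
  first_of_resetting : s.resetting = true → s.first = false
  stage_eq_zero : s.runs = 0 → s.stage.val = 0
  first_of_runs : s.runs = 0 → s.first = true

/-- The expected squared relative error. -/
noncomputable def error (N : ℝ) (p : Fin n → ℝ) (s : Ctl n) : ℝ :=
  errorSq N p s.trialsLeft fun i => s.count i

theorem mem_settled {u : Fin n} :
    u ∈ s.settled ↔ u ≤ s.stage ∧ u ∉ s.stack ∧ u ≠ s.cur :=
  mem_filter_univ u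

theorem cur_notMem_settled (s : Ctl n) : s.cur ∉ s.settled := fun h => (mem_settled.1 h).2.2 rfl

theorem load_nonneg (s : Ctl n) : 0 ≤ s.load := by
  rw [load]
  split_ifs with h
  · exact le_rfl
  · have hruns : (1 : ℝ) ≤ s.runs := by exact_mod_cast Nat.one_le_iff_ne_zero.2 h
    have hstage : (s.stage.val : ℝ) ≤ n := by exact_mod_cast s.stage.2.le
    have : 0 ≤ (n : ℝ) * (s.runs - 1) := mul_nonneg n.cast_nonneg (by linarith)
    have : (0 : ℝ) ≤ s.stack.length := Nat.cast_nonneg _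
    linarith

theorem countSuccess_eq (s : Ctl n) : (fun i => (s.countSuccess i : ℝ)) =
    if s.first then Function.update (fun i => (s.count i : ℝ)) s.stage (s.count s.stage + 1)
    else fun i => (s.count i : ℝ) := by
  funext i
  cases hf : s.first
  · simp [countSuccess, hf]
  · simp only [countSuccess, hf, if_true, Function.update_apply, Bool.toNat_true]
    split_ifs <;> simp

theorem trialsLeft_sink (s : Ctl n) : s.sink.trialsLeft =
    if s.first then Function.update s.trialsLeft s.stage (s.trialsLeft s.stage - 1)
    else s.trialsLeft := by
  funext i
  cases hf : s.first
  · simp [trialsLeft, sink, hf]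
  · rcases eq_or_ne i s.stage with rfl | h
    · simp [trialsLeft, sink, hf]
    · simp [trialsLeft, sink, h]

theorem settled_resetEdge (s : Ctl n) (u : Fin n) (j : ℕ) :
    (s.resetEdge u j).settled = s.settled.erase u := by
  ext w
  simp only [mem_erase, mem_settled, resetEdge, push]
  by_cases hp : u ≤ s.stage ∧ u ∉ s.stack
  · rw [if_pos hp, List.mem_cons]; tauto
  · rw [if_neg hp]
    rcases eq_or_ne w u with rfl | hw
    · tauto
    · tauto

theorem load_resetEdge_le (s : Ctl n) (u : Fin n) (j : ℕ) :
    (s.resetEdge u j).load ≤ s.load + 1 := by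
  have hlength : ((s.push u).length : ℝ) ≤ s.stack.length + 1 := by
    rw [push]
    split_ifs <;> simp
  rw [load, load]
  change (if s.runs = 0 then 0 else _) ≤ _
  split_ifs
  · norm_num
  · change ((s.push u).length : ℝ) + (n - s.stage.val) + n * (s.runs - 1) ≤ _
    linarith

theorem stack_cases (s : Ctl n) :
    (∃ u l, s.stack = u :: l) ∨ (s.stack = [] ∧ s.stage.val + 1 < n) ∨ s.EndsRun := by
  cases h : s.stack with
  | nil => exact Or.inr ((em _).imp (⟨rfl, ·⟩) (⟨h, ·⟩))
  | cons u l => exact Or.inl ⟨u, l, rfl⟩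

theorem EndsRun.stage_add_one (h : s.EndsRun) : s.stage.val + 1 = n :=
  (Nat.succ_le_of_lt s.stage.2).antisymm (not_lt.1 h.2)

theorem cast_runs_sub_one (hr : s.runs ≠ 0) : ((s.runs - 1 : ℕ) : ℝ) = s.runs - 1 := by
  rw [Nat.cast_pred (Nat.pos_of_ne_zero hr)]

namespace Valid

theorem trialsLeft_eq_zero (h : s.Valid) (hr : s.runs = 0) : s.trialsLeft = 0 := by
  funext i
  simp [trialsLeft, hr, h.first_of_runs hr, Fin.lt_def, h.stage_eq_zero hr]

theorem trialsLeft_nonneg (h : s.Valid) (i : Fin n) : 0 ≤ s.trialsLeft i := by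
  by_cases hr : s.runs = 0
  · rw [h.trialsLeft_eq_zero hr, Pi.zero_apply]
  · have : (1 : ℝ) ≤ s.runs := by exact_mod_cast Nat.one_le_iff_ne_zero.2 hr
    rw [trialsLeft]
    split_ifs <;> linarith

theorem error_of_runs_eq_zero {N : ℝ} {p : Fin n → ℝ} (h : s.Valid) (hr : s.runs = 0) :
    s.error N p = (∏ i, (s.count i : ℝ) / (N * p i) - 1) ^ 2 := by
  rw [error, h.trialsLeft_eq_zero hr, errorSq_zero]

theorem settled_of_first (h : s.Valid) (hf : s.first = true) :
    s.settled = Iio s.stage := by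
  ext w
  simp only [mem_settled, mem_Iio, h.stack_eq_nil hf, h.cur_eq hf, List.not_mem_nil,
    not_false_iff, true_and, lt_iff_le_and_ne]

theorem first_eq_false {u : Fin n} {l : List (Fin n)} (h : s.Valid) (hst : s.stack = u :: l) :
    s.first = false :=
  Bool.eq_false_iff.2 fun hf => List.cons_ne_nil u l (hst ▸ h.stack_eq_nil hf)

theorem sink (h : s.Valid) (hr : s.runs ≠ 0) : s.sink.Valid where
  nodup := h.nodup
  cur_notMem := h.cur_notMem
  le_stage := h.le_stage
  cur_le := h.cur_le
  stack_eq_nil := by simp [Ctl.sink]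
  cur_eq := by simp [Ctl.sink]
  first_of_resetting _ := rfl
  stage_eq_zero := h.stage_eq_zero
  first_of_runs h' := (hr h').elim

theorem setPos (h : s.Valid) (j : ℕ) : Valid { s with pos := j } :=
  ⟨h.1, h.2, h.3, h.4, h.5, h.6, h.7, h.8, h.9⟩

theorem endReset (h : s.Valid) : Valid { s with resetting := false } :=
  ⟨h.1, h.2, h.3, h.4, h.5, h.6, nofun, h.8, h.9⟩

theorem resetEdge (h : s.Valid) (hs : s.resetting = true) {u : Fin n} (hu : u ≠ s.cur) (j : ℕ) :
    (s.resetEdge u j).Valid := by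
  have hf : (s.resetEdge u j).first = false := h.first_of_resetting hs
  have hpush (q : List (Fin n) → Prop) (hcons : u ≤ s.stage → u ∉ s.stack → q (u :: s.stack))
      (hstack : q s.stack) : q (s.push u) := by
    rw [push]
    split_ifs with hp
    exacts [hcons hp.1 hp.2, hstack]
  exact {
    nodup := hpush _ (fun _ h' => List.nodup_cons.2 ⟨h', h.nodup⟩) h.nodup
    cur_notMem := hpush (s.cur ∉ ·) (fun _ _ => List.not_mem_cons_of_ne_of_not_mem hu.symm
      h.cur_notMem) h.cur_notMem
    le_stage := hpush (∀ w ∈ ·, w ≤ s.stage) (fun h' _ => List.forall_mem_cons.2 ⟨h', h.le_stage⟩)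
      h.le_stage
    cur_le := h.cur_le
    stack_eq_nil := by simp [hf]
    cur_eq := by simp [hf]
    first_of_resetting := h.first_of_resetting
    stage_eq_zero := h.stage_eq_zero
    first_of_runs := h.first_of_runs }

end Valid

section Success

variable [NeZero n]

theorem success_of_cons {u : Fin n} {l : List (Fin n)} (h : s.stack = u :: l) :
    s.success = ⟨s.runs, s.stage, u, l, s.first, false, 0, s.countSuccess⟩ := by
  rw [success, h]

theorem success_of_lt (h : s.stack = []) (h' : s.stage.val + 1 < n) :
    s.success = ⟨s.runs, ⟨s.stage.val + 1, h'⟩, ⟨s.stage.val + 1, h'⟩, [], true, false, 0,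
      s.countSuccess⟩ := by
  rw [success, h]
  exact dif_pos h'

theorem success_of_endsRun (h : s.EndsRun) :
    s.success = ⟨s.runs - 1, 0, 0, [], true, false, 0, s.countSuccess⟩ := by
  rw [success, h.1]
  exact dif_neg h.2

theorem pos_success (s : Ctl n) : s.success.pos = 0 := by
  rcases s.stack_cases with ⟨u, l, hst⟩ | ⟨hst, hlt⟩ | hend
  exacts [by rw [success_of_cons hst], by rw [success_of_lt hst hlt],
    by rw [success_of_endsRun hend]]

theorem resetting_success (s : Ctl n) : s.success.resetting = false := by
  rcases s.stack_cases with ⟨u, l, hst⟩ | ⟨hst, hlt⟩ | hend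
  exacts [by rw [success_of_cons hst], by rw [success_of_lt hst hlt],
    by rw [success_of_endsRun hend]]

theorem count_success (s : Ctl n) : s.success.count = s.countSuccess := by
  rcases s.stack_cases with ⟨u, l, hst⟩ | ⟨hst, hlt⟩ | hend
  exacts [by rw [success_of_cons hst], by rw [success_of_lt hst hlt],
    by rw [success_of_endsRun hend]]

theorem load_success (hr : s.runs ≠ 0) : s.success.load = s.load - 1 := by
  rcases s.stack_cases with ⟨u, l, hst⟩ | ⟨hst, hlt⟩ | hend
  · rw [success_of_cons hst]
    simp only [load, if_neg hr, hst, List.length_cons]; push_cast; ring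
  · rw [success_of_lt hst hlt]
    simp only [load, if_neg hr, hst]; push_cast; simp only [List.length_nil]; ring
  · have hn : (n : ℝ) = s.stage.val + 1 := by exact_mod_cast hend.stage_add_one.symm
    rw [success_of_endsRun hend]
    simp only [load, if_neg hr, hend.1, cast_runs_sub_one hr, List.length_nil, Fin.val_zero,
      Nat.cast_zero]
    split_ifs with h1
    · have : (s.runs : ℝ) = 1 := by exact_mod_cast (by omega : s.runs = 1)
      rw [this, hn]; ring
    · rw [hn]; ring

theorem settled_success_of_endsRun (h : s.EndsRun) : s.success.settled = ∅ := by
  refine eq_empty_of_forall_notMem fun w hw => ?_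
  rw [mem_settled, success_of_endsRun h] at hw
  exact hw.2.2 (nonpos_iff_eq_zero.1 hw.1)

namespace Valid

theorem success (h : s.Valid) (hr : s.runs ≠ 0) : s.success.Valid := by
  rcases s.stack_cases with ⟨u, l, hst⟩ | ⟨hst, hlt⟩ | hend
  · have hnodup := h.nodup
    have hle := h.le_stage
    rw [hst] at hnodup hle
    rw [success_of_cons hst]
    exact {
      nodup := hnodup.of_cons
      cur_notMem := hnodup.notMem
      le_stage := fun w hw => hle w (List.mem_cons_of_mem _ hw)
      cur_le := hle u List.mem_cons_self
      stack_eq_nil := by simp [h.first_eq_false hst]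
      cur_eq := by simp [h.first_eq_false hst]
      first_of_resetting := by simp
      stage_eq_zero := fun h' => (hr h').elim
      first_of_runs := fun h' => (hr h').elim }
  · rw [success_of_lt hst hlt]
    constructor <;> simp [hr]
  · rw [success_of_endsRun hend]
    constructor <;> simp

theorem settled_success (h : s.Valid) (hend : ¬ s.EndsRun) :
    s.success.settled = insert s.cur s.settled := by
  ext w
  have hcur := h.cur_le
  rcases s.stack_cases with ⟨u, l, hst⟩ | ⟨hst, hlt⟩ | hend'
  · have hnodup := h.nodup
    have hnotMem := h.cur_notMem
    rw [mem_insert, mem_settled, mem_settled, success_of_cons hst]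
    simp only [hst, List.nodup_cons, List.mem_cons, not_or] at hnodup hnotMem ⊢
    rcases eq_or_ne w s.cur with rfl | hw
    · tauto
    · tauto
  · rw [mem_insert, mem_settled, mem_settled, success_of_lt hst hlt, hst]
    simp only [List.not_mem_nil, not_false_iff, true_and, ne_eq, Fin.le_def, Fin.ext_iff]
      at hcur ⊢
    omega
  · exact (hend hend').elim

theorem trialsLeft_success (h : s.Valid) (hr : s.runs ≠ 0) :
    s.success.trialsLeft = s.sink.trialsLeft := by
  funext i
  rcases s.stack_cases with ⟨u, l, hst⟩ | ⟨hst, hlt⟩ | hend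
  · rw [success_of_cons hst]
    simp only [trialsLeft, Ctl.sink, h.first_eq_false hst]
  · rw [success_of_lt hst hlt]
    simp only [trialsLeft, Ctl.sink]
    congr 1
    refine if_congr ?_ rfl rfl
    simp only [Fin.lt_def, Fin.ext_iff, Bool.true_eq_false, and_false, or_false, and_true]
    omega
  · have hi : i < s.stage ∨ i = s.stage := by
      have := hend.stage_add_one
      rw [Fin.lt_def, Fin.ext_iff]
      omega
    rw [success_of_endsRun hend]
    simp [trialsLeft, Ctl.sink, cast_runs_sub_one hr, hi]

variable (N : ℝ) (p : Fin n → ℝ)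

theorem error_harmonic (h : s.Valid) (hr : s.runs ≠ 0) (hf : s.first = true) :
    p s.stage * s.success.error N p + (1 - p s.stage) * s.sink.error N p = s.error N p := by
  have hcount : s.sink.count = s.count := rfl
  simp only [error, h.trialsLeft_success hr, trialsLeft_sink, hf, if_true, count_success,
    countSuccess_eq, hcount]
  exact errorSq_harmonic N p s.trialsLeft (fun i => (s.count i : ℝ)) s.stage

theorem error_success (h : s.Valid) (hr : s.runs ≠ 0) (hf : s.first = false) :
    s.success.error N p = s.error N p := by
  simp only [error, h.trialsLeft_success hr, trialsLeft_sink, hf, count_success, countSuccess_eq,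
    Bool.false_eq_true, if_false]

end Valid

end Success

theorem error_sink (N : ℝ) (p : Fin n → ℝ) (hf : s.first = false) :
    s.sink.error N p = s.error N p := by
  have hcount : s.sink.count = s.count := rfl
  simp only [error, trialsLeft_sink, hf, Bool.false_eq_true, if_false, hcount]

end Ctl

/-! ### The expected error and cost of the sampler -/

open Multigraph

section StageProb

variable {n m : ℕ} {G : Multigraph (Fin n) (Fin m)}

/-- The probability that the vertex `i` is not a sink, given that no earlier vertex is. -/
noncomputable def stageProb (G : Multigraph (Fin n) (Fin m)) (i : Fin n) : ℝ :=
  #(G.noSinkIn (Iic i)) / #(G.noSinkIn (Iio i))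

theorem stageProb_mul_card (hdeg : ∀ v, 3 ≤ G.degree v) (i : Fin n) :
    stageProb G i * #(G.noSinkIn (Iio i)) = #(G.noSinkIn (Iic i)) :=
  div_mul_cancel₀ _ (card_noSinkIn_pos hdeg _).ne'

theorem half_le_stageProb (hdeg : ∀ v, 3 ≤ G.degree v) (i : Fin n) : 1 / 2 ≤ stageProb G i := by
  rw [stageProb, le_div_iff₀ (card_noSinkIn_pos hdeg _), ← Iio_insert]
  exact half_card_noSinkIn_le_card_noSinkIn_insert hdeg (by simp)

theorem stageProb_pos (hdeg : ∀ v, 3 ≤ G.degree v) (i : Fin n) : 0 < stageProb G i :=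
  one_half_pos.trans_le (half_le_stageProb hdeg i)

theorem stageProb_le_one (hdeg : ∀ v, 3 ≤ G.degree v) (i : Fin n) : stageProb G i ≤ 1 := by
  rw [stageProb, div_le_one (card_noSinkIn_pos hdeg _), Nat.cast_le]
  refine card_le_card fun σ hσ => mem_noSinkIn.2 fun u hu => mem_noSinkIn.1 hσ u ?_
  exact mem_Iic.2 (mem_Iio.1 hu).le

end StageProb

section ScanLength

variable {n m : ℕ} {G : Multigraph (Fin n) (Fin m)} (L : AdjList G) {S : Finset (Fin n)} {v : Fin n}

/-- The number of steps of a scan of the vertex `v` under the orientation `σ`: one for every initial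
segment of the adjacency list that contains no edge directed away from `v`. -/
noncomputable def scanLength (v : Fin n) (σ : Fin m → Bool) : ℕ :=
  #{i ∈ range ((L.list v).length + 1) | ∀ d ∈ (L.list v).take i, G.tail σ d.1 ≠ v}

theorem lt_scanLength {σ : Fin m → Bool} {j : ℕ} (hj : j ≤ (L.list v).length)
    (hσ : ∀ d ∈ (L.list v).take j, G.tail σ d.1 ≠ v) : j < scanLength L v σ := by
  have hsub : range (j + 1) ⊆
      {i ∈ range ((L.list v).length + 1) | ∀ d ∈ (L.list v).take i, G.tail σ d.1 ≠ v} := by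
    refine fun i hi => mem_filter.2 ⟨?_, fun d hd => hσ d ?_⟩
    · rw [mem_range] at hi ⊢
      omega
    · exact List.take_subset_take_left _ (Nat.lt_succ_iff.1 (mem_range.1 hi)) hd
  exact Nat.succ_le_iff.1 ((card_range (j + 1)).symm.trans_le (card_le_card hsub))

theorem geom_five_eighths_le (k : ℕ) : ∑ i ∈ range k, ((5 : ℝ) / 8) ^ i ≤ 8 / 3 := by
  have : (0 : ℝ) ≤ (5 / 8) ^ k := by positivity
  rw [geom_sum_eq (by norm_num), div_le_iff_of_neg (by norm_num)]
  linarith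

theorem sum_scanLength_le (hdeg : ∀ v, 3 ≤ G.degree v) (hv : v ∉ S) :
    ∑ σ ∈ G.noSinkIn S, (scanLength L v σ : ℝ) ≤ 8 / 3 * #(G.noSinkIn S) := by
  have hcount (i : ℕ) (hi : i ∈ range ((L.list v).length + 1)) :
      ∑ σ ∈ G.noSinkIn S, (if ∀ d ∈ (L.list v).take i, G.tail σ d.1 ≠ v then (1 : ℝ) else 0) ≤
        (5 / 8) ^ i * #(G.noSinkIn S) := by
    have hlength : ((L.list v).take i).length = i := by
      have := mem_range.1 hi
      rw [List.length_take]
      omega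
    have hle := card_noSinkInto_le hdeg ((L.endsAt v).sublist (List.take_sublist i _)) hv
    rw [hlength] at hle
    refine le_of_eq_of_le ?_ hle
    rw [sum_boole]
    congr 2
    ext σ
    rw [mem_filter, mem_noSinkIn, mem_noSinkInto]
  calc ∑ σ ∈ G.noSinkIn S, (scanLength L v σ : ℝ)
      = ∑ i ∈ range ((L.list v).length + 1), ∑ σ ∈ G.noSinkIn S,
          (if ∀ d ∈ (L.list v).take i, G.tail σ d.1 ≠ v then (1 : ℝ) else 0) := by
        rw [sum_comm]
        simp only [scanLength, sum_boole]
    _ ≤ (∑ i ∈ range ((L.list v).length + 1), (5 / 8) ^ i) * #(G.noSinkIn S) := by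
        rw [sum_mul]
        exact sum_le_sum hcount
    _ ≤ 8 / 3 * #(G.noSinkIn S) :=
        mul_le_mul_of_nonneg_right (geom_five_eighths_le _) (Nat.cast_nonneg _)

theorem add_one_mul_five_eighths_pow_le {d : ℕ} (hd : 3 ≤ d) :
    ((d : ℝ) + 1) * (5 / 8) ^ d ≤ 125 / 128 := by
  induction d, hd using Nat.le_induction with
  | base => norm_num
  | succ d hd ih =>
    have h3 : (3 : ℝ) ≤ d := by exact_mod_cast hd
    have : (0 : ℝ) ≤ (5 / 8) ^ d := by positivity
    push_cast
    rw [pow_succ]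
    nlinarith

theorem length_add_one_mul_card_noSinkInto_le (hdeg : ∀ v, 3 ≤ G.degree v) (hv : v ∉ S) :
    ((L.list v).length + 1) * (#(G.noSinkInto S v (L.list v)) : ℝ) ≤
      125 / 128 * #(G.noSinkIn S) := by
  have hlength : 3 ≤ (L.list v).length := (hdeg v).trans_eq (L.length_list v).symm
  calc ((L.list v).length + 1) * (#(G.noSinkInto S v (L.list v)) : ℝ)
      ≤ ((L.list v).length + 1) * ((5 / 8) ^ (L.list v).length * #(G.noSinkIn S)) := by
        gcongr
        exact card_noSinkInto_le hdeg (L.endsAt v) hv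
    _ = ((L.list v).length + 1) * (5 / 8) ^ (L.list v).length * #(G.noSinkIn S) := by ring
    _ ≤ 125 / 128 * #(G.noSinkIn S) := by
        gcongr
        exact add_one_mul_five_eighths_pow_le hlength

end ScanLength

section EagerValue

variable {n m : ℕ} [NeZero n] {G : Multigraph (Fin n) (Fin m)} (L : AdjList G)

theorem eagerStep_nonneg {f : Ctl n → (Fin m → Bool) → ℝ} (hf : ∀ s σ, 0 ≤ f s σ) (s : Ctl n)
    (σ : Fin m → Bool) : 0 ≤ eagerStep L f s σ := by
  rw [eagerStep]
  split_ifs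
  · exact hf _ _
  · exact hf _ _
  · split
    exacts [hf _ _, div_nonneg (add_nonneg (hf _ _) (hf _ _)) zero_le_two]
  · split
    · exact hf _ _
    · rw [eagerReveal, afterSuccess]
      split_ifs
      exacts [avg_nonneg fun _ => hf _ _, hf _ _, hf _ _]

theorem eagerStep_mono {f g : Ctl n → (Fin m → Bool) → ℝ} (h : ∀ s σ, f s σ ≤ g s σ) (s : Ctl n)
    (σ : Fin m → Bool) : eagerStep L f s σ ≤ eagerStep L g s σ := by
  rw [eagerStep, eagerStep]
  split_ifs
  · exact h _ _
  · exact h _ _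
  · cases (L.list s.cur)[s.pos - 1]?
    exacts [h _ _, div_le_div_of_nonneg_right (add_le_add (h _ _) (h _ _)) zero_le_two]
  · cases (L.list s.cur)[s.pos]?
    · exact h _ _
    · simp only [eagerReveal, afterSuccess]
      split_ifs
      exacts [avg_mono fun _ => h _ _, h _ _, h _ _]

variable {t : Ctl n → ℝ} {κ : ℝ}

theorem eagerValue_nonneg (ht : ∀ s, 0 ≤ t s) (hκ : 0 ≤ κ) (F : ℕ) :
    ∀ (s : Ctl n) (σ : Fin m → Bool), 0 ≤ eagerValue L t κ F s σ := by
  induction F with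
  | zero => exact fun s _ => ht s
  | succ F ih =>
    refine fun s σ => add_nonneg ?_ (eagerStep_nonneg L ih s σ)
    split_ifs
    exacts [le_rfl, hκ]

theorem eagerValue_of_runs_eq_zero {s : Ctl n} (hs : s.runs = 0) (F : ℕ) (σ : Fin m → Bool) :
    eagerValue L t κ F s σ = t s := by
  induction F with
  | zero => rfl
  | succ F ih => rw [eagerValue, if_pos hs, eagerStep, if_pos hs, ih, zero_add]

theorem eagerValue_le_succ (ht : ∀ s, 0 ≤ t s) (hκ : 0 ≤ κ) (ht0 : ∀ s, s.runs ≠ 0 → t s = 0)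
    (F : ℕ) : ∀ (s : Ctl n) (σ : Fin m → Bool),
    eagerValue L t κ F s σ ≤ eagerValue L t κ (F + 1) s σ := by
  induction F with
  | zero =>
    intro s σ
    by_cases hs : s.runs = 0
    · rw [eagerValue_of_runs_eq_zero L hs, eagerValue_of_runs_eq_zero L hs]
    · exact (ht0 s hs).trans_le (eagerValue_nonneg L ht hκ _ _ _)
  | succ F ih => exact fun s σ => add_le_add_right (eagerStep_mono L ih s σ) _

variable {s : Ctl n} {σ : Fin m → Bool}

theorem eagerValue_scan_of_getElem?_eq_none (F : ℕ) (hr : s.runs ≠ 0) (hs : s.resetting = false)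
    (hd : (L.list s.cur)[s.pos]? = none) :
    eagerValue L t κ (F + 1) s σ = κ + eagerValue L t κ F s.sink σ := by
  rw [eagerValue, if_neg hr, eagerStep, if_neg hr, if_neg (by simp [hs]), hd]

theorem eagerValue_scan_of_getElem?_eq_some (F : ℕ) (hr : s.runs ≠ 0) (hs : s.resetting = false)
    {d : Fin m × Bool} (hd : (L.list s.cur)[s.pos]? = some d) :
    eagerValue L t κ (F + 1) s σ = κ + eagerReveal G (eagerValue L t κ F) s d.1 σ := by
  rw [eagerValue, if_neg hr, eagerStep, if_neg hr, if_neg (by simp [hs]), hd]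

theorem eagerValue_reset_of_pos_eq_zero (F : ℕ) (hr : s.runs ≠ 0) (hs : s.resetting = true)
    (hpos : s.pos = 0) :
    eagerValue L t κ (F + 1) s σ = κ + eagerValue L t κ F { s with resetting := false } σ := by
  rw [eagerValue, if_neg hr, eagerStep, if_neg hr, if_pos hs, if_pos hpos]

theorem eagerValue_reset_of_pos_eq_add_one (F : ℕ) (hr : s.runs ≠ 0) (hs : s.resetting = true)
    {j : ℕ} (hpos : s.pos = j + 1) {e : Fin m} {b : Bool} (hd : (L.list s.cur)[j]? = some (e, b)) :
    eagerValue L t κ (F + 1) s σ = κ +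
      (eagerValue L t κ F (s.resetEdge (G.ends e (!b)) j) (Function.update σ e true) +
        eagerValue L t κ F (s.resetEdge (G.ends e (!b)) j) (Function.update σ e false)) / 2 := by
  have hpos' : s.pos ≠ 0 := hpos ▸ j.succ_ne_zero
  have hj : s.pos - 1 = j := by omega
  rw [eagerValue, if_neg hr, eagerStep, if_neg hr, if_pos hs, if_neg hpos', hj, hd]

theorem eagerValue_setPos_add_le (ht : ∀ s, 0 ≤ t s) (hκ : 0 ≤ κ)
    (ht0 : ∀ s, s.runs ≠ 0 → t s = 0) (F : ℕ) (hr : s.runs ≠ 0) (hs : s.resetting = false) {j : ℕ}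
    (hj : j ≤ (L.list s.cur).length) :
    (∀ d ∈ (L.list s.cur).take j, G.tail σ d.1 ≠ s.cur) →
    eagerValue L t κ (F + 1) { s with pos := j } σ + κ * j ≤ κ * scanLength L s.cur σ +
      if ∃ e, G.tail σ e = s.cur then afterSuccess (eagerValue L t κ F) s σ
      else eagerValue L t κ F { s.sink with pos := (L.list s.cur).length } σ := by
  have hcost {i : ℕ} (hi : i ≤ (L.list s.cur).length)
      (hσ : ∀ d ∈ (L.list s.cur).take i, G.tail σ d.1 ≠ s.cur) :
      κ + κ * i ≤ κ * scanLength L s.cur σ := by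
    have : (i : ℝ) + 1 ≤ scanLength L s.cur σ := by exact_mod_cast lt_scanLength L hi hσ
    nlinarith
  induction hj using Nat.decreasingInduction with
  | self =>
    intro hσ
    have hno : ¬ ∃ e, G.tail σ e = s.cur := fun ⟨e, he⟩ =>
      hσ (e, σ e) (by rw [List.take_length]; exact L.mem_list (e, σ e) he) he
    rw [if_neg hno, eagerValue_scan_of_getElem?_eq_none
      (s := { s with pos := (L.list s.cur).length }) L F hr hs (List.getElem?_length _)]
    change κ + eagerValue L t κ F { s.sink with pos := (L.list s.cur).length } σ + _ ≤ _
    linarith [hcost le_rfl hσ]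
  | of_succ j hj ih =>
    intro hσ
    have hget : (L.list s.cur)[j]? = some (L.list s.cur)[j] := List.getElem?_eq_getElem hj
    rw [eagerValue_scan_of_getElem?_eq_some (s := { s with pos := j }) L F hr hs hget, eagerReveal]
    by_cases hout : G.tail σ (L.list s.cur)[j].1 = s.cur
    · rw [if_pos hout, if_pos ⟨_, hout⟩]
      change κ + afterSuccess (eagerValue L t κ F) s σ + _ ≤ _
      linarith [hcost hj.le hσ]
    · have hσ' : ∀ d ∈ (L.list s.cur).take (j + 1), G.tail σ d.1 ≠ s.cur := by
        rw [List.take_add_one, hget, Option.toList_some]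
        exact List.forall_mem_append.2 ⟨hσ, by simpa using hout⟩
      have hmono := eagerValue_le_succ L ht hκ ht0 F { s with pos := j + 1 } σ
      have hih := ih hσ'
      rw [if_neg hout]
      push_cast at hih
      linarith

end EagerValue

section Potential

variable {n m : ℕ} {G : Multigraph (Fin n) (Fin m)} {N w κ : ℝ} {s : Ctl n}

/-- The squared relative error of a final state, weighted by `w`. -/
noncomputable def finalError (G : Multigraph (Fin n) (Fin m)) (N w : ℝ) (s : Ctl n) : ℝ :=
  if s.runs = 0 then w * (∏ i, (s.count i : ℝ) / (N * stageProb G i) - 1) ^ 2 else 0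

/-- A bound for the expected final error and cost. -/
noncomputable def potential (G : Multigraph (Fin n) (Fin m)) (N w κ : ℝ) (s : Ctl n) : ℝ :=
  w * s.error N (stageProb G) + 200 * κ * s.load

theorem finalError_nonneg (hw : 0 ≤ w) (s : Ctl n) : 0 ≤ finalError G N w s := by
  rw [finalError]
  split_ifs
  exacts [mul_nonneg hw (sq_nonneg _), le_rfl]

theorem finalError_of_runs_ne_zero (hr : s.runs ≠ 0) : finalError G N w s = 0 :=
  if_neg hr

theorem finalError_of_runs_eq_zero (h : s.Valid) (hr : s.runs = 0) :
    finalError G N w s = potential G N w κ s := by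
  rw [finalError, if_pos hr, potential, h.error_of_runs_eq_zero hr, Ctl.load, if_pos hr, mul_zero,
    add_zero]

theorem potential_nonneg (hdeg : ∀ v, 3 ≤ G.degree v) (hw : 0 ≤ w) (hκ : 0 ≤ κ) (h : s.Valid) :
    0 ≤ potential G N w κ s :=
  add_nonneg
    (mul_nonneg hw (errorSq_nonneg (fun i => (stageProb_pos hdeg i).le) (stageProb_le_one hdeg)
      h.trialsLeft_nonneg))
    (mul_nonneg (by positivity) s.load_nonneg)

theorem card_mul_error [NeZero n] (L : AdjList G) (hdeg : ∀ v, 3 ≤ G.degree v) (N : ℝ)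
    (h : s.Valid) (hr : s.runs ≠ 0) :
    (#(G.noSinkIn (insert s.cur s.settled)) : ℝ) * s.success.error N (stageProb G) +
        #(G.noSinkInto s.settled s.cur (L.list s.cur)) * s.sink.error N (stageProb G) =
      #(G.noSinkIn s.settled) * s.error N (stageProb G) := by
  have hcard := card_noSinkIn (fun d hd => L.mem_list d hd) s.settled (v := s.cur)
  cases hf : s.first with
  | false => rw [h.error_success N _ hr hf, s.error_sink N _ hf, hcard]; ring
  | true =>
    have hprob := stageProb_mul_card hdeg s.stage
    rw [← Iio_insert, ← h.settled_of_first hf, ← h.cur_eq hf] at hprob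
    have hharmonic := h.error_harmonic N (stageProb G) hr hf
    rw [← h.cur_eq hf] at hharmonic
    have hinto : (#(G.noSinkInto s.settled s.cur (L.list s.cur)) : ℝ) =
        (1 - stageProb G s.cur) * #(G.noSinkIn s.settled) := by linarith
    rw [hinto, ← hprob, ← hharmonic]
    ring

end Potential

section EagerBound

variable {n m : ℕ} [NeZero n] {G : Multigraph (Fin n) (Fin m)} (L : AdjList G) {N w κ : ℝ} {F : ℕ}
  {s : Ctl n}

/-- The potential bounds the expected error and cost when a scan starts: averaged over the
orientations in which the settled vertices are not sinks. -/
def ScanBound (N w κ : ℝ) (F : ℕ) (s : Ctl n) : Prop :=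
  ∑ σ ∈ G.noSinkIn s.settled, eagerValue L (finalError G N w) κ F s σ ≤
    #(G.noSinkIn s.settled) * potential G N w κ s

/-- The potential, with the cost of the remaining resets added, bounds the expected error and cost
while the edges at a sink are being reset: averaged over the orientations in which, moreover, the
edges at `cur` that remain to be reset are directed towards `cur`. -/
def ResetBound (N w κ : ℝ) (F : ℕ) (s : Ctl n) : Prop :=
  ∑ σ ∈ G.noSinkInto s.settled s.cur ((L.list s.cur).take s.pos),
      eagerValue L (finalError G N w) κ F s σ ≤
    #(G.noSinkInto s.settled s.cur ((L.list s.cur).take s.pos)) *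
      (potential G N w κ s + 200 * κ * s.pos + κ * (s.pos + 1))

variable {L}

theorem scanBound_of_runs_eq_zero (h : s.Valid) (hr : s.runs = 0) : ScanBound L N w κ F s := by
  simp only [ScanBound, eagerValue_of_runs_eq_zero L hr, finalError_of_runs_eq_zero (κ := κ) h hr,
    sum_const, nsmul_eq_mul, le_rfl]

theorem scanBound_zero (hdeg : ∀ v, 3 ≤ G.degree v) (hw : 0 ≤ w) (hκ : 0 ≤ κ) (h : s.Valid)
    (hr : s.runs ≠ 0) : ScanBound L N w κ 0 s := by
  have := potential_nonneg (N := N) hdeg hw hκ h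
  simp only [ScanBound, eagerValue, finalError_of_runs_ne_zero hr, sum_const_zero]
  positivity

theorem resetBound_zero (hdeg : ∀ v, 3 ≤ G.degree v) (hw : 0 ≤ w) (hκ : 0 ≤ κ) (h : s.Valid)
    (hr : s.runs ≠ 0) : ResetBound L N w κ 0 s := by
  have := potential_nonneg (N := N) hdeg hw hκ h
  simp only [ResetBound, eagerValue, finalError_of_runs_ne_zero hr, sum_const_zero]
  positivity

theorem sum_afterSuccess_le (h : s.Valid) (hsuccess : ScanBound L N w κ F s.success) :
    ∑ σ ∈ G.noSinkIn (insert s.cur s.settled),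
        afterSuccess (eagerValue L (finalError G N w) κ F) s σ ≤
      #(G.noSinkIn (insert s.cur s.settled)) * potential G N w κ s.success := by
  rw [ScanBound] at hsuccess
  by_cases hend : s.EndsRun
  · rw [Ctl.settled_success_of_endsRun hend, noSinkIn_empty] at hsuccess
    have havg : avg (eagerValue L (finalError G N w) κ F s.success) ≤
        potential G N w κ s.success := by
      rw [avg, div_le_iff₀ (by positivity)]
      simpa [mul_comm] using hsuccess
    simp only [afterSuccess, if_pos hend, sum_const, nsmul_eq_mul]
    exact mul_le_mul_of_nonneg_left havg (Nat.cast_nonneg _)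
  · rw [h.settled_success hend] at hsuccess
    simpa only [afterSuccess, if_neg hend] using hsuccess

theorem sum_eagerValue_scan_le (hw : 0 ≤ w) (hκ : 0 ≤ κ) (hr : s.runs ≠ 0)
    (hs : s.resetting = false) (hpos : s.pos = 0) :
    ∑ σ ∈ G.noSinkIn s.settled, eagerValue L (finalError G N w) κ (F + 1) s σ ≤
      κ * ∑ σ ∈ G.noSinkIn s.settled, (scanLength L s.cur σ : ℝ) +
        (∑ σ ∈ G.noSinkIn (insert s.cur s.settled),
            afterSuccess (eagerValue L (finalError G N w) κ F) s σ +
          ∑ σ ∈ G.noSinkInto s.settled s.cur (L.list s.cur), eagerValue L (finalError G N w) κ F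
            { s.sink with pos := (L.list s.cur).length } σ) := by
  have hscan (σ : Fin m → Bool) := eagerValue_setPos_add_le (σ := σ) L
    (finalError_nonneg (G := G) (N := N) hw) hκ (fun _ => finalError_of_runs_ne_zero) F hr hs
    (Nat.zero_le _) (by simp)
  have hself : ({ s with pos := 0 } : Ctl n) = s := by rw [← hpos]
  have hexit (σ : Fin m → Bool) (hσ : σ ∈ G.noSinkIn (insert s.cur s.settled)) :
      ∃ e, G.tail σ e = s.cur :=
    mem_noSinkIn.1 hσ _ (mem_insert_self _ _)
  have hno_exit (σ : Fin m → Bool) (hσ : σ ∈ G.noSinkInto s.settled s.cur (L.list s.cur)) :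
      ¬ ∃ e, G.tail σ e = s.cur :=
    fun ⟨e, he⟩ => (mem_noSinkInto.1 hσ).2 (e, σ e) (L.mem_list (e, σ e) he) he
  simp only [hself, Nat.cast_zero, mul_zero, add_zero] at hscan
  refine (sum_le_sum fun σ _ => hscan σ).trans_eq ?_
  rw [sum_add_distrib, mul_sum]
  congr 1
  rw [sum_noSinkIn (v := s.cur) (fun d hd => L.mem_list d hd)]
  exact congrArg₂ _ (sum_congr rfl fun σ hσ => if_pos (hexit σ hσ))
    (sum_congr rfl fun σ hσ => if_neg (hno_exit σ hσ))

theorem scanBound_succ (hdeg : ∀ v, 3 ≤ G.degree v) (hw : 0 ≤ w) (hκ : 0 ≤ κ) (h : s.Valid)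
    (hr : s.runs ≠ 0) (hs : s.resetting = false) (hpos : s.pos = 0)
    (hsuccess : ScanBound L N w κ F s.success)
    (hsink : ResetBound L N w κ F { s.sink with pos := (L.list s.cur).length }) :
    ScanBound L N w κ (F + 1) s := by
  have hsink' : ∑ σ ∈ G.noSinkInto s.settled s.cur (L.list s.cur),
      eagerValue L (finalError G N w) κ F { s.sink with pos := (L.list s.cur).length } σ ≤
      #(G.noSinkInto s.settled s.cur (L.list s.cur)) * (potential G N w κ s.sink +
        200 * κ * (L.list s.cur).length + κ * ((L.list s.cur).length + 1)) := by
    have htake := hsink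
    change ∑ σ ∈ G.noSinkInto s.settled s.cur ((L.list s.cur).take (L.list s.cur).length), _ ≤
      (#(G.noSinkInto s.settled s.cur ((L.list s.cur).take (L.list s.cur).length)) : ℝ) * _ at htake
    rwa [List.take_length] at htake
  have hcur := s.cur_notMem_settled
  have hscan := mul_le_mul_of_nonneg_left (sum_scanLength_le L hdeg hcur) hκ
  have hreset := mul_le_mul_of_nonneg_left (length_add_one_mul_card_noSinkInto_le L hdeg hcur) hκ
  have hcard := card_noSinkIn (fun d hd => L.mem_list d hd) s.settled (v := s.cur)
  have herror := card_mul_error L hdeg N h hr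
  refine (sum_eagerValue_scan_le hw hκ hr hs hpos).trans
    ((add_le_add hscan (add_le_add (sum_afterSuccess_le h hsuccess) hsink')).trans ?_)
  have hload : s.sink.load = s.load := rfl
  simp only [potential, Ctl.load_success hr, hload]
  set O : ℝ := (#(G.noSinkIn s.settled) : ℝ)
  set O₁ : ℝ := (#(G.noSinkIn (insert s.cur s.settled)) : ℝ)
  set O₂ : ℝ := (#(G.noSinkInto s.settled s.cur (L.list s.cur)) : ℝ)
  have hκO : 0 ≤ κ * O := mul_nonneg hκ (Nat.cast_nonneg _)
  calc _ = w * (O₁ * s.success.error N (stageProb G) + O₂ * s.sink.error N (stageProb G)) +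
        200 * κ * s.load * (O₁ + O₂) - 200 * κ * (O₁ + O₂) + κ * (8 / 3 * O) +
          201 * (κ * (((L.list s.cur).length + 1) * O₂)) := by ring
    _ ≤ O * (w * s.error N (stageProb G) + 200 * κ * s.load) := by
        rw [herror, ← hcard]
        linarith

theorem resetBound_succ_of_pos_eq_zero (hr : s.runs ≠ 0) (hs : s.resetting = true)
    (hpos : s.pos = 0) (hscan : ScanBound L N w κ F { s with resetting := false }) :
    ResetBound L N w κ (F + 1) s := by
  have htake : G.noSinkInto s.settled s.cur ((L.list s.cur).take s.pos) = G.noSinkIn s.settled := by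
    rw [hpos, List.take_zero, noSinkInto_nil]
  have hpos' : (s.pos : ℝ) = 0 := by rw [hpos, Nat.cast_zero]
  rw [ResetBound, htake, hpos', sum_congr rfl fun σ _ =>
    eagerValue_reset_of_pos_eq_zero L F hr hs hpos, sum_add_distrib, sum_const, nsmul_eq_mul]
  refine (add_le_add_right hscan _).trans_eq ?_
  change _ + (#(G.noSinkIn s.settled) : ℝ) * potential G N w κ s = _
  ring

theorem resetBound_succ_of_pos_eq_add_one (hκ : 0 ≤ κ) (hr : s.runs ≠ 0)
    (hs : s.resetting = true) {j : ℕ} (hpos : s.pos = j + 1) {e : Fin m} {b : Bool}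
    (hd : (L.list s.cur)[j]? = some (e, b))
    (hreset : G.ends e (!b) ≠ s.cur → ResetBound L N w κ F (s.resetEdge (G.ends e (!b)) j)) :
    ResetBound L N w κ (F + 1) s := by
  have htake : (L.list s.cur).take s.pos = (L.list s.cur).take j ++ [(e, b)] := by
    rw [hpos, List.take_add_one, hd, Option.toList_some]
  have hends : G.EndsAt s.cur ((L.list s.cur).take j ++ [(e, b)]) :=
    htake ▸ (L.endsAt s.cur).sublist (List.take_sublist _ _)
  rw [ResetBound, htake]
  by_cases hloop : G.ends e (!b) = s.cur
  · simp [noSinkInto_append_of_loop hends.last hloop]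
  have hbound := hreset hloop
  rw [ResetBound, Ctl.settled_resetEdge] at hbound
  have hcurs : (s.resetEdge (G.ends e (!b)) j).cur = s.cur := rfl
  have hpos' : (s.resetEdge (G.ends e (!b)) j).pos = j := rfl
  rw [hcurs, hpos', ← two_mul_card_noSinkInto_append s.cur_notMem_settled hends rfl hloop,
    ← sum_noSinkInto_append s.cur_notMem_settled hends rfl hloop] at hbound
  have hload := Ctl.load_resetEdge_le s (G.ends e (!b)) j
  have herror : (s.resetEdge (G.ends e (!b)) j).error N (stageProb G) = s.error N (stageProb G) :=
    rfl
  rw [sum_congr rfl fun σ _ => eagerValue_reset_of_pos_eq_add_one L F hr hs hpos hd,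
    sum_add_distrib, sum_const, nsmul_eq_mul, ← sum_div, hpos]
  simp only [potential, herror] at hbound ⊢
  set O : ℝ := (#(G.noSinkInto s.settled s.cur ((L.list s.cur).take j ++ [(e, b)])) : ℝ)
  have hloadO := mul_le_mul_of_nonneg_left hload (mul_nonneg hκ (Nat.cast_nonneg _ : 0 ≤ O))
  push_cast
  linarith

theorem scanBound_and_resetBound (hdeg : ∀ v, 3 ≤ G.degree v) (hw : 0 ≤ w) (hκ : 0 ≤ κ) (F : ℕ) :
    ∀ s : Ctl n, s.Valid →
      (s.resetting = false → s.pos = 0 → ScanBound L N w κ F s) ∧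
      (s.resetting = true → s.runs ≠ 0 → s.pos ≤ (L.list s.cur).length →
        ResetBound L N w κ F s) := by
  induction F with
  | zero =>
    refine fun s h => ⟨fun _ _ => ?_, fun _ hr _ => resetBound_zero hdeg hw hκ h hr⟩
    by_cases hr : s.runs = 0
    exacts [scanBound_of_runs_eq_zero h hr, scanBound_zero hdeg hw hκ h hr]
  | succ F ih =>
    refine fun s h => ⟨fun hs hpos => ?_, fun hs hr hpos => ?_⟩
    · by_cases hr : s.runs = 0
      · exact scanBound_of_runs_eq_zero h hr
      · exact scanBound_succ hdeg hw hκ h hr hs hpos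
          ((ih _ (h.success hr)).1 s.resetting_success s.pos_success)
          ((ih _ ((h.sink hr).setPos _)).2 rfl hr le_rfl)
    · by_cases hpos0 : s.pos = 0
      · exact resetBound_succ_of_pos_eq_zero hr hs hpos0 ((ih _ h.endReset).1 rfl hpos0)
      · obtain ⟨j, hj⟩ := Nat.exists_eq_succ_of_ne_zero hpos0
        have hjlt : j < (L.list s.cur).length := by omega
        exact resetBound_succ_of_pos_eq_add_one hκ hr hs hj (List.getElem?_eq_getElem hjlt)
          fun hloop => (ih _ (h.resetEdge hs hloop j)).2 hs hr hjlt.le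

end EagerBound

/-! ### The program of the sampler -/

-- While the sampler runs, the registers up to `rRounds` hold the words that their names say (with
-- `m` in `rExponent`); the others are scratch registers.
local notation "rMantissa" => 0
local notation "rExponent" => 1
local notation "rShift" => 2
local notation "rVertices" => 3
local notation "rOne" => 4
local notation "rTwo" => 5
local notation "rThree" => 6
local notation "rFour" => 7
local notation "rRuns" => 8
local notation "rBase" => 9
local notation "rStage" => 10
local notation "rCur" => 11
local notation "rAddress" => 12
local notation "rHeight" => 13
local notation "rFirst" => 14
local notation "rResetting" => 15
local notation "rFuel" => 16
local notation "rTrials" => 17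
local notation "rPrecision" => 18
local notation "rRounds" => 19
local notation "rCoin" => 20
local notation "rEnd" => 21
local notation "rCell" => 22
local notation "rWord" => 23
local notation "rTest" => 24
local notation "rUnused" => 25

namespace Program

/-- A sequence of instructions followed by a program. -/
def block : List Instr → Program → Program
  | [], p => p
  | i :: l, p => .seq (.instr i) (block l p)

/-- A program without effect on the registers and cells in use. -/
def skip : Program := .instr (.const rUnused 0)

/-- Clear the scratch registers. -/
def clear : Program :=
  block [.const rCoin 0, .const rEnd 0, .const rCell 0, .const rWord 0, .const rTest 0]
    (.instr (.const rUnused 0))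

/-- Load the other end of the edge at `rAddress` and the memory address of its direction. -/
def fetch : Program :=
  block [.read rEnd rAddress, .add rCell rAddress rOne, .read rCell rCell, .add rCell rCell rBase,
    .mul rCell rCell rFour] (.instr (.add rCell rCell rThree))

/-- Load the tail of the fetched edge, drawing its direction if necessary. -/
def reveal : Program :=
  block [.load rWord rCell] (.branch rWord skip (.branch rCoin
    (block [.add rWord rCur rOne] (.instr (.store rCell rWord)))
    (block [.add rWord rEnd rOne] (.instr (.store rCell rWord)))))

/-- Continue with the vertex on the top of the stack. -/
def popStack : Program :=
  block [.sub rHeight rHeight rOne, .mul rCell rHeight rFour, .add rCell rCell rOne,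
    .load rCur rCell, .mul rCell rCur rFour, .const rWord 0] (.instr (.store rCell rWord))

/-- Continue with the first stage of the next run. -/
def nextRun : Program :=
  block [.const rStage 0, .const rCur 0, .sub rRuns rRuns rOne]
    (.instr (.add rBase rBase rExponent))

/-- Continue with the next stage, or with the next run after the last stage. -/
def nextStage : Program :=
  block [.add rStage rStage rOne, .const rFirst 1, .sub rTest rVertices rStage, .const rWord 0]
    (.branch rTest (.instr (.add rCur rStage rWord)) nextRun)

/-- Count a success of the current stage. -/
def countSuccess : Program :=
  block [.mul rCell rStage rFour, .add rCell rCell rTwo, .load rWord rCell,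
    .add rWord rWord rFirst] (.instr (.store rCell rWord))

/-- Go to the beginning of the list of the current vertex. -/
def rewind : Program := block [.add rCell rCur rThree] (.instr (.read rAddress rCell))

/-- The current vertex is not a sink. -/
def success : Program :=
  .seq countSuccess (.seq (.branch rHeight popStack nextStage) rewind)

/-- Compute the distance between the tail of the revealed edge and the current vertex. -/
def tailDistance : Program :=
  block [.add rTest rCur rOne, .sub rUnused rTest rWord, .sub rTest rWord rTest]
    (.instr (.add rTest rTest rUnused))

/-- Test whether the revealed edge is directed away from the current vertex. -/
def compareTail : Program :=
  .seq tailDistance (.branch rTest (.instr (.add rAddress rAddress rTwo)) success)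

/-- The current vertex is a sink. -/
def sink : Program := block [.const rResetting 1] (.instr (.const rFirst 0))

/-- Compute the length of the part of the current list that has not been scanned. -/
def remaining : Program :=
  block [.add rTest rCur rFour, .read rTest rTest] (.instr (.sub rTest rTest rAddress))

/-- Look at the next edge at the current vertex. -/
def scan : Program :=
  .seq remaining (.branch rTest (.seq fetch (.seq reveal compareTail)) sink)

/-- Forget the direction of the fetched edge. -/
def forget : Program := block [.const rWord 0] (.instr (.store rCell rWord))

/-- Put the fetched end on the stack. -/
def pushEnd : Program :=
  block [.store rCell rOne, .mul rTest rHeight rFour, .add rTest rTest rOne, .store rTest rEnd]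
    (.instr (.add rHeight rHeight rOne))

/-- Put the fetched end on the stack if it belongs there. -/
def pushStack : Program :=
  block [.add rTest rStage rOne, .sub rTest rTest rEnd] (.branch rTest
    (block [.mul rCell rEnd rFour, .load rWord rCell] (.branch rWord skip pushEnd)) skip)

/-- Compute the length of the part of the current list that has not been reset. -/
def preceding : Program :=
  block [.add rTest rCur rThree, .read rTest rTest] (.instr (.sub rTest rAddress rTest))

/-- Reset the edges at a sink, one at a time and the last one first. -/
def resetEdges : Program :=
  .seq preceding (.branch rTest
    (.seq (.instr (.sub rAddress rAddress rTwo)) (.seq fetch (.seq forget pushStack)))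
    (.instr (.const rResetting 0)))

/-- One step of the sampler, after a coin has been tossed. -/
def sampleStep : Program :=
  .seq (.branch rRuns (.branch rResetting resetEdges scan) skip) clear

end Program

@[simp]
theorem Store.reg_setReg (σ : Store) (d y i : ℕ) :
    (σ.setReg d y).reg i = if i = d then y else σ.reg i :=
  Function.update_apply _ _ _ _

@[simp]
theorem Store.mem_setReg (σ : Store) (d y : ℕ) : (σ.setReg d y).mem = σ.mem := rfl

@[simp]
theorem Store.reg_setMem (σ : Store) (d y : ℕ) : (σ.setMem d y).reg = σ.reg := rfl

@[simp]
theorem Store.mem_setMem (σ : Store) (d y : ℕ) :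
    (σ.setMem d y).mem = Function.update σ.mem d y := rfl

/-! ### The memory of the sampler -/

section Memory

variable {n m : ℕ}

/-- The word that stores the direction of the edge `e`: `0` while it is unknown, and otherwise
the successor of the tail. -/
def tailWord (G : Multigraph (Fin n) (Fin m)) (e : Fin m) : Option Bool → ℕ
  | none => 0
  | some b => (G.ends e b).val + 1

/-- The memory holds the stack, the counts and the revealed directions.  Every run has new cells
for the directions, which start at the cell `4 * base + 3`, so that nothing need be erased when a
run ends. -/
structure HoldsData (G : Multigraph (Fin n) (Fin m)) (base : ℕ) (stack : List (Fin n))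
    (count : Fin n → ℕ) (π : Fin m → Option Bool) (B : ℕ) (mem : ℕ → ℕ) : Prop where
  onStack : ∀ u : Fin n, mem (4 * u) = if u ∈ stack then 1 else 0
  stack : ∀ k v, stack.reverse[k]? = some v → mem (4 * k + 1) = v.val
  count : ∀ i : Fin n, mem (4 * i + 2) = count i
  edge : ∀ e : Fin m, mem (4 * (base + e) + 3) = tailWord G e (π e)
  fresh : ∀ k, base + m ≤ k → mem (4 * k + 3) = 0
  le : ∀ a, mem a ≤ B

namespace HoldsData

variable {G : Multigraph (Fin n) (Fin m)} {base B : ℕ} {stack : List (Fin n)}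
  {count : Fin n → ℕ} {π : Fin m → Option Bool} {mem : ℕ → ℕ} {u : Fin n}

theorem update_le {a w : ℕ} (hw : w ≤ B) (hmem : ∀ a, mem a ≤ B) (i : ℕ) :
    Function.update mem a w i ≤ B :=
  (Function.forall_update_iff mem fun _ z => z ≤ B).2 ⟨hw, fun j _ => hmem j⟩ i

theorem update_count (h : HoldsData G base stack count π B mem) (i : Fin n) {y : ℕ} (hy : y ≤ B) :
    HoldsData G base stack (Function.update count i y) π B (Function.update mem (4 * i + 2) y) where
  onStack v := by rw [Function.update_of_ne (by omega), h.onStack]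
  stack k v hk := by rw [Function.update_of_ne (by omega), h.stack k v hk]
  count j := by
    rcases eq_or_ne j i with rfl | hj
    · rw [Function.update_self, Function.update_self]
    · rw [Function.update_of_ne (by omega), Function.update_of_ne hj, h.count]
  edge e := by rw [Function.update_of_ne (by omega), h.edge]
  fresh k hk := by rw [Function.update_of_ne (by omega), h.fresh k hk]
  le := update_le hy h.le

theorem update_edge (h : HoldsData G base stack count π B mem) (hn : n ≤ B) (e : Fin m)
    (o : Option Bool) :
    HoldsData G base stack count (Function.update π e o) B
      (Function.update mem (4 * (base + e) + 3) (tailWord G e o)) where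
  onStack v := by rw [Function.update_of_ne (by omega), h.onStack]
  stack k v hk := by rw [Function.update_of_ne (by omega), h.stack k v hk]
  count j := by rw [Function.update_of_ne (by omega), h.count]
  edge e' := by
    rcases eq_or_ne e' e with rfl | he
    · rw [Function.update_self, Function.update_self]
    · rw [Function.update_of_ne (by omega), Function.update_of_ne he, h.edge]
  fresh k hk := by rw [Function.update_of_ne (by omega), h.fresh k hk]
  le := by
    refine update_le ?_ h.le
    cases o with
    | none => exact Nat.zero_le B
    | some b => exact (G.ends e b).2.trans_le hn

theorem top (h : HoldsData G base (u :: stack) count π B mem) :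
    mem (4 * stack.length + 1) = u :=
  h.stack _ _ (by rw [List.reverse_cons, ← List.length_reverse, List.getElem?_concat_length])

theorem pop (h : HoldsData G base (u :: stack) count π B mem) (hu : u ∉ stack) :
    HoldsData G base stack count π B (Function.update mem (4 * u) 0) where
  onStack v := by
    rcases eq_or_ne v u with rfl | hv
    · rw [Function.update_self, if_neg hu]
    · rw [Function.update_of_ne (by omega), h.onStack]
      simp only [List.mem_cons, hv, false_or]
  stack k v hk := by
    rw [Function.update_of_ne (by omega)]
    refine h.stack k v ?_
    rwa [List.reverse_cons, List.getElem?_append_left (List.getElem?_eq_some_iff.1 hk).1]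
  count j := by rw [Function.update_of_ne (by omega), h.count]
  edge e := by rw [Function.update_of_ne (by omega), h.edge]
  fresh k hk := by rw [Function.update_of_ne (by omega), h.fresh k hk]
  le := update_le (Nat.zero_le B) h.le

theorem push (h : HoldsData G base stack count π B mem) (hn : n ≤ B) (u : Fin n) :
    HoldsData G base (u :: stack) count π B
      (Function.update (Function.update mem (4 * u) 1) (4 * stack.length + 1) u) where
  onStack v := by
    rw [Function.update_of_ne (by omega)]
    rcases eq_or_ne v u with rfl | hv
    · rw [Function.update_self, if_pos List.mem_cons_self]
    · rw [Function.update_of_ne (by omega), h.onStack]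
      simp only [List.mem_cons, hv, false_or]
  stack k v hk := by
    rw [List.reverse_cons] at hk
    rcases eq_or_ne k stack.length with rfl | hne
    · rw [← List.length_reverse, List.getElem?_concat_length, Option.some_inj] at hk
      rw [Function.update_self, hk]
    · have hlt : k < stack.length := by
        have := (List.getElem?_eq_some_iff.1 hk).1
        rw [List.length_append, List.length_reverse, List.length_singleton] at this
        omega
      rw [List.getElem?_append_left (by rwa [List.length_reverse])] at hk
      rw [Function.update_of_ne (by omega), Function.update_of_ne (by omega), h.stack k v hk]
  count j := by rw [Function.update_of_ne (by omega), Function.update_of_ne (by omega), h.count]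
  edge e := by rw [Function.update_of_ne (by omega), Function.update_of_ne (by omega), h.edge]
  fresh k hk := by
    rw [Function.update_of_ne (by omega), Function.update_of_ne (by omega), h.fresh k hk]
  le := update_le (u.2.le.trans hn) (update_le (u.pos.trans_le hn) h.le)

theorem nextRun (h : HoldsData G base stack count π B mem) :
    HoldsData G (base + m) stack count (fun _ => none) B mem :=
  { h with
    edge := fun _ => h.fresh _ (by omega)
    fresh := fun _ hk => h.fresh _ (by omega) }

end HoldsData

end Memory

/-! ### Simulation of the sampler -/

section Simulation

variable {n m : ℕ} {G : Multigraph (Fin n) (Fin m)}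

/-- The input words hold the adjacency list. -/
structure Encodes (x : List ℕ) (L : AdjList G) : Prop where
  pointer : ∀ v ≤ n, x.getD (v + 3) 0 = L.start v
  neighbour : ∀ v j d, (L.list v)[j]? = some d →
    x.getD (L.start v + 2 * j) 0 = G.ends d.1 (!d.2)
  edge : ∀ v j d, (L.list v)[j]? = some d → x.getD (L.start v + 2 * j + 1) 0 = d.1

/-- The contents of the registers in the control state `s`, except for the scratch registers; the
number `N` of trials, the precision `Q`, the number `R` of rounds of the product loop and the
number `t` of remaining steps are not used by the sampler. -/
def registers (L : AdjList G) (N Q R t : ℕ) (s : Ctl n) : ℕ → ℕ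
  | rMantissa => 1
  | rExponent => m
  | rShift => 0
  | rVertices => n
  | rOne => 1
  | rTwo => 2
  | rThree => 3
  | rFour => 4
  | rRuns => s.runs
  | rBase => (N - s.runs) * m
  | rStage => s.stage
  | rCur => s.cur
  | rAddress => L.start s.cur + 2 * s.pos
  | rHeight => s.stack.length
  | rFirst => s.first.toNat
  | rResetting => s.resetting.toNat
  | rFuel => t
  | rTrials => N
  | rPrecision => Q
  | rRounds => R
  | _ => 0

/-- The store holds the given state of the sampler. -/
structure Represents (L : AdjList G) (N Q R t : ℕ) (σ : Store) (s : Ctl n)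
    (π : Fin m → Option Bool) : Prop where
  reg : ∀ i, i < rCoin ∨ rUnused < i → σ.reg i = registers L N Q R t s i
  data : HoldsData G ((N - s.runs) * m) s.stack s.count π (n + N + 1) σ.mem

theorem registers_of_lt (L : AdjList G) (N Q R t : ℕ) (s : Ctl n) {i : ℕ} (hi : rUnused < i) :
    registers L N Q R t s i = 0 := by
  obtain ⟨j, rfl⟩ := Nat.exists_eq_add_of_le' hi
  rfl

theorem AdjList.start_add_one (L : AdjList G) (v : Fin n) :
    L.start (v + 1) = L.start v + 2 * (L.list v).length := by
  have hfilter : ({u : Fin n | u.val < v.val + 1} : Finset (Fin n)) =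
      insert v ({u : Fin n | u.val < v.val} : Finset (Fin n)) := by
    ext u
    simp only [mem_filter_univ, mem_insert, Fin.ext_iff]
    omega
  rw [start, start, hfilter, sum_insert (by simp)]
  ring

theorem Encodes.pointer_add_one {x : List ℕ} {L : AdjList G} (hx : Encodes x L) (v : Fin n) :
    x.getD (v + 4) 0 = L.start v + 2 * (L.list v).length := by
  rw [← L.start_add_one, ← hx.pointer (v + 1) v.2]

variable {L : AdjList G} {N Q R t : ℕ} {σ τ : Store} {s s' : Ctl n} {π π' : Fin m → Option Bool}
  {x : List ℕ} {d : Fin m × Bool} {c : Bool}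

open Program

/-- The invariant of the control state that bounds the words of the machine.  In contrast to
`Ctl.Valid` it survives steps in which the revealed directions do not fit the state. -/
structure Ctl.InBounds (L : AdjList G) (N : ℕ) (s : Ctl n) : Prop where
  nodup : s.stack.Nodup
  stack_eq_nil : s.first = true → s.stack = []
  first_of_resetting : s.resetting = true → s.first = false
  pos_le : s.pos ≤ (L.list s.cur).length
  runs_le : s.runs ≤ N
  count_add_runs_le : ∀ i, s.count i + s.runs ≤
    N + if s.runs ≠ 0 ∧ (i < s.stage ∨ i = s.stage ∧ s.first = false) then 1 else 0

namespace Ctl.InBounds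

theorem count_le (hs : s.InBounds L N) (i : Fin n) : s.count i ≤ N := by
  have := hs.count_add_runs_le i
  split_ifs at this <;> omega

theorem countSuccess_add_runs_le (hs : s.InBounds L N) (hruns : s.runs ≠ 0) (i : Fin n) :
    s.countSuccess i + s.runs ≤ N + if i ≤ s.stage then 1 else 0 := by
  have hi := hs.count_add_runs_le i
  rcases eq_or_ne i s.stage with rfl | hne
  · rw [countSuccess, Function.update_self, if_pos le_rfl]
    cases hf : s.first <;> simp [hruns, hf] at hi ⊢ <;> omega
  · rw [countSuccess, Function.update_of_ne hne]
    simpa [hruns, hne, hne.le_iff_lt] using hi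

theorem sink (hs : s.InBounds L N) : s.sink.InBounds L N :=
  { hs with
    stack_eq_nil := fun h => nomatch h
    first_of_resetting := fun _ => rfl
    count_add_runs_le := fun i => (hs.count_add_runs_le i).trans (by
      change _ ≤ N + if s.runs ≠ 0 ∧ (i < s.stage ∨ i = s.stage ∧ false = false) then 1 else 0
      grind) }

theorem setPos (hs : s.InBounds L N) {j : ℕ} (hj : j ≤ (L.list s.cur).length) :
    { s with pos := j }.InBounds L N :=
  { hs with pos_le := hj }

theorem endReset (hs : s.InBounds L N) : { s with resetting := false }.InBounds L N :=
  { hs with first_of_resetting := fun h => nomatch h }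

theorem resetEdge (hs : s.InBounds L N) (hreset : s.resetting = true) (u : Fin n) {j : ℕ}
    (hj : j ≤ (L.list s.cur).length) : (s.resetEdge u j).InBounds L N :=
  { hs with
    nodup := by
      change (s.push u).Nodup
      rw [push]
      split_ifs with h
      exacts [List.nodup_cons.2 ⟨h.2, hs.nodup⟩, hs.nodup]
    stack_eq_nil := fun hfirst =>
      absurd (hfirst.symm.trans (hs.first_of_resetting hreset)) (by decide)
    pos_le := hj }

theorem success [NeZero n] (hs : s.InBounds L N) (hruns : s.runs ≠ 0) :
    s.success.InBounds L N := by
  have hcount := hs.countSuccess_add_runs_le hruns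
  rcases s.stack_cases with ⟨u, l, hstack⟩ | ⟨hstack, hlt⟩ | hend
  · have hfirst : s.first = false := by
      by_contra hfirst
      simp [hs.stack_eq_nil (Bool.eq_true_of_not_eq_false hfirst)] at hstack
    rw [success_of_cons hstack]
    exact
      { nodup := (List.nodup_cons.1 (hstack ▸ hs.nodup)).2
        stack_eq_nil := fun h => by simp [hfirst] at h
        first_of_resetting := fun h => nomatch h
        pos_le := Nat.zero_le _
        runs_le := hs.runs_le
        count_add_runs_le := fun i => by simpa [hruns, hfirst, le_iff_lt_or_eq] using hcount i }
  · rw [success_of_lt hstack hlt]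
    exact
      { nodup := List.nodup_nil
        stack_eq_nil := fun _ => rfl
        first_of_resetting := fun h => nomatch h
        pos_le := Nat.zero_le _
        runs_le := hs.runs_le
        count_add_runs_le := fun i => by
          simpa only [ne_eq, hruns, not_false_eq_true, true_and, Fin.lt_def, Fin.le_def,
            Nat.lt_succ_iff, Bool.true_eq_false, and_false, or_false] using hcount i }
  · rw [success_of_endsRun hend]
    exact
      { nodup := List.nodup_nil
        stack_eq_nil := fun _ => rfl
        first_of_resetting := fun h => nomatch h
        pos_le := Nat.zero_le _
        runs_le := (Nat.sub_le _ _).trans hs.runs_le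
        count_add_runs_le := fun i => by
          have hle : i ≤ s.stage := Nat.le_of_lt_succ (i.2.trans_eq hend.stage_add_one.symm)
          have := hcount i
          rw [if_pos hle] at this
          simp
          omega }

theorem lazyStep [NeZero n] (hs : s.InBounds L N) (π : Fin m → Option Bool) (c : Bool) :
    (lazyStep L s π c).1.InBounds L N := by
  rw [SFO.lazyStep]
  split_ifs with hruns hreset hpos
  · exact hs
  · exact hs.endReset
  · split
    · exact hs
    · exact hs.resetEdge hreset _ ((Nat.sub_le _ _).trans hs.pos_le)
  · split
    · exact hs.sink
    · next d hd =>
      rw [revealEdge]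
      split_ifs
      · exact hs.success hruns
      · exact hs.success hruns
      · exact hs.setPos (List.getElem?_eq_some_iff.1 hd).1

end Ctl.InBounds

theorem reg_eval_clear (x : List ℕ) (σ : Store) {i : ℕ} (hi : rCoin ≤ i ∧ i ≤ rUnused) :
    (clear.eval x σ).reg i = 0 := by
  simp only [clear, block, eval, Instr.eval, Store.reg_setReg]
  grind

namespace Represents

theorem congr (h : Represents L N Q R t σ s π)
    (hreg : ∀ i, i < rCoin ∨ rUnused < i → τ.reg i = σ.reg i) (hmem : τ.mem = σ.mem) :
    Represents L N Q R t τ s π :=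
  ⟨fun i hi => (hreg i hi).trans (h.reg i hi), hmem ▸ h.data⟩

theorem of_lt_rCoin (h : Represents L N Q R t σ s π)
    (hlt : ∀ i < rCoin, τ.reg i = registers L N Q R t s' i)
    (hgt : ∀ i, rUnused < i → τ.reg i = σ.reg i)
    (hdata : HoldsData G ((N - s'.runs) * m) s'.stack s'.count π' (n + N + 1) τ.mem) :
    Represents L N Q R t τ s' π' := by
  refine ⟨fun i hi => hi.elim (hlt i) fun hi => ?_, hdata⟩
  rw [hgt i hi, h.reg i (.inr hi), registers_of_lt _ _ _ _ _ _ hi, registers_of_lt _ _ _ _ _ _ hi]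

theorem setReg (h : Represents L N Q R t σ s π) {d : ℕ} (hd : rCoin ≤ d ∧ d ≤ rUnused) (y : ℕ) :
    Represents L N Q R t (σ.setReg d y) s π :=
  h.congr (fun i hi => by rw [Store.reg_setReg, if_neg (by omega)]) rfl

theorem eval_skip (h : Represents L N Q R t σ s π) :
    Represents L N Q R t (skip.eval x σ) s π :=
  h.setReg (by norm_num) 0

theorem eval_clear (h : Represents L N Q R t σ s π) :
    Represents L N Q R t (clear.eval x σ) s π := by
  refine h.congr (fun i hi => ?_) rfl
  simp only [clear, block, eval, Instr.eval, Store.reg_setReg]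
  grind

theorem eval_fetch (h : Represents L N Q R t σ s π) :
    Represents L N Q R t (fetch.eval x σ) s π := by
  refine h.congr (fun i hi => ?_) rfl
  simp only [fetch, block, eval, Instr.eval, Store.reg_setReg]
  grind

theorem reg_rEnd_eval_fetch (h : Represents L N Q R t σ s π) (hx : Encodes x L)
    (hd : (L.list s.cur)[s.pos]? = some d) :
    (fetch.eval x σ).reg rEnd = G.ends d.1 (!d.2) := by
  simp [fetch, block, eval, Instr.eval, h.reg, registers, ← hx.neighbour _ _ _ hd]

theorem reg_rCell_eval_fetch (h : Represents L N Q R t σ s π) (hx : Encodes x L)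
    (hd : (L.list s.cur)[s.pos]? = some d) :
    (fetch.eval x σ).reg rCell = 4 * ((N - s.runs) * m + d.1) + 3 := by
  have he := hx.edge _ _ _ hd
  simp [fetch, block, eval, Instr.eval, h.reg, registers, -List.getD_eq_getElem?_getD, he]
  ring

theorem eval_reveal_of_some (h : Represents L N Q R t σ s π) {e : Fin m} {o : Bool}
    (he : σ.reg rCell = 4 * ((N - s.runs) * m + e) + 3) (ho : π e = some o) :
    reveal.eval x σ = (σ.setReg rWord (G.ends e o + 1)).setReg rUnused 0 := by
  simp [reveal, block, skip, eval, Instr.eval, he, h.data.edge, ho, tailWord]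

theorem eval_reveal_of_none (h : Represents L N Q R t σ s π) (hd : G.ends d.1 d.2 = s.cur)
    (hc : σ.reg rCoin = c.toNat) (hend : σ.reg rEnd = G.ends d.1 (!d.2))
    (he : σ.reg rCell = 4 * ((N - s.runs) * m + d.1) + 3) (ho : π d.1 = none) :
    reveal.eval x σ =
      ((σ.setReg rWord 0).setReg rWord (tailWord G d.1 (some (c == d.2)))).setMem
        (4 * ((N - s.runs) * m + d.1) + 3) (tailWord G d.1 (some (c == d.2))) := by
  cases c <;> simp [reveal, block, eval, Instr.eval, he, h.data.edge, ho, tailWord, hc, hend,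
    h.reg, registers, hd]

theorem eval_reveal (h : Represents L N Q R t σ s π) (hd : G.ends d.1 d.2 = s.cur)
    (hc : σ.reg rCoin = c.toNat) (hend : σ.reg rEnd = G.ends d.1 (!d.2))
    (he : σ.reg rCell = 4 * ((N - s.runs) * m + d.1) + 3) :
    Represents L N Q R t (reveal.eval x σ) s
      (Function.update π d.1 (some ((π d.1).getD (c == d.2)))) := by
  cases ho : π d.1 with
  | some o =>
    rw [h.eval_reveal_of_some he ho, Option.getD_some, ← ho, Function.update_eq_self]
    exact (h.setReg (by norm_num) _).setReg (by norm_num) _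
  | none =>
    rw [h.eval_reveal_of_none hd hc hend he ho, Option.getD_none]
    exact ⟨((h.setReg (by norm_num) _).setReg (by norm_num) _).reg,
      h.data.update_edge (by omega) d.1 _⟩

theorem reg_rWord_eval_reveal (h : Represents L N Q R t σ s π) (hd : G.ends d.1 d.2 = s.cur)
    (hc : σ.reg rCoin = c.toNat) (hend : σ.reg rEnd = G.ends d.1 (!d.2))
    (he : σ.reg rCell = 4 * ((N - s.runs) * m + d.1) + 3) :
    (reveal.eval x σ).reg rWord = G.ends d.1 ((π d.1).getD (c == d.2)) + 1 := by
  cases ho : π d.1 with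
  | some o => rw [h.eval_reveal_of_some he ho]; rfl
  | none => rw [h.eval_reveal_of_none hd hc hend he ho]; rfl

theorem eval_countSuccess (h : Represents L N Q R t σ s π)
    (hle : s.count s.stage + s.first.toNat ≤ n + N + 1) :
    Represents L N Q R t (countSuccess.eval x σ) { s with count := s.countSuccess } π := by
  have hcell : s.stage.val * 4 + 2 = 4 * s.stage.val + 2 := by ring
  refine h.of_lt_rCoin (fun i hi => ?_) (fun i hi => ?_) ?_
  · interval_cases i <;> simp [countSuccess, block, eval, Instr.eval, h.reg, registers]
  · simp only [countSuccess, block, eval, Instr.eval, Store.reg_setReg, Store.reg_setMem]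
    grind
  · simpa [countSuccess, block, eval, Instr.eval, h.reg, registers, hcell, h.data.count,
      Ctl.countSuccess] using
      h.data.update_count s.stage hle

theorem eval_rewind (h : Represents L N Q R t (σ.setReg rAddress (L.start s.cur)) s π)
    (hx : Encodes x L) : Represents L N Q R t (rewind.eval x σ) s π := by
  have hcur : σ.reg rCur = s.cur := h.reg rCur (by norm_num)
  have hthree : σ.reg rThree = 3 := h.reg rThree (by norm_num)
  refine h.congr (fun i hi => ?_) rfl
  simp only [rewind, block, eval, Instr.eval, Store.reg_setReg, hcur, hthree, if_true,
    hx.pointer s.cur s.cur.2.le]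
  grind

theorem eval_popStack (h : Represents L N Q R t σ s π) {u : Fin n} {l : List (Fin n)}
    (hstack : s.stack = u :: l) (hu : u ∉ l) :
    Represents L N Q R t ((popStack.eval x σ).setReg rAddress (L.start u))
      { s with cur := u, stack := l, pos := 0 } π := by
  have hdata := hstack ▸ h.data
  have hlen : s.stack.length - 1 = l.length := by rw [hstack]; rfl
  refine h.of_lt_rCoin (fun i hi => ?_) (fun i hi => ?_) ?_
  · interval_cases i <;>
      simp [popStack, block, eval, Instr.eval, h.reg, registers, hlen, mul_comm _ 4, hdata.top]
  · simp only [popStack, block, eval, Instr.eval, Store.reg_setReg, Store.reg_setMem]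
    grind
  · simpa [popStack, block, eval, Instr.eval, h.reg, registers, hlen, mul_comm _ 4, hdata.top]
      using hdata.pop hu

theorem eval_nextStage_of_lt (h : Represents L N Q R t σ s π) (hlt : s.stage.val + 1 < n) :
    Represents L N Q R t ((nextStage.eval x σ).setReg rAddress (L.start (s.stage.val + 1)))
      { s with stage := ⟨s.stage.val + 1, hlt⟩, cur := ⟨s.stage.val + 1, hlt⟩, first := true,
               pos := 0 } π := by
  have hne : n - (s.stage.val + 1) ≠ 0 := by omega
  have hbranch : (nextStage.eval x σ) = ((((σ.setReg rStage (s.stage.val + 1)).setReg rFirst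
      1).setReg rTest (n - (s.stage.val + 1))).setReg rWord 0).setReg rCur (s.stage.val + 1) := by
    simp [nextStage, block, eval, Instr.eval, h.reg, registers, hne]
  rw [hbranch]
  refine h.of_lt_rCoin (fun i hi => ?_) (fun i hi => ?_) h.data
  · interval_cases i <;> simp [h.reg, registers]
  · simp only [Store.reg_setReg]
    grind

theorem eval_nextStage_of_not_lt [NeZero n] (h : Represents L N Q R t σ s π)
    (hlt : ¬ s.stage.val + 1 < n) (hruns : s.runs ≠ 0) (hle : s.runs ≤ N) :
    Represents L N Q R t ((nextStage.eval x σ).setReg rAddress (L.start 0))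
      { s with runs := s.runs - 1, stage := 0, cur := 0, first := true, pos := 0 }
      (fun _ => none) := by
  have heq : n - (s.stage.val + 1) = 0 := by omega
  have hbase : (N - (s.runs - 1)) * m = (N - s.runs) * m + m := by
    rw [show N - (s.runs - 1) = N - s.runs + 1 by omega, Nat.add_one_mul]
  have hbranch : nextStage.eval x σ = (nextRun.eval x ((((σ.setReg rStage (s.stage.val + 1)).setReg
      rFirst 1).setReg rTest 0).setReg rWord 0)) := by
    simp [nextStage, block, eval, Instr.eval, h.reg, registers, heq]
  rw [hbranch]
  refine h.of_lt_rCoin (fun i hi => ?_) (fun i hi => ?_) ?_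
  · interval_cases i <;> simp [nextRun, block, eval, Instr.eval, h.reg, registers, hbase]
  · simp only [nextRun, block, eval, Instr.eval, Store.reg_setReg]
    grind
  · exact hbase ▸ h.data.nextRun

theorem eval_success [NeZero n] (h : Represents L N Q R t σ s π) (hx : Encodes x L)
    (hs : s.InBounds L N) (hreset : s.resetting = false) (hruns : s.runs ≠ 0) :
    Represents L N Q R t (success.eval x σ) s.success
      (if s.EndsRun then fun _ => none else π) := by
  have hle : s.count s.stage + s.first.toNat ≤ n + N + 1 := by
    have := hs.count_le s.stage
    have := s.first.toNat_le
    omega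
  have hcount := h.eval_countSuccess (x := x) hle
  have hheight : (countSuccess.eval x σ).reg rHeight = s.stack.length :=
    hcount.reg rHeight (by norm_num)
  simp only [success, eval, hheight]
  rcases s.stack_cases with ⟨u, l, hstack⟩ | ⟨hstack, hlt⟩ | hend
  · rw [if_pos (by simp [hstack]), if_neg (by simp [Ctl.EndsRun, hstack]),
      Ctl.success_of_cons hstack, ← hreset]
    refine eval_rewind ?_ hx
    exact hcount.eval_popStack hstack (List.nodup_cons.1 (hstack ▸ hs.nodup)).1
  · rw [if_neg (by simp [hstack]), if_neg fun hend => hend.2 hlt, Ctl.success_of_lt hstack hlt]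
    have hnext := hcount.eval_nextStage_of_lt (x := x) hlt
    simp only [hstack, hreset] at hnext
    exact eval_rewind hnext hx
  · rw [if_neg (by simp [hend.1]), if_pos hend, Ctl.success_of_endsRun hend]
    have hnext := hcount.eval_nextStage_of_not_lt (x := x) hend.2 hruns hs.runs_le
    simp only [hend.1, hreset] at hnext
    exact eval_rewind hnext hx

theorem eval_tailDistance (h : Represents L N Q R t σ s π) :
    Represents L N Q R t (tailDistance.eval x σ) s π := by
  refine h.congr (fun i hi => ?_) rfl
  simp only [tailDistance, block, eval, Instr.eval, Store.reg_setReg]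
  grind

theorem reg_rTest_eval_tailDistance (h : Represents L N Q R t σ s π) {w : Fin n}
    (hw : σ.reg rWord = w + 1) : (tailDistance.eval x σ).reg rTest = (w - s.cur) + (s.cur - w) := by
  simp [tailDistance, block, eval, Instr.eval, h.reg, registers, hw]

theorem setReg_rAddress (h : Represents L N Q R t σ s π) (j : ℕ) :
    Represents L N Q R t (σ.setReg rAddress (L.start s.cur + 2 * j)) { s with pos := j } π := by
  refine h.of_lt_rCoin (fun i hi => ?_) (fun i hi => ?_) h.data
  · interval_cases i <;> simp [h.reg, registers]
  · rw [Store.reg_setReg, if_neg (by omega)]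

theorem eval_compareTail [NeZero n] (h : Represents L N Q R t σ s π) (hx : Encodes x L)
    (hs : s.InBounds L N) (hreset : s.resetting = false) (hruns : s.runs ≠ 0) {w : Fin n}
    (hw : σ.reg rWord = w + 1) :
    Represents L N Q R t (compareTail.eval x σ)
      (if w = s.cur then s.success else { s with pos := s.pos + 1 })
      (if w = s.cur then if s.EndsRun then fun _ => none else π else π) := by
  have hdist := h.eval_tailDistance (x := x)
  simp only [compareTail, eval, h.reg_rTest_eval_tailDistance hw]
  rcases eq_or_ne w s.cur with rfl | hcur
  · rw [if_neg (by omega), if_pos rfl, if_pos rfl]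
    exact hdist.eval_success hx hs hreset hruns
  · have hforward : (Instr.add rAddress rAddress rTwo).eval x (tailDistance.eval x σ) =
        (tailDistance.eval x σ).setReg rAddress (L.start s.cur + 2 * (s.pos + 1)) := by
      have hAddress : (tailDistance.eval x σ).reg rAddress = L.start s.cur + 2 * s.pos :=
        hdist.reg rAddress (by norm_num)
      have hTwo : (tailDistance.eval x σ).reg rTwo = 2 := hdist.reg rTwo (by norm_num)
      rw [Instr.eval, hAddress, hTwo, mul_add_one, add_assoc]
    rw [if_pos (by omega), if_neg hcur, if_neg hcur, hforward]
    exact hdist.setReg_rAddress (s.pos + 1)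

theorem eval_remaining (h : Represents L N Q R t σ s π) :
    Represents L N Q R t (remaining.eval x σ) s π := by
  refine h.congr (fun i hi => ?_) rfl
  simp only [remaining, block, eval, Instr.eval, Store.reg_setReg]
  grind

theorem reg_rTest_eval_remaining (h : Represents L N Q R t σ s π) (hx : Encodes x L) :
    (remaining.eval x σ).reg rTest = 2 * ((L.list s.cur).length - s.pos) := by
  simp [remaining, block, eval, Instr.eval, h.reg, registers, -List.getD_eq_getElem?_getD,
    hx.pointer_add_one]
  omega

theorem eval_sink (h : Represents L N Q R t σ s π) :
    Represents L N Q R t (sink.eval x σ) s.sink π := by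
  refine h.of_lt_rCoin (fun i hi => ?_) (fun i hi => ?_) h.data
  · interval_cases i <;> simp [sink, block, eval, Instr.eval, h.reg, registers, Ctl.sink]
  · simp only [sink, block, eval, Instr.eval, Store.reg_setReg]
    grind

theorem eval_scan [NeZero n] (h : Represents L N Q R t σ s π) (hx : Encodes x L)
    (hs : s.InBounds L N) (hreset : s.resetting = false) (hruns : s.runs ≠ 0)
    (hc : σ.reg rCoin = c.toNat) :
    Represents L N Q R t (scan.eval x σ) (lazyStep L s π c).1 (lazyStep L s π c).2 := by
  have hremaining := h.eval_remaining (x := x)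
  simp only [scan, eval, h.reg_rTest_eval_remaining hx]
  rw [lazyStep, if_neg hruns, hreset, if_neg Bool.false_ne_true]
  cases hd : (L.list s.cur)[s.pos]? with
  | none =>
    have := List.getElem?_eq_none_iff.1 hd
    rw [if_neg (by omega)]
    exact hremaining.eval_sink
  | some d =>
    have := (List.getElem?_eq_some_iff.1 hd).1
    have hends := (L.endsAt s.cur).ends_eq d (List.mem_of_getElem? hd)
    have hfetch := hremaining.eval_fetch (x := x)
    have hcoin : (fetch.eval x (remaining.eval x σ)).reg rCoin = c.toNat := hc
    have hend := hremaining.reg_rEnd_eval_fetch hx hd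
    have hcell := hremaining.reg_rCell_eval_fetch hx hd
    rw [if_pos (by omega)]
    have hreveal := hfetch.eval_reveal (x := x) hends hcoin hend hcell
    have hcompare := hreveal.eval_compareTail hx hs hreset hruns
      (hfetch.reg_rWord_eval_reveal hends hcoin hend hcell)
    simp only [revealEdge]
    split_ifs at hcompare ⊢ <;> exact hcompare

theorem eval_forget (h : Represents L N Q R t σ s π) {e : Fin m}
    (he : σ.reg rCell = 4 * ((N - s.runs) * m + e) + 3) :
    Represents L N Q R t (forget.eval x σ) s (Function.update π e none) := by
  have hforget : forget.eval x σ =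
      (σ.setReg rWord 0).setMem (4 * ((N - s.runs) * m + e) + 3) (tailWord G e none) := by
    simp [forget, block, eval, Instr.eval, he, tailWord]
  rw [hforget]
  exact ⟨(h.setReg (by norm_num) 0).reg, h.data.update_edge (by omega) e none⟩

theorem eval_pushEnd (h : Represents L N Q R t σ s π) {u : Fin n} (hend : σ.reg rEnd = u)
    (hcell : σ.reg rCell = 4 * u) :
    Represents L N Q R t (pushEnd.eval x σ) { s with stack := u :: s.stack } π := by
  refine h.of_lt_rCoin (fun i hi => ?_) (fun i hi => ?_) ?_
  · interval_cases i <;> simp [pushEnd, block, eval, Instr.eval, h.reg, registers]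
  · simp only [pushEnd, block, eval, Instr.eval, Store.reg_setReg, Store.reg_setMem]
    grind
  · simpa [pushEnd, block, eval, Instr.eval, h.reg, registers, hend, hcell, mul_comm _ 4] using
      h.data.push (by omega) u

theorem eval_pushStack (h : Represents L N Q R t σ s π) {u : Fin n} (hend : σ.reg rEnd = u) :
    Represents L N Q R t (pushStack.eval x σ) { s with stack := s.push u } π := by
  have hstage : σ.reg rStage = s.stage := h.reg rStage (by norm_num)
  have hone : σ.reg rOne = 1 := h.reg rOne (by norm_num)
  have hfour : σ.reg rFour = 4 := h.reg rFour (by norm_num)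
  have hflag := h.data.onStack u
  have htest := (h.setReg (d := rTest) (by norm_num) (s.stage.val + 1)).setReg (d := rTest)
    (by norm_num) (s.stage.val + 1 - u)
  rw [Ctl.push]
  by_cases hle : u ≤ s.stage
  · have hpos : s.stage.val + 1 - u.val ≠ 0 := by omega
    have hload := (htest.setReg (d := rCell) (by norm_num) (u * 4)).setReg (d := rWord)
      (by norm_num) (if u ∈ s.stack then 1 else 0)
    by_cases hmem : u ∈ s.stack
    · rw [if_neg fun hpush => hpush.2 hmem]
      simpa [pushStack, block, eval, Instr.eval, hstage, hone, hfour, hend, hpos, mul_comm _ 4,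
        hflag, hmem] using hload.eval_skip (x := x)
    · rw [if_pos ⟨hle, hmem⟩]
      simpa [pushStack, block, eval, Instr.eval, hstage, hone, hfour, hend, hpos, mul_comm _ 4,
        hflag, hmem] using hload.eval_pushEnd (x := x) (u := u) (by simpa using hend)
          (by simp [mul_comm])
  · have hpos : s.stage.val + 1 - u.val = 0 := by omega
    rw [if_neg fun hpush => hle hpush.1]
    simpa [pushStack, block, eval, Instr.eval, hstage, hone, hend, hpos] using
      htest.eval_skip (x := x)

theorem eval_preceding (h : Represents L N Q R t σ s π) :
    Represents L N Q R t (preceding.eval x σ) s π := by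
  refine h.congr (fun i hi => ?_) rfl
  simp only [preceding, block, eval, Instr.eval, Store.reg_setReg]
  grind

theorem reg_rTest_eval_preceding (h : Represents L N Q R t σ s π) (hx : Encodes x L) :
    (preceding.eval x σ).reg rTest = 2 * s.pos := by
  simp [preceding, block, eval, Instr.eval, h.reg, registers, -List.getD_eq_getElem?_getD,
    hx.pointer s.cur s.cur.2.le]

theorem eval_endReset (h : Represents L N Q R t σ s π) :
    Represents L N Q R t (σ.setReg rResetting 0) { s with resetting := false } π := by
  refine h.of_lt_rCoin (fun i hi => ?_) (fun i hi => ?_) h.data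
  · interval_cases i <;> simp [h.reg, registers]
  · rw [Store.reg_setReg, if_neg (by omega)]

theorem eval_resetEdges [NeZero n] (h : Represents L N Q R t σ s π) (hx : Encodes x L)
    (hs : s.InBounds L N) (hreset : s.resetting = true) (hruns : s.runs ≠ 0) (c : Bool) :
    Represents L N Q R t (resetEdges.eval x σ) (lazyStep L s π c).1 (lazyStep L s π c).2 := by
  have hpreceding := h.eval_preceding (x := x)
  simp only [resetEdges, eval, h.reg_rTest_eval_preceding hx]
  rw [lazyStep, if_neg hruns, if_pos hreset]
  rcases eq_or_ne s.pos 0 with hpos | hpos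
  · rw [if_neg (by omega), if_pos hpos]
    exact hpreceding.eval_endReset
  · have hlt : s.pos - 1 < (L.list s.cur).length := by
      have := hs.pos_le
      omega
    have hd := List.getElem?_eq_getElem hlt
    have hback : (Instr.sub rAddress rAddress rTwo).eval x (preceding.eval x σ) =
        (preceding.eval x σ).setReg rAddress (L.start s.cur + 2 * (s.pos - 1)) := by
      have hAddress : (preceding.eval x σ).reg rAddress = L.start s.cur + 2 * s.pos :=
        hpreceding.reg rAddress (by norm_num)
      have hTwo : (preceding.eval x σ).reg rTwo = 2 := hpreceding.reg rTwo (by norm_num)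
      rw [Instr.eval, hAddress, hTwo, Nat.mul_sub_one, Nat.add_sub_assoc (by omega)]
    have hmove := hpreceding.setReg_rAddress (s.pos - 1)
    have hfetch := hmove.eval_fetch (x := x)
    have hforget := hfetch.eval_forget (x := x) (hmove.reg_rCell_eval_fetch hx hd)
    rw [if_pos (by omega), if_neg hpos, hd, hback]
    refine hforget.eval_pushStack ?_
    simpa [forget, block, eval, Instr.eval] using hmove.reg_rEnd_eval_fetch hx hd

theorem eval_sampleStep [NeZero n] (h : Represents L N Q R t σ s π) (hx : Encodes x L)
    (hs : s.InBounds L N) (hc : σ.reg rCoin = c.toNat) :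
    Represents L N Q R t (sampleStep.eval x σ) (lazyStep L s π c).1 (lazyStep L s π c).2 := by
  refine eval_clear ?_
  have hrRuns : σ.reg rRuns = s.runs := h.reg rRuns (by norm_num)
  have hrResetting : σ.reg rResetting = s.resetting.toNat := h.reg rResetting (by norm_num)
  simp only [eval, hrRuns, hrResetting]
  rcases eq_or_ne s.runs 0 with hruns | hruns
  · rw [if_neg (by simpa using hruns), lazyStep, if_pos hruns]
    exact h.eval_skip
  · rw [if_pos hruns]
    cases hreset : s.resetting
    · exact h.eval_scan hx hs hreset hruns hc
    · exact h.eval_resetEdges hx hs hreset hruns c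

end Represents

end Simulation

/-! ### The input words -/

section Input

theorem length_flatMap_pair {α : Type*} (l : List α) (f g : α → ℕ) :
    (l.flatMap fun d => [f d, g d]).length = 2 * l.length := by
  simp [mul_comm]

theorem getElem?_flatMap_pair {α : Type*} (f g : α → ℕ) {l : List α} {j : ℕ} {d : α}
    (h : l[j]? = some d) : (l.flatMap fun d => [f d, g d])[2 * j]? = some (f d) ∧
      (l.flatMap fun d => [f d, g d])[2 * j + 1]? = some (g d) := by
  induction l generalizing j with
  | nil => simp at h
  | cons c l ih =>
    cases j with
    | zero => simp_all
    | succ j => simpa [mul_add_one] using ih (List.getElem?_cons_succ ▸ h)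

theorem getElem?_flatMap_of_lt {α β : Type*} (l : List α) (f : α → List β) {k i : ℕ}
    (hk : k < l.length) (hi : i < (f l[k]).length) :
    (l.flatMap f)[((l.take k).flatMap f).length + i]? = (f l[k])[i]? := by
  have hsplit : l.flatMap f = (l.take k).flatMap f ++ (f l[k] ++ (l.drop (k + 1)).flatMap f) := by
    rw [← List.flatMap_cons, ← List.drop_eq_getElem_cons hk, ← List.flatMap_append,
      List.take_append_drop]
  rw [hsplit, List.getElem?_append_right (Nat.le_add_right _ _), Nat.add_sub_cancel_left,
    List.getElem?_append_left hi]

namespace AdjList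

variable {n m : ℕ} {G : Multigraph (Fin n) (Fin m)} (L : AdjList G) (a b : ℕ)

/-- The part of the input that describes the list of one vertex. -/
def words (v : Fin n) : List ℕ :=
  (L.list v).flatMap fun d => [(G.ends d.1 (!d.2)).val, d.1.val]

theorem length_words (v : Fin n) : (L.words v).length = 2 * (L.list v).length :=
  length_flatMap_pair _ _ _

theorem encode_eq : L.encode a b = ([n, a, b] ++ (List.range (n + 1)).map L.start) ++
    (List.finRange n).flatMap L.words := rfl

theorem length_header : ([n, a, b] ++ (List.range (n + 1)).map L.start).length = n + 4 := by
  simp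

theorem start_eq_add_length {v : ℕ} (hv : v ≤ n) :
    L.start v = n + 4 + (((List.finRange n).take v).flatMap L.words).length := by
  induction v with
  | zero => simp [start]
  | succ v ih =>
    have hget : (List.finRange n)[v]? = some ⟨v, hv⟩ := by
      rw [List.getElem?_eq_getElem (by simpa using hv), List.getElem_finRange]
      rfl
    rw [L.start_add_one ⟨v, hv⟩, ih (Nat.le_of_succ_le hv), List.take_add_one, hget]
    simp [length_words, add_assoc]

theorem getElem?_encode (v : Fin n) {i : ℕ} (hi : i < (L.words v).length) :
    (L.encode a b)[L.start v + i]? = (L.words v)[i]? := by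
  have hflat := getElem?_flatMap_of_lt (List.finRange n) L.words (k := v) (i := i)
    (by simp) (by simpa using hi)
  rw [encode_eq, L.start_eq_add_length v.2.le,
    List.getElem?_append_right (by rw [length_header]; omega), length_header]
  convert hflat using 2
  · omega
  · simp

theorem encodes_encode : Encodes (L.encode a b) L where
  pointer v hv := by
    rw [encode_eq, List.getD_eq_getElem?_getD,
      List.getElem?_append_left (by rw [length_header]; omega)]
    simp [Nat.lt_succ_iff.2 hv]
  neighbour v j d hd := by
    have hj := (List.getElem?_eq_some_iff.1 hd).1
    rw [List.getD_eq_getElem?_getD, L.getElem?_encode a b v (by rw [length_words]; omega), words,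
      (getElem?_flatMap_pair _ _ hd).1, Option.getD_some]
  edge v j d hd := by
    have hj := (List.getElem?_eq_some_iff.1 hd).1
    rw [List.getD_eq_getElem?_getD, add_assoc,
      L.getElem?_encode a b v (by rw [length_words]; omega), words,
      (getElem?_flatMap_pair _ _ hd).2, Option.getD_some]

theorem sum_length_list : ∑ v, (L.list v).length = 2 * m := by
  have hfiber (v : Fin n) :
      (L.list v).length = #{d : Fin m × Bool | G.ends d.1 d.2 = v} := by
    rw [← List.toFinset_card_of_nodup (L.nodup v)]
    congr 1
    ext d
    simp [L.mem_iff]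
  simp_rw [hfiber]
  rw [← card_eq_sum_card_fiberwise fun _ _ => mem_coe.2 (mem_univ _)]
  simp [mul_comm]

theorem start_last : L.start n = n + 4 + 4 * m := by
  rw [start, filter_true_of_mem fun u _ => u.2, ← mul_sum, sum_length_list]
  ring

theorem start_le (v : ℕ) : L.start v ≤ n + 4 + 4 * m := by
  rw [← start_last L, start, start]
  exact Nat.add_le_add_left (sum_le_sum_of_subset fun u _ => by simp) _

theorem le_of_mem_words {v : Fin n} {w : ℕ} (hw : w ∈ L.words v) : w ≤ n + m := by
  obtain ⟨d, -, hd⟩ := List.mem_flatMap.1 hw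
  rcases List.mem_pair.1 hd with rfl | rfl <;> omega

theorem getD_encode_le {a b : ℕ} (hab : a ≤ b) (i : ℕ) :
    (L.encode a b).getD i 0 ≤ n + 4 + 4 * m + b := by
  have hmem : ∀ w ∈ L.encode a b, w ≤ n + 4 + 4 * m + b := by
    intro w hw
    rw [encode_eq, List.mem_append, List.mem_append, List.mem_map, List.mem_flatMap] at hw
    rcases hw with (hw | ⟨v, -, rfl⟩) | ⟨v, -, hw⟩
    · simp only [List.mem_cons, List.not_mem_nil, or_false] at hw
      omega
    · exact (L.start_le v).trans (Nat.le_add_right _ _)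
    · have := L.le_of_mem_words hw
      omega
  rw [List.getD_eq_getElem?_getD]
  cases hi : (L.encode a b)[i]? with
  | none => exact Nat.zero_le _
  | some w => exact hmem w (List.mem_of_getElem? hi)

end AdjList

end Input

/-! ### The loops -/

namespace Program

/-- The part of a round of the sampling loop that follows the toss of the coin. -/
def sampleRound : Program := .seq sampleStep (.instr (.sub rFuel rFuel rOne))

/-- Repeat a step of the sampler as often as `rFuel` says. -/
def sampleLoop : Program := .loop rFuel (.seq (.instr (.flip rCoin)) sampleRound)

/-- Multiply the mantissa by the next estimated probability. -/
def multiply : Program :=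
  block [.mul rCell rStage rFour, .add rCell rCell rTwo, .load rCell rCell,
    .mul rMantissa rMantissa rCell, .div rMantissa rMantissa rTrials]
    (.instr (.add rStage rStage rOne))

/-- Double the mantissa. -/
def double : Program :=
  block [.add rMantissa rMantissa rMantissa] (.instr (.add rShift rShift rOne))

/-- Test whether factors are left, and whether the mantissa has reached the precision. -/
def productTests : Program :=
  block [.sub rRounds rRounds rOne, .sub rCoin rVertices rStage, .add rEnd rMantissa rOne]
    (.instr (.sub rEnd rEnd rPrecision))

/-- One step of the computation of the product of the estimated probabilities. -/
def productStep : Program :=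
  .seq productTests (.branch rCoin (.branch rEnd multiply double) skip)

/-- The computation of the product of the estimated probabilities. -/
def productLoop : Program := .loop rRounds productStep

theorem isStraight_sampleRound : sampleRound.IsStraight 1600 := by
  simp [sampleRound, sampleStep, resetEdges, scan, skip, clear, block, IsStraight, Instr.IsDet,
    fetch, forget, pushStack, reveal, compareTail, success, countSuccess, popStack, nextStage,
    rewind, tailDistance, remaining, preceding, pushEnd, nextRun, sink]

theorem isStraight_productStep : productStep.IsStraight 1600 := by
  simp [productStep, productTests, skip, block, IsStraight, Instr.IsDet, multiply, double]

end Program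

/-- The bounds for words between two rounds of the loops, for `N` trials, precision `Q`, `R` rounds
of the product loop and `F` rounds of the sampling loop. -/
structure WordBound (n m N Q R F B : ℕ) : Prop where
  const_le : 1600 ≤ B
  memory_le : 4 * n + N + 3 ≤ B
  base_le : N * m ≤ B
  input_le : n + 4 + 4 * m ≤ B
  product_le : 2 * Q * (N + 1) + 1 ≤ B
  fuel_le : F ≤ B
  rounds_le : R ≤ B

section SampleLoop

variable {n m : ℕ} {G : Multigraph (Fin n) (Fin m)} {L : AdjList G} {N Q R F B t : ℕ} {σ : Store}
  {s : Ctl n} {π : Fin m → Option Bool} {x : List ℕ}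

theorem registers_le (hB : WordBound n m N Q R F B) (ht : t ≤ F) (hs : s.InBounds L N) (i : ℕ) :
    registers L N Q R t s i ≤ B := by
  have hconst := hB.const_le
  have hmemory := hB.memory_le
  have hinput := hB.input_le
  have hfuel := hB.fuel_le
  have hrounds := hB.rounds_le
  have hruns := hs.runs_le
  have hprecision : Q ≤ B := by nlinarith [hB.product_le, Nat.zero_le (Q * N)]
  have hbase : (N - s.runs) * m ≤ B :=
    (Nat.mul_le_mul_right m (Nat.sub_le _ _)).trans hB.base_le
  have haddress : L.start s.cur + 2 * s.pos ≤ B := by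
    have := L.start_add_one s.cur
    have := L.start_le (s.cur + 1)
    have := hs.pos_le
    omega
  have hheight : s.stack.length ≤ n := by simpa using hs.nodup.length_le_card
  have hfirst := s.first.toNat_le
  have hresetting := s.resetting.toNat_le
  rw [registers.eq_def]
  split <;> omega

theorem registers_fuel (t' : ℕ) {i : ℕ} (hi : i ≠ rFuel) :
    registers L N Q R t s i = registers L N Q R t' s i := by
  rw [registers.eq_def, registers.eq_def]
  split <;> simp_all

theorem lazyValue_nonneg [NeZero n] {q : Ctl n → ℝ} (hq : ∀ s, 0 ≤ q s) (F : ℕ) (s : Ctl n)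
    (π : Fin m → Option Bool) : 0 ≤ lazyValue L q 0 F s π := by
  induction F generalizing s π with
  | zero => exact hq s
  | succ F ih =>
    simp only [lazyValue, ite_self, zero_add]
    exact div_nonneg (add_nonneg (ih _ _) (ih _ _)) zero_le_two

/-- The store holds the given state of the sampler and all scratch registers have been cleared, as
between two rounds of the sampling loop. -/
structure AtRest (L : AdjList G) (N Q R t : ℕ) (σ : Store) (s : Ctl n)
    (π : Fin m → Option Bool) : Prop extends Represents L N Q R t σ s π where
  inBounds : s.InBounds L N
  scratch : ∀ i, rCoin ≤ i → σ.reg i = 0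

namespace AtRest

theorem boundedBy (h : AtRest L N Q R t σ s π) (hB : WordBound n m N Q R F B) (ht : t ≤ F) :
    σ.BoundedBy B := by
  have hmemory := hB.memory_le
  refine ⟨fun i => ?_, fun a => (h.data.le a).trans (by omega)⟩
  rcases lt_or_ge i rCoin with hi | hi
  · rw [h.reg i (.inl hi)]
    exact registers_le hB ht h.inBounds i
  · rw [h.scratch i hi]
    exact Nat.zero_le B

theorem eval_sampleRound [NeZero n] (h : AtRest L N Q R (t + 1) σ s π) (hx : Encodes x L)
    (c : Bool) :
    AtRest L N Q R t (Program.sampleRound.eval x (σ.setReg rCoin c.toNat)) (lazyStep L s π c).1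
      (lazyStep L s π c).2 := by
  have hcoin := h.setReg (d := rCoin) (by norm_num) c.toNat
  have hstep := hcoin.eval_sampleStep hx h.inBounds (c := c) (by simp)
  have hfuel : (Program.sampleStep.eval x (σ.setReg rCoin c.toNat)).reg rFuel = t + 1 :=
    hstep.reg rFuel (by norm_num)
  have hone : (Program.sampleStep.eval x (σ.setReg rCoin c.toNat)).reg rOne = 1 :=
    hstep.reg rOne (by norm_num)
  have hround : Program.sampleRound.eval x (σ.setReg rCoin c.toNat) =
      (Program.sampleStep.eval x (σ.setReg rCoin c.toNat)).setReg rFuel t := by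
    simp only [Program.sampleRound, Program.eval, Instr.eval, hfuel, hone, Nat.add_sub_cancel]
  rw [hround]
  refine { toRepresents := ?_, inBounds := h.inBounds.lazyStep π c, scratch := fun i hi => ?_ }
  · refine ⟨fun i hi => ?_, hstep.data⟩
    rw [Store.reg_setReg]
    split_ifs with hi'
    · rw [hi']
      rfl
    · rw [hstep.reg i hi, registers_fuel t hi']
  · rw [Store.reg_setReg, if_neg (by omega)]
    rcases lt_or_ge rUnused i with hi' | hi'
    · rw [hstep.reg i (.inr hi'), registers_of_lt _ _ _ _ _ _ hi']
    · exact reg_eval_clear x _ ⟨hi, hi'⟩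

theorem reaches_sampleLoop [NeZero n] (hx : Encodes x L) (hB : WordBound n m N Q R F B)
    (hxB : ∀ a, x.getD a 0 ≤ B) {A : Set ℝ} {W T : ℕ}
    (hW : B ^ 2 ^ Program.sampleRound.cost ≤ W) {q : Ctl n → ℝ} (hq : ∀ s, 0 ≤ q s)
    {k : List Program}
    (hk : ∀ σ s π, AtRest L N Q R 0 σ s π → Config.Reaches x A W T (q s) ⟨k, σ⟩)
    (ht : t ≤ F) (h : AtRest L N Q R t σ s π) :
    Config.Reaches x A W (T + 1 + t * (Program.sampleRound.cost + 3)) (lazyValue L q 0 t s π)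
      ⟨Program.sampleLoop :: k, σ⟩ := by
  have hBW : B ≤ W := (Nat.le_self_pow (by positivity) B).trans hW
  have hconst := hB.const_le
  induction t generalizing σ s π with
  | zero =>
    have hfuel : σ.reg rFuel = 0 := h.reg rFuel (by norm_num)
    exact ((hk σ s π h).of_loop_zero hfuel ((h.boundedBy hB ht).mono hBW)).mono (by omega)
  | succ t ih =>
    have hbounded := h.boundedBy hB ht
    have hfuel : σ.reg rFuel = t + 1 := h.reg rFuel (by norm_num)
    have hround (c : Bool) : Config.Reaches x A W
        (T + 1 + t * (Program.sampleRound.cost + 3) + Program.sampleRound.cost)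
        (lazyValue L q 0 t (lazyStep L s π c).1 (lazyStep L s π c).2)
        ⟨Program.sampleRound :: Program.sampleLoop :: k, σ.setReg rCoin c.toNat⟩ := by
      refine .of_eval Program.isStraight_sampleRound (B := B) ?_ hW
        (ih (by omega) (h.eval_sampleRound hx c))
      exact { two_le := by omega
              const_le := hconst
              input_le := hxB
              bounded := hbounded.setReg ((Bool.toNat_le c).trans (by omega)) }
    have hflip := Config.Reaches.of_flip (r := rCoin) (hbounded.mono hBW)
      (lazyValue_nonneg hq _ _ _) (lazyValue_nonneg hq _ _ _) (hround true) (hround false)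
    have hbody := Config.Reaches.of_step (c := ⟨.seq (.instr (.flip rCoin)) Program.sampleRound ::
      Program.sampleLoop :: k, σ⟩) rfl (hbounded.mono hBW) hflip
    have hloop := hbody.of_loop_ne_zero (by omega) (hbounded.mono hBW)
    simp only [lazyValue, ite_self, zero_add]
    exact hloop.mono (by linarith)

end AtRest

end SampleLoop

/-! ### The product of the estimated probabilities -/

/-- The product of the first `index` estimated probabilities, as a floating point number. -/
structure FloatProduct where
  /-- The mantissa. -/
  mantissa : ℕ
  /-- The negated exponent. -/
  shift : ℕ
  /-- The number of factors. -/
  index : ℕ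

namespace FloatProduct

/-- The number that the mantissa and the exponent stand for. -/
noncomputable def value (p : FloatProduct) : ℝ := p.mantissa / 2 ^ p.shift

/-- One step of the computation of the product of the `n` fractions `c i / N`: the mantissa is
doubled until it has reached the precision `Q`, and only then multiplied by the next factor. -/
def next (n N Q : ℕ) (c : ℕ → ℕ) (p : FloatProduct) : FloatProduct :=
  if p.index < n then
    if Q ≤ p.mantissa then ⟨p.mantissa * c p.index / N, p.shift, p.index + 1⟩
    else ⟨2 * p.mantissa, p.shift + 1, p.index⟩
  else p

variable {n N Q : ℕ} {c : ℕ → ℕ} {p : FloatProduct}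

theorem next_of_le (hi : p.index < n) (hQ : Q ≤ p.mantissa) :
    next n N Q c p = ⟨p.mantissa * c p.index / N, p.shift, p.index + 1⟩ := by
  rw [next, if_pos hi, if_pos hQ]

theorem next_of_lt (hi : p.index < n) (hQ : p.mantissa < Q) :
    next n N Q c p = ⟨2 * p.mantissa, p.shift + 1, p.index⟩ := by
  rw [next, if_pos hi, if_neg hQ.not_ge]

theorem next_of_index_ge (hi : n ≤ p.index) : next n N Q c p = p := by
  rw [next, if_neg hi.not_gt]

end FloatProduct

/-- The registers during the computation of the product, with `T` rounds left. -/
def productRegisters (n m N Q T : ℕ) (p : FloatProduct) : ℕ → ℕ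
  | rMantissa => p.mantissa
  | rExponent => m
  | rShift => p.shift
  | rVertices => n
  | rOne => 1
  | rTwo => 2
  | rThree => 3
  | rFour => 4
  | rStage => p.index
  | rTrials => N
  | rPrecision => Q
  | rRounds => T
  | _ => 0

/-- The store, whose words are at most `B`, holds the given state of the computation of the product,
with `T` rounds left. -/
structure HoldsProduct (n m N Q B T : ℕ) (c : ℕ → ℕ) (σ : Store) (p : FloatProduct) : Prop where
  reg : ∀ i, i < rRuns ∨ i = rStage ∨ rFuel < i ∧ i < rCoin →
    σ.reg i = productRegisters n m N Q T p i
  count : ∀ i < n, σ.mem (4 * i + 2) = c i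
  count_le : ∀ i < n, c i ≤ N
  mantissa_le : p.mantissa ≤ 2 * Q
  index_le : p.index ≤ n
  shift_add_le : p.shift + T ≤ B
  bounded : σ.BoundedBy B

namespace HoldsProduct

open Program

variable {n m N Q R F B T : ℕ} {c : ℕ → ℕ} {σ : Store} {p : FloatProduct} {x : List ℕ}

theorem setReg (h : HoldsProduct n m N Q B T c σ p) {d y : ℕ} (hd : rCoin ≤ d) (hy : y ≤ B) :
    HoldsProduct n m N Q B T c (σ.setReg d y) p :=
  { h with
    reg := fun i hi => by
      rw [Store.reg_setReg, if_neg (by omega)]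
      exact h.reg i hi
    bounded := h.bounded.setReg hy }

theorem setReg_rRounds (h : HoldsProduct n m N Q B (T + 1) c σ p) :
    HoldsProduct n m N Q B T c (σ.setReg rRounds T) p :=
  { h with
    reg := fun i hi => by
      rw [Store.reg_setReg]
      split_ifs with hround
      · rw [hround]
        rfl
      · rw [h.reg i hi, productRegisters.eq_def, productRegisters.eq_def]
        split <;> simp_all
    shift_add_le := by linarith [h.shift_add_le]
    bounded := h.bounded.setReg (by linarith [h.shift_add_le]) }

theorem eval_productTests (h : HoldsProduct n m N Q B (T + 1) c σ p)
    (hB : WordBound n m N Q R F B) :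
    HoldsProduct n m N Q B T c (productTests.eval x σ) p ∧
      (productTests.eval x σ).reg rCoin = n - p.index ∧
      (productTests.eval x σ).reg rEnd = p.mantissa + 1 - Q := by
  have hmantissa : p.mantissa + 1 ≤ B := by
    nlinarith [h.mantissa_le, hB.product_le, Nat.zero_le (Q * N)]
  have hvertices : n ≤ B := by linarith [hB.memory_le]
  have heval : productTests.eval x σ = (((σ.setReg rRounds T).setReg rCoin (n - p.index)).setReg
      rEnd (p.mantissa + 1)).setReg rEnd (p.mantissa + 1 - Q) := by
    simp [productTests, block, eval, Instr.eval, h.reg, productRegisters]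
  rw [heval]
  refine ⟨?_, by simp, by simp⟩
  exact ((h.setReg_rRounds.setReg le_rfl (by omega)).setReg (by norm_num) hmantissa).setReg
    (by norm_num) (by omega)

theorem eval_multiply (h : HoldsProduct n m N Q B T c σ p) (hB : WordBound n m N Q R F B)
    (hi : p.index < n) :
    HoldsProduct n m N Q B T c (multiply.eval x σ)
      ⟨p.mantissa * c p.index / N, p.shift, p.index + 1⟩ := by
  have hcount := h.count_le p.index hi
  have hmemory := hB.memory_le
  have hproduct : p.mantissa * c p.index ≤ 2 * Q * N := Nat.mul_le_mul h.mantissa_le hcount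
  have hproductB : p.mantissa * c p.index ≤ B := by nlinarith [hB.product_le]
  have hquotient : p.mantissa * c p.index / N ≤ 2 * Q :=
    Nat.div_le_of_le_mul (hproduct.trans_eq (mul_comm _ _))
  have hcell : σ.mem (p.index * 4 + 2) = c p.index := by rw [mul_comm, h.count _ hi]
  have heval : multiply.eval x σ = (((((σ.setReg rCell (p.index * 4)).setReg rCell
      (p.index * 4 + 2)).setReg rCell (c p.index)).setReg rMantissa
      (p.mantissa * c p.index)).setReg rMantissa (p.mantissa * c p.index / N)).setReg rStage
      (p.index + 1) := by
    simp [multiply, block, eval, Instr.eval, h.reg, productRegisters, hcell]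
  rw [heval]
  exact
    { count := h.count
      count_le := h.count_le
      mantissa_le := hquotient
      index_le := hi
      shift_add_le := h.shift_add_le
      reg := fun i hi => by
        have hi' : i < rCoin := by omega
        interval_cases i <;> first | omega | simp [h.reg, productRegisters]
      bounded := ((((h.bounded.setReg (by omega)).setReg (by omega)).setReg (by omega)).setReg
        hproductB).setReg ((Nat.div_le_self _ _).trans hproductB) |>.setReg (by omega) }

theorem eval_double (h : HoldsProduct n m N Q B T c σ p) (hB : WordBound n m N Q R F B)
    (hmantissa : p.mantissa < Q) (hshift : p.shift + (T + 1) ≤ B) :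
    HoldsProduct n m N Q B T c (double.eval x σ) ⟨2 * p.mantissa, p.shift + 1, p.index⟩ := by
  have hprecision : 2 * p.mantissa ≤ B := by nlinarith [hB.product_le, Nat.zero_le (Q * N)]
  have heval : double.eval x σ =
      (σ.setReg rMantissa (2 * p.mantissa)).setReg rShift (p.shift + 1) := by
    simp [double, block, eval, Instr.eval, h.reg, productRegisters, two_mul]
  rw [heval]
  exact
    { count := h.count
      count_le := h.count_le
      mantissa_le := Nat.mul_le_mul_left 2 hmantissa.le
      index_le := h.index_le
      shift_add_le := (add_right_comm _ _ _).trans_le hshift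
      reg := fun i hi => by
        have hi' : i < rCoin := by omega
        interval_cases i <;> first | omega | simp [h.reg, productRegisters]
      bounded := (h.bounded.setReg hprecision).setReg (by omega) }

theorem eval_productStep (h : HoldsProduct n m N Q B (T + 1) c σ p)
    (hB : WordBound n m N Q R F B) :
    HoldsProduct n m N Q B T c (productStep.eval x σ) (p.next n N Q c) := by
  obtain ⟨htests, hcoin, hend⟩ := h.eval_productTests (x := x) hB
  simp only [productStep, eval, hcoin, hend]
  rcases lt_or_ge p.index n with hi | hi
  · rw [if_pos (by omega)]
    rcases le_or_gt Q p.mantissa with hQ | hQ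
    · rw [if_pos (by omega), FloatProduct.next_of_le hi hQ]
      exact htests.eval_multiply hB hi
    · rw [if_neg (by omega), FloatProduct.next_of_lt hi hQ]
      exact htests.eval_double hB hQ h.shift_add_le
  · rw [if_neg (by omega), FloatProduct.next_of_index_ge hi]
    exact htests.setReg (by norm_num) (Nat.zero_le B)

theorem reaches_productLoop (h : HoldsProduct n m N Q B T c σ p) (hB : WordBound n m N Q R F B)
    (hxB : ∀ a, x.getD a 0 ≤ B) {W : ℕ} (hW : B ^ 2 ^ productStep.cost ≤ W) {A : Set ℝ} {q : ℝ}
    (hq : q ≤ A.indicator 1 (2 ^ m * ((FloatProduct.next n N Q c)^[T] p).value)) :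
    Config.Reaches x A W (1 + T * (productStep.cost + 1)) q ⟨[productLoop], σ⟩ := by
  have hBW : B ≤ W := (Nat.le_self_pow (by positivity) B).trans hW
  have hrounds : σ.reg rRounds = T := h.reg rRounds (by norm_num)
  induction T generalizing σ p with
  | zero =>
    have houtput : σ.output = 2 ^ m * p.value := by
      simp [Store.output, h.reg, productRegisters, FloatProduct.value]
      ring
    have hhalted : Config.Reaches x A W 0 q ⟨[], σ⟩ :=
      .of_halted (h.bounded.mono hBW) (houtput ▸ hq)
    exact (hhalted.of_loop_zero hrounds (h.bounded.mono hBW)).mono (by omega)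
  | succ T ih =>
    have hnext := h.eval_productStep (x := x) hB
    have hfits : σ.Fits x 1600 B :=
      { two_le := by linarith [hB.const_le]
        const_le := hB.const_le
        input_le := hxB
        bounded := h.bounded }
    have hstep := Config.Reaches.of_eval isStraight_productStep hfits hW
      (ih hnext hq (hnext.reg rRounds (by norm_num)))
    exact (hstep.of_loop_ne_zero (by omega) (h.bounded.mono hBW)).mono (by linarith)

end HoldsProduct

namespace FloatProduct

variable {n N Q ℓ : ℕ} {c : ℕ → ℕ} {p : FloatProduct}

/-- The mantissa is positive and has at most `ℓ + 1` binary digits, and there are at most `n`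
factors. -/
structure Normal (n ℓ : ℕ) (p : FloatProduct) : Prop where
  mantissa_pos : 1 ≤ p.mantissa
  mantissa_lt : p.mantissa < 2 ^ (ℓ + 1)
  index_le : p.index ≤ n

theorem Normal.log_lt (hp : p.Normal n ℓ) : Nat.log 2 p.mantissa < ℓ + 1 :=
  Nat.log_lt_of_lt_pow (Nat.one_le_iff_ne_zero.1 hp.mantissa_pos) hp.mantissa_lt

theorem Normal.next (hp : p.Normal n ℓ) (hN : 0 < N) (hNQ : N ≤ Q) (hQ : Q ≤ 2 ^ ℓ)
    (hc : ∀ i < n, 1 ≤ c i) (hcN : ∀ i < n, c i ≤ N) : (p.next n N Q c).Normal n ℓ := by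
  rcases lt_or_ge p.index n with hi | hi
  · rcases le_or_gt Q p.mantissa with hM | hM
    · rw [next_of_le hi hM]
      have hle : p.mantissa * c p.index / N ≤ p.mantissa :=
        Nat.div_le_of_le_mul (by rw [mul_comm N]; exact Nat.mul_le_mul_left _ (hcN _ hi))
      exact
        { mantissa_pos :=
            (Nat.one_le_div_iff hN).2 ((hNQ.trans hM).trans (Nat.le_mul_of_pos_right _ (hc _ hi)))
          mantissa_lt := hle.trans_lt hp.mantissa_lt
          index_le := hi }
    · rw [next_of_lt hi hM]
      exact
        { mantissa_pos := by linarith [hp.mantissa_pos]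
          mantissa_lt := by rw [pow_succ']; linarith
          index_le := hp.index_le }
  · rwa [next_of_index_ge hi]

/-- The number `(n - index) * (ℓ + 1) - log₂ mantissa` of rounds that are left decreases in every
round. -/
theorem Normal.next_potential_le (hp : p.Normal n ℓ) {T : ℕ}
    (h : (n - p.index) * (ℓ + 1) ≤ T + 1 + Nat.log 2 p.mantissa) :
    (n - (p.next n N Q c).index) * (ℓ + 1) ≤ T + Nat.log 2 (p.next n N Q c).mantissa := by
  have hlog := hp.log_lt
  rcases lt_or_ge p.index n with hi | hi
  · rcases le_or_gt Q p.mantissa with hM | hM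
    · have hsub : (n - p.index) * (ℓ + 1) = (n - (p.index + 1)) * (ℓ + 1) + (ℓ + 1) := by
        rw [← Nat.succ_mul]
        congr 1
        omega
      simp only [next_of_le hi hM]
      omega
    · have hdouble : Nat.log 2 (2 * p.mantissa) = Nat.log 2 p.mantissa + 1 := by
        rw [mul_comm]
        exact Nat.log_mul_base one_lt_two (Nat.one_le_iff_ne_zero.1 hp.mantissa_pos)
      simp only [next_of_lt hi hM, hdouble]
      omega
  · simp [next_of_index_ge hi, Nat.sub_eq_zero_of_le hi]

theorem Normal.index_iterate_next {T : ℕ} (hp : p.Normal n ℓ) (hN : 0 < N) (hNQ : N ≤ Q)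
    (hQ : Q ≤ 2 ^ ℓ) (hc : ∀ i < n, 1 ≤ c i) (hcN : ∀ i < n, c i ≤ N)
    (h : (n - p.index) * (ℓ + 1) ≤ T + Nat.log 2 p.mantissa) :
    ((FloatProduct.next n N Q c)^[T] p).index = n := by
  induction T generalizing p with
  | zero =>
    rw [Function.iterate_zero_apply]
    have hlog := hp.log_lt
    by_contra hne
    have hlt : 1 * (ℓ + 1) ≤ (n - p.index) * (ℓ + 1) :=
      Nat.mul_le_mul_right _ (by have := hp.index_le; omega)
    omega
  | succ T ih =>
    rw [Function.iterate_succ_apply]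
    exact ih (hp.next hN hNQ hQ hc hcN) (hp.next_potential_le h)

/-- The floating point number approximates the product of the first `index` fractions `c i / N` from
below, with a relative error of at most `δ` for every factor. -/
structure Approx (N : ℕ) (δ : ℝ) (c : ℕ → ℕ) (p : FloatProduct) : Prop where
  le_value : (1 - δ) ^ p.index * ∏ j ∈ range p.index, ((c j : ℝ) / N) ≤ p.value
  value_le : p.value ≤ ∏ j ∈ range p.index, ((c j : ℝ) / N)

theorem value_double (M e i : ℕ) : value ⟨2 * M, e + 1, i⟩ = value ⟨M, e, i⟩ := by
  simp only [value, pow_succ', Nat.cast_mul, Nat.cast_ofNat]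
  exact mul_div_mul_left _ _ two_ne_zero

theorem le_cast_mul_div {M a : ℕ} {δ : ℝ} (hN : 0 < N) (hδ : N ≤ δ * M) (ha : 1 ≤ a) :
    (1 - δ) * (M * (a / N)) ≤ ((M * a / N : ℕ) : ℝ) := by
  have hN' : (0 : ℝ) < N := Nat.cast_pos.2 hN
  have ha' : (1 : ℝ) ≤ a := Nat.one_le_cast.2 ha
  have hfloor : ((M * a : ℕ) : ℝ) / N < ((M * a / N : ℕ) : ℝ) + 1 := by
    rw [← Nat.floor_div_eq_div (K := ℝ)]
    exact Nat.lt_floor_add_one _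
  have herror : 1 ≤ δ * (M * (a / N)) := by
    calc (1 : ℝ) ≤ δ * M / N := (one_le_div hN').2 hδ
      _ ≤ δ * M / N * a := le_mul_of_one_le_right (div_nonneg (hN'.le.trans hδ) hN'.le) ha'
      _ = δ * (M * (a / N)) := by ring
  rw [Nat.cast_mul, mul_div_assoc] at hfloor
  linarith

theorem Approx.next {δ : ℝ} (h : p.Approx N δ c) (hN : 0 < N) (hδ : N ≤ δ * Q) (hδ' : δ ≤ 1)
    (hc : ∀ i < n, 1 ≤ c i) : (p.next n N Q c).Approx N δ c := by
  have : 0 ≤ 1 - δ := sub_nonneg.2 hδ'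
  rcases lt_or_ge p.index n with hi | hi
  · rcases le_or_gt Q p.mantissa with hM | hM
    · have hδ0 : 0 ≤ δ :=
        pos_of_mul_pos_left ((Nat.cast_pos.2 hN).trans_le hδ) (Nat.cast_nonneg Q) |>.le
      have hδM : (N : ℝ) ≤ δ * p.mantissa := hδ.trans (by gcongr)
      have hlower := le_cast_mul_div hN hδM (hc _ hi)
      have hupper : ((p.mantissa * c p.index / N : ℕ) : ℝ) ≤ p.mantissa * (c p.index / N) := by
        rw [← mul_div_assoc, ← Nat.cast_mul]
        exact Nat.cast_div_le
      rw [next_of_le hi hM]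
      constructor <;> simp only [value] <;> rw [prod_range_succ]
      · calc (1 - δ) ^ (p.index + 1) *
              ((∏ j ∈ range p.index, ((c j : ℝ) / N)) * (c p.index / N))
            = (1 - δ) * ((1 - δ) ^ p.index * ∏ j ∈ range p.index, ((c j : ℝ) / N)) *
                (c p.index / N) := by ring
          _ ≤ (1 - δ) * p.value * (c p.index / N) := by gcongr; exact h.le_value
          _ = (1 - δ) * (p.mantissa * (c p.index / N)) / 2 ^ p.shift := by rw [value]; ring
          _ ≤ _ := by gcongr
      · calc ((p.mantissa * c p.index / N : ℕ) : ℝ) / 2 ^ p.shift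
            ≤ p.mantissa * (c p.index / N) / 2 ^ p.shift := by gcongr
          _ = p.value * (c p.index / N) := by rw [value]; ring
          _ ≤ _ := by gcongr; exact h.value_le
    · rw [next_of_lt hi hM]
      exact ⟨(value_double _ _ _).symm ▸ h.le_value, (value_double _ _ _).symm ▸ h.value_le⟩
  · rwa [next_of_index_ge hi]

theorem Approx.iterate_next {δ : ℝ} (h : p.Approx N δ c) (hN : 0 < N) (hδ : N ≤ δ * Q)
    (hδ' : δ ≤ 1) (hc : ∀ i < n, 1 ≤ c i) (T : ℕ) :
    ((FloatProduct.next n N Q c)^[T] p).Approx N δ c := by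
  induction T with
  | zero => exact h
  | succ T ih =>
    rw [Function.iterate_succ_apply']
    exact ih.next hN hδ hδ' hc

end FloatProduct

/-! ### The whole program -/

/-- The number of trials for each vertex, which makes the relative standard deviation of the product
of the estimated probabilities of the order of `1 / k`. -/
def trials (n k : ℕ) : ℕ := n * k * k * 64

/-- The precision of the mantissa, which makes the rounding errors of `n` multiplications at most
`1 / (16 * k)` in total. -/
def precision (n k : ℕ) : ℕ := n * k * trials n k * 16

/-- The number of rounds of the sampling loop. -/
def fuel (n k : ℕ) : ℕ := n * trials n k * 1600

/-- The number of rounds of the product loop. -/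
def rounds (n k : ℕ) : ℕ := (trials n k + 1) * n

theorem trials_pos {n k : ℕ} (hn : 0 < n) (hk : 0 < k) : 0 < trials n k := by
  rw [trials]
  positivity

theorem fuel_pos {n k : ℕ} (hn : 0 < n) (hk : 0 < k) : 0 < fuel n k :=
  Nat.mul_pos (Nat.mul_pos hn (trials_pos hn hk)) (by norm_num)

namespace Program

/-- Initialise the registers that do not depend on the input. -/
def setConstants : Program :=
  block [.const rOne 1, .const rTwo 2, .const rThree 3, .const rFour 4, .const rMantissa 1]
    (.instr (.const rFirst 1))

/-- Read the numbers of vertices and edges, the beginning of the first adjacency list, and the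
number `k = ⌊b / a⌋ + 1`. -/
def readInput : Program :=
  block [.read rVertices rEnd, .add rExponent rVertices rThree, .read rExponent rExponent,
    .sub rExponent rExponent rVertices, .sub rExponent rExponent rFour,
    .div rExponent rExponent rFour, .read rAddress rThree, .read rCell rOne, .read rWord rTwo,
    .div rWord rWord rCell] (.instr (.add rWord rWord rOne))

/-- Compute the parameters. -/
def setParameters : Program :=
  block [.mul rTest rVertices rWord, .mul rTrials rTest rWord, .const rCoin 64,
    .mul rTrials rTrials rCoin, .add rRuns rTrials rEnd, .mul rPrecision rTest rTrials,
    .const rCoin 16, .mul rPrecision rPrecision rCoin, .mul rFuel rVertices rTrials,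
    .const rCoin 1600, .mul rFuel rFuel rCoin, .add rRounds rTrials rOne]
    (.instr (.mul rRounds rRounds rVertices))

/-- Prepare all registers except for the scratch registers. -/
def setup : Program := .seq setConstants (.seq readInput setParameters)

/-- Prepare the sampling loop. -/
def init : Program := .seq setup clear

/-- Start with the first factor. -/
def rewindStage : Program := .instr (.const rStage 0)

/-- Estimate, for each vertex in turn, the probability that it is not a sink if no earlier vertex
is a sink, and output the product of the estimates and the number of all orientations. -/
def approxSinkFree : Program := .seq init (.seq sampleLoop (.seq rewindStage productLoop))

theorem isStraight_init : init.IsStraight 1600 := by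
  simp [init, setup, setConstants, readInput, setParameters, clear, block, IsStraight, Instr.IsDet]

end Program

/-- The initial control state. -/
def Ctl.start (n N : ℕ) [NeZero n] : Ctl n := ⟨N, 0, 0, [], true, false, 0, fun _ => 0⟩

section Init

open Program

variable {n m : ℕ} {G : Multigraph (Fin n) (Fin m)} [NeZero n]

theorem Ctl.inBounds_start (L : AdjList G) (N : ℕ) : (Ctl.start n N).InBounds L N where
  nodup := List.nodup_nil
  stack_eq_nil _ := rfl
  first_of_resetting h := by simp [start] at h
  pos_le := Nat.zero_le _
  runs_le := le_rfl
  count_add_runs_le i := by simp [start]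

theorem Ctl.valid_start (n N : ℕ) [NeZero n] : (Ctl.start n N).Valid where
  nodup := List.nodup_nil
  cur_notMem := by simp [start]
  le_stage := by simp [start]
  cur_le := le_rfl
  stack_eq_nil _ := rfl
  cur_eq _ := rfl
  first_of_resetting h := by simp [start] at h
  stage_eq_zero _ := by simp [start]
  first_of_runs _ := rfl

theorem represents_setup {L : AdjList G} {a b k : ℕ} {x : List ℕ} (hx : Encodes x L)
    (hn : x.getD 0 0 = n) (ha : x.getD 1 0 = a) (hb : x.getD 2 0 = b) (hk : k = b / a + 1) :
    Represents L (trials n k) (precision n k) (rounds n k) (fuel n k) (setup.eval x Store.zero)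
      (Ctl.start n (trials n k)) fun _ => none := by
  have hstart : L.start 0 = n + 4 := by simp [AdjList.start]
  have hfirst : x.getD 3 0 = n + 4 := (hx.pointer 0 (Nat.zero_le _)).trans hstart
  have hlast : x.getD (n + 3) 0 = n + 4 + 4 * m := (hx.pointer n le_rfl).trans L.start_last
  have hedges : (n + 4 + 4 * m - n - 4) / 4 = m := by omega
  refine ⟨fun i hi => ?_, ?_⟩
  · rcases hi with hi | hi
    · interval_cases i <;> simp [setup, setConstants, readInput, setParameters, block, eval,
        Instr.eval, registers, Ctl.start, Store.zero, hn, ha, hb, ← hk, hstart, hfirst, hlast,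
        hedges, trials, precision, fuel, rounds, -List.getD_eq_getElem?_getD]
    · have hne (j : ℕ) (hj : j ≤ rUnused) : i ≠ j := by omega
      rw [registers_of_lt _ _ _ _ _ _ hi]
      simp [setup, setConstants, readInput, setParameters, block, eval, Instr.eval, Store.zero, hne]
  · exact
      { onStack := fun _ => rfl
        stack := fun k v hv => by simp [Ctl.start] at hv
        count := fun _ => rfl
        edge := fun _ => rfl
        fresh := fun _ _ => rfl
        le := fun _ => Nat.zero_le _ }

theorem atRest_init {L : AdjList G} {a b k : ℕ} {x : List ℕ} (hx : Encodes x L)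
    (hn : x.getD 0 0 = n) (ha : x.getD 1 0 = a) (hb : x.getD 2 0 = b) (hk : k = b / a + 1) :
    AtRest L (trials n k) (precision n k) (rounds n k) (fuel n k) (init.eval x Store.zero)
      (Ctl.start n (trials n k)) fun _ => none :=
  have hinit : Represents L (trials n k) (precision n k) (rounds n k) (fuel n k)
      (init.eval x Store.zero) (Ctl.start n (trials n k)) fun _ => none :=
    (represents_setup hx hn ha hb hk).eval_clear
  { toRepresents := hinit
    inBounds := Ctl.inBounds_start L _
    scratch := fun i hi => by
      rcases le_or_gt i rUnused with hi' | hi'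
      · exact reg_eval_clear x _ ⟨hi, hi'⟩
      · rw [hinit.reg i (.inr hi'), registers_of_lt _ _ _ _ _ _ hi'] }

end Init

/-! ### The probability of success -/

section Success

variable {n m : ℕ} {G : Multigraph (Fin n) (Fin m)} {N k F : ℕ} {ε κ : ℝ} {s : Ctl n}

theorem le_trials (hk : 0 < k) : n ≤ trials n k := by
  rw [trials, mul_assoc, mul_assoc]
  exact Nat.le_mul_of_pos_right n (by positivity)

theorem prod_stageProb_val_lt (hdeg : ∀ v, 3 ≤ G.degree v) (hk : k ≤ n) :
    ∏ i : Fin n with i.val < k, stageProb G i =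
      #(G.noSinkIn (univ.filter fun i : Fin n => i.val < k)) / 2 ^ m := by
  induction k with
  | zero => simp [noSinkIn_empty]
  | succ k ih =>
    have hIio : (univ.filter fun i : Fin n => i.val < k) = Iio ⟨k, hk⟩ := by
      ext i
      simp [Fin.lt_def]
    have hIic : (univ.filter fun i : Fin n => i.val < k + 1) = Iic ⟨k, hk⟩ := by
      ext i
      simp [Fin.le_def]
    rw [hIic, ← Iio_insert, prod_insert (by simp), ← hIio, ih (by omega), mul_div_assoc', hIio,
      stageProb_mul_card hdeg, Iio_insert]

theorem prod_stageProb (hdeg : ∀ v, 3 ≤ G.degree v) :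
    ∏ i, stageProb G i = G.numSinkFree / 2 ^ m := by
  have h := prod_stageProb_val_lt hdeg le_rfl
  rwa [filter_true_of_mem fun i _ => i.2, card_noSinkIn_univ] at h

/-- All runs are finished, and the relative error of the product of the estimated probabilities is
at most `ε / 2`. -/
def Ctl.Accurate (G : Multigraph (Fin n) (Fin m)) (N : ℕ) (ε : ℝ) (s : Ctl n) : Prop :=
  s.runs = 0 ∧ |∏ i, (s.count i : ℝ) / (N * stageProb G i) - 1| ≤ ε / 2

/-- The indicator function of the accurate final states. -/
noncomputable def accuracy (G : Multigraph (Fin n) (Fin m)) (N : ℕ) (ε : ℝ) : Ctl n → ℝ :=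
  Set.indicator {s | s.Accurate G N ε} 1

theorem accuracy_nonneg (s : Ctl n) : 0 ≤ accuracy G N ε s :=
  Set.indicator_nonneg (fun _ _ => zero_le_one) s

-- Chebyshev's inequality.
theorem one_le_accuracy_add_finalError (hε : 0 < ε) (hs : s.runs = 0) :
    1 ≤ accuracy G N ε s + finalError G N (4 / ε ^ 2) s := by
  by_cases h : s.Accurate G N ε
  · have hone : accuracy G N ε s = 1 := Set.indicator_of_mem h 1
    rw [hone]
    exact le_add_of_nonneg_right (finalError_nonneg (by positivity) s)
  · have hdev : ε / 2 < |∏ i, (s.count i : ℝ) / (N * stageProb G i) - 1| :=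
      not_le.1 fun hle => h ⟨hs, hle⟩
    have hsq : (ε / 2) ^ 2 ≤ (∏ i, (s.count i : ℝ) / (N * stageProb G i) - 1) ^ 2 := by
      rw [← sq_abs (∏ i, (s.count i : ℝ) / (N * stageProb G i) - 1)]
      gcongr
    calc (1 : ℝ) = 4 / ε ^ 2 * (ε / 2) ^ 2 := by field_simp; norm_num
      _ ≤ finalError G N (4 / ε ^ 2) s := by rw [finalError, if_pos hs]; gcongr
      _ ≤ _ := le_add_of_nonneg_left (accuracy_nonneg s)

variable [NeZero n] {L : AdjList G}

theorem lazyValue_of_runs_eq_zero {t : Ctl n → ℝ} (hs : s.runs = 0) (F : ℕ)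
    (π : Fin m → Option Bool) : lazyValue L t κ F s π = t s := by
  induction F with
  | zero => rfl
  | succ F ih => simp [lazyValue, lazyStep, hs, ih]

-- Markov's inequality: a run that is not finished after `F` steps costs `κ * F`.
theorem le_lazyValue_add_lazyValue {t f : Ctl n → ℝ} (ht : ∀ s, 0 ≤ t s) (hf : ∀ s, 0 ≤ f s)
    (h : ∀ s : Ctl n, s.runs = 0 → 1 ≤ t s + f s) (hκ : 0 ≤ κ) (hF : κ * F ≤ 1) (s : Ctl n)
    (π : Fin m → Option Bool) : κ * F ≤ lazyValue L t 0 F s π + lazyValue L f κ F s π := by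
  induction F generalizing s π with
  | zero => simpa [lazyValue] using add_nonneg (ht s) (hf s)
  | succ F ih =>
    by_cases hs : s.runs = 0
    · rw [lazyValue_of_runs_eq_zero hs, lazyValue_of_runs_eq_zero hs]
      exact hF.trans (h s hs)
    · push_cast at hF ⊢
      have hheads := ih (by linarith) (lazyStep L s π true).1 (lazyStep L s π true).2
      have htails := ih (by linarith) (lazyStep L s π false).1 (lazyStep L s π false).2
      simp only [lazyValue, if_neg hs]
      linarith

theorem lazyValue_finalError_start_le (hdeg : ∀ v, 3 ≤ G.degree v) {w : ℝ} (hw : 0 ≤ w)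
    (hκ : 0 ≤ κ) : lazyValue L (finalError G N w) κ F (Ctl.start n N) (fun _ => none) ≤
      potential G N w κ (Ctl.start n N) := by
  have hsettled : (Ctl.start n N).settled = ∅ := by
    ext u
    simp [Ctl.mem_settled, Ctl.start]
  have hbound := (scanBound_and_resetBound (L := L) (N := N) hdeg hw hκ F _
    (Ctl.valid_start n N)).1 rfl rfl
  rw [ScanBound, hsettled, noSinkIn_empty] at hbound
  rw [lazyValue_eq_completionAvg, completionAvg, avg, div_le_iff₀ (by positivity)]
  simpa [complete_none, mul_comm] using hbound

theorem Ctl.error_start_le (hdeg : ∀ v, 3 ≤ G.degree v) (hN : 0 < N) (hnN : n ≤ N) :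
    (Ctl.start n N).error N (stageProb G) ≤ 2 * (n / N) := by
  have hleft : (Ctl.start n N).trialsLeft = fun _ => (N : ℝ) := by
    funext i
    simp [Ctl.trialsLeft, Ctl.start]
  have hcount : (fun i => ((Ctl.start n N).count i : ℝ)) = 0 := by
    funext i
    simp [Ctl.start]
  rw [Ctl.error, hleft, hcount]
  exact errorSq_start_le (Nat.cast_pos.2 hN) (half_le_stageProb hdeg) (stageProb_le_one hdeg)
    (Nat.cast_le.2 hnN)

theorem Ctl.load_start (hN : 0 < N) : (Ctl.start n N).load = n * N := by
  have hruns : (Ctl.start n N).runs ≠ 0 := hN.ne'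
  rw [Ctl.load, if_neg hruns]
  simp only [Ctl.start, List.length_nil, Fin.val_zero]
  push_cast
  ring

theorem potential_start_le (hdeg : ∀ v, 3 ≤ G.degree v) (hk : 0 < k) (hεk : 1 ≤ ε * k) :
    potential G (trials n k) (4 / ε ^ 2) (1 / fuel n k) (Ctl.start n (trials n k)) ≤ 1 / 4 := by
  have hn : (n : ℝ) ≠ 0 := NeZero.ne _
  have hk' : (k : ℝ) ≠ 0 := Nat.cast_ne_zero.2 hk.ne'
  have herror :
      4 / ε ^ 2 * (Ctl.start n (trials n k)).error (trials n k) (stageProb G) ≤ 1 / 8 := by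
    calc _ ≤ 4 / ε ^ 2 * (2 * (n / trials n k : ℝ)) := by
          gcongr
          exact Ctl.error_start_le hdeg (trials_pos (NeZero.pos n) hk) (le_trials hk)
      _ = 1 / (8 * (ε * k) ^ 2) := by
          rw [trials]
          push_cast
          field_simp
          norm_num
      _ ≤ 1 / 8 := by
          gcongr
          nlinarith
  have hload : 200 * (1 / fuel n k) * (Ctl.start n (trials n k)).load = 1 / 8 := by
    have hN : (trials n k : ℝ) ≠ 0 := Nat.cast_ne_zero.2 (trials_pos (NeZero.pos n) hk).ne'
    rw [Ctl.load_start (trials_pos (NeZero.pos n) hk), fuel]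
    push_cast
    field_simp
    norm_num
  rw [potential, hload]
  linarith

theorem three_quarters_le_lazyValue_accuracy (hdeg : ∀ v, 3 ≤ G.degree v) (hε : 0 < ε)
    (hk : 0 < k) (hεk : 1 ≤ ε * k) : 3 / 4 ≤ lazyValue L (accuracy G (trials n k) ε) 0 (fuel n k)
      (Ctl.start n (trials n k)) fun _ => none := by
  have hF : (1 / fuel n k : ℝ) * fuel n k = 1 :=
    one_div_mul_cancel (Nat.cast_ne_zero.2 (fuel_pos (NeZero.pos n) hk).ne')
  have hw : 0 ≤ 4 / ε ^ 2 := by positivity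
  have hmarkov := le_lazyValue_add_lazyValue (L := L) (accuracy_nonneg (G := G) (N := trials n k))
    (finalError_nonneg hw) (fun _ => one_le_accuracy_add_finalError hε) (by positivity) hF.le
    (Ctl.start n (trials n k)) fun _ => none
  have herror := (lazyValue_finalError_start_le (L := L) (F := fuel n k) hdeg hw
    (by positivity)).trans (potential_start_le hdeg hk hεk)
  linarith

end Success

/-! ### The accuracy of the output -/

section Precision

variable {n k : ℕ} {c : ℕ → ℕ}

theorem trials_le_precision (hn : 0 < n) (hk : 0 < k) : trials n k ≤ precision n k := by
  calc trials n k = 1 * 1 * trials n k * 1 := by ring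
    _ ≤ n * k * trials n k * 16 := by gcongr <;> omega

theorem precision_le_two_pow_trials (n k : ℕ) : precision n k ≤ 2 ^ trials n k := by
  have hhalf : trials n k = 2 * (n * k * k * 32) := by rw [trials]; ring
  rcases Nat.eq_zero_or_pos k with rfl | hk
  · simp [precision]
  · calc precision n k ≤ n * k * trials n k * (4 * (16 * k)) := by
          rw [precision]
          gcongr
          omega
      _ = trials n k * trials n k := by rw [trials]; ring
      _ ≤ 2 ^ (n * k * k * 32) * 2 ^ (n * k * k * 32) := by
          rw [hhalf]
          exact Nat.mul_le_mul (Nat.mul_le_pow (by norm_num) _) (Nat.mul_le_pow (by norm_num) _)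
      _ = 2 ^ trials n k := by rw [← pow_add, ← two_mul, hhalf]

theorem rounding_le_one (hn : 0 < n) (hk : 0 < k) : 1 / (16 * n * k : ℝ) ≤ 1 := by
  have hn' : (1 : ℝ) ≤ n := Nat.one_le_cast.2 hn
  have hk' : (1 : ℝ) ≤ k := Nat.one_le_cast.2 hk
  rw [div_le_one (by positivity)]
  nlinarith

namespace FloatProduct

/-- The computed product of the `n` fractions `c i / trials n k`. -/
def ofCounts (n k : ℕ) (c : ℕ → ℕ) : FloatProduct :=
  (next n (trials n k) (precision n k) c)^[rounds n k] ⟨1, 0, 0⟩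

theorem index_ofCounts (hn : 0 < n) (hk : 0 < k) (hc : ∀ i < n, 1 ≤ c i)
    (hcN : ∀ i < n, c i ≤ trials n k) : (ofCounts n k c).index = n := by
  have hstart : Normal n (trials n k) ⟨1, 0, 0⟩ :=
    { mantissa_pos := le_rfl
      mantissa_lt := Nat.one_lt_two_pow (Nat.succ_ne_zero _)
      index_le := Nat.zero_le n }
  have hN := trials_pos hn hk
  refine hstart.index_iterate_next hN (trials_le_precision hn hk) (precision_le_two_pow_trials n k)
    hc hcN ?_
  simp [rounds, mul_comm]

theorem approx_ofCounts (hn : 0 < n) (hk : 0 < k) (hc : ∀ i < n, 1 ≤ c i) :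
    (ofCounts n k c).Approx (trials n k) (1 / (16 * n * k)) c := by
  have hstart : Approx (trials n k) (1 / (16 * n * k)) c ⟨1, 0, 0⟩ := by
    constructor <;> simp [value]
  have hN := trials_pos hn hk
  have hδ : (trials n k : ℝ) ≤ 1 / (16 * n * k) * precision n k := by
    rw [precision]
    push_cast
    field_simp
    rfl
  exact hstart.iterate_next hN hδ (rounding_le_one hn hk) hc _

theorem value_ofCounts_mem_Icc (hn : 0 < n) (hk : 0 < k) (hc : ∀ i < n, 1 ≤ c i)
    (hcN : ∀ i < n, c i ≤ trials n k) : (ofCounts n k c).value ∈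
      Set.Icc ((1 - 1 / (16 * k)) * ∏ i : Fin n, ((c i : ℝ) / trials n k))
        (∏ i : Fin n, ((c i : ℝ) / trials n k)) := by
  obtain ⟨hlower, hupper⟩ := approx_ofCounts hn hk hc
  rw [index_ofCounts hn hk hc hcN, ← Fin.prod_univ_eq_prod_range fun j => (c j : ℝ) / trials n k]
    at hlower hupper
  have hbernoulli : 1 - 1 / (16 * k : ℝ) ≤ (1 - 1 / (16 * n * k)) ^ n := by
    have hδ : -2 ≤ -(1 / (16 * n * k : ℝ)) := by linarith [rounding_le_one hn hk]
    calc 1 - 1 / (16 * k : ℝ) = 1 + n * -(1 / (16 * n * k)) := by field_simp; ring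
      _ ≤ (1 - 1 / (16 * n * k)) ^ n := one_add_mul_le_pow hδ n
  refine ⟨le_trans ?_ hlower, hupper⟩
  gcongr

end FloatProduct

end Precision

section Accuracy

variable {n m : ℕ} {G : Multigraph (Fin n) (Fin m)} {N k : ℕ} {ε : ℝ} {s : Ctl n}

/-- The counts of the vertices as a function on the natural numbers. -/
def Ctl.countAt (s : Ctl n) (i : ℕ) : ℕ := if h : i < n then s.count ⟨i, h⟩ else 0

theorem Ctl.countAt_of_lt (s : Ctl n) {i : ℕ} (hi : i < n) : s.countAt i = s.count ⟨i, hi⟩ :=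
  dif_pos hi

namespace Ctl.Accurate

theorem prod_mem_Icc (hdeg : ∀ v, 3 ≤ G.degree v) (h : s.Accurate G N ε) :
    ∏ i, (s.count i : ℝ) / N ∈ Set.Icc ((1 - ε / 2) * (G.numSinkFree / 2 ^ m))
      ((1 + ε / 2) * (G.numSinkFree / 2 ^ m)) := by
  have hpos : 0 < ∏ i, stageProb G i := prod_pos fun i _ => stageProb_pos hdeg i
  have hdiv : ∏ i, (s.count i : ℝ) / (N * stageProb G i) =
      (∏ i, (s.count i : ℝ) / N) / ∏ i, stageProb G i := by
    rw [← prod_div_distrib]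
    exact prod_congr rfl fun i _ => (div_div _ _ _).symm
  obtain ⟨hlower, hupper⟩ := abs_le.1 (hdiv ▸ h.2)
  rw [← prod_stageProb hdeg]
  constructor
  · rw [← le_div_iff₀ hpos]
    linarith
  · rw [← div_le_iff₀ hpos]
    linarith

theorem one_le_count (hdeg : ∀ v, 3 ≤ G.degree v) (h : s.Accurate G N ε) (hε : ε < 2) (i : Fin n) :
    1 ≤ s.count i := by
  have hZ : (0 : ℝ) < G.numSinkFree := by
    rw [← card_noSinkIn_univ]
    exact card_noSinkIn_pos hdeg univ
  have hlower : 0 < (1 - ε / 2) * (G.numSinkFree / 2 ^ m) :=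
    mul_pos (by linarith) (by positivity)
  have hprod : ∏ i, (s.count i : ℝ) / N ≠ 0 :=
    (hlower.trans_le (h.prod_mem_Icc hdeg).1).ne'
  refine Nat.one_le_iff_ne_zero.2 fun hi => prod_ne_zero_iff.1 hprod i (mem_univ i) ?_
  simp [hi]

theorem value_ofCounts_mem_Icc (hdeg : ∀ v, 3 ≤ G.degree v) (h : s.Accurate G (trials n k) ε)
    (hcN : ∀ i, s.count i ≤ trials n k) (hn : 0 < n) (hk : 0 < k) (hε : ε < 2) :
    (FloatProduct.ofCounts n k s.countAt).value ∈
      Set.Icc ((1 - 1 / (16 * k)) * ((1 - ε / 2) * (G.numSinkFree / 2 ^ m)))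
        ((1 + ε / 2) * (G.numSinkFree / 2 ^ m)) := by
  have hcount : ∏ i : Fin n, ((s.countAt i : ℝ) / trials n k) =
      ∏ i, (s.count i : ℝ) / trials n k :=
    prod_congr rfl fun i _ => by rw [countAt_of_lt s i.2]
  have hvalue := FloatProduct.value_ofCounts_mem_Icc (c := s.countAt) hn hk
    (fun i hi => by rw [countAt_of_lt s hi]; exact h.one_le_count hdeg hε _)
    (fun i hi => by rw [countAt_of_lt s hi]; exact hcN _)
  rw [hcount] at hvalue
  have hround : 0 ≤ 1 - 1 / (16 * k : ℝ) := by
    simpa using rounding_le_one one_pos hk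
  exact ⟨(mul_le_mul_of_nonneg_left (h.prod_mem_Icc hdeg).1 hround).trans hvalue.1,
    hvalue.2.trans (h.prod_mem_Icc hdeg).2⟩

theorem isApprox (hdeg : ∀ v, 3 ≤ G.degree v) (h : s.Accurate G (trials n k) ε)
    (hcN : ∀ i, s.count i ≤ trials n k) (hn : 0 < n) (hk : 0 < k) (hε : ε < 1) (hεk : 1 ≤ ε * k) :
    IsApprox ε G.numSinkFree (2 ^ m * (FloatProduct.ofCounts n k s.countAt).value) := by
  obtain ⟨hlower, hupper⟩ := h.value_ofCounts_mem_Icc hdeg hcN hn hk (hε.trans one_lt_two)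
  have hk' : (0 : ℝ) < k := Nat.cast_pos.2 hk
  have hε0 : 0 < ε := pos_of_mul_pos_left (one_pos.trans_le hεk) hk'.le
  have hround : 1 / (16 * k : ℝ) ≤ ε / 2 := by
    rw [div_le_iff₀ (by positivity)]
    linarith
  constructor
  · calc (1 - ε) * (G.numSinkFree : ℝ)
        ≤ (1 - ε / 2) * (1 - ε / 2) * G.numSinkFree := by
          gcongr
          nlinarith
      _ ≤ (1 - 1 / (16 * k)) * (1 - ε / 2) * G.numSinkFree := by
          gcongr
          linarith
      _ = 2 ^ m * ((1 - 1 / (16 * k)) * ((1 - ε / 2) * (G.numSinkFree / 2 ^ m))) := by field_simp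
      _ ≤ _ := by gcongr
  · calc 2 ^ m * (FloatProduct.ofCounts n k s.countAt).value
        ≤ 2 ^ m * ((1 + ε / 2) * (G.numSinkFree / 2 ^ m)) := by gcongr
      _ = (1 + ε / 2) * G.numSinkFree := by field_simp
      _ ≤ (1 + ε) * G.numSinkFree := by
          gcongr
          linarith

end Ctl.Accurate

end Accuracy

/-! ### Bounds for the time and for the words -/

section Bounds

variable {n m k X : ℕ}

theorem trials_le_pow (hX : 4 ≤ X) (hn : n ≤ X) (hk : k ≤ X) : trials n k ≤ X ^ 6 := by
  calc trials n k = n * k * k * 4 ^ 3 := rfl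
    _ ≤ X * X * X * X ^ 3 := by gcongr
    _ = X ^ 6 := by ring

theorem precision_le_pow (hX : 4 ≤ X) (hn : n ≤ X) (hk : k ≤ X) : precision n k ≤ X ^ 10 := by
  calc precision n k = n * k * trials n k * 4 ^ 2 := rfl
    _ ≤ X * X * X ^ 6 * X ^ 2 := by gcongr; exact trials_le_pow hX hn hk
    _ = X ^ 10 := by ring

theorem wordBound_pow (hX : 4 ≤ X) (hn : n ≤ X) (hm : m ≤ X) (hk : k ≤ X) :
    WordBound n m (trials n k) (precision n k) (rounds n k) (fuel n k) (X ^ 20) := by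
  have hN := trials_le_pow hX hn hk
  have hQ := precision_le_pow hX hn hk
  have hpow {i : ℕ} (hi : i ≤ 20) : X ^ i ≤ X ^ 20 := Nat.pow_le_pow_right (by omega) hi
  have hX6 : 4 ^ 6 ≤ X ^ 6 := Nat.pow_le_pow_left hX 6
  have hfour (i : ℕ) : 4 * X ^ i ≤ X ^ (i + 1) := by
    rw [pow_succ']
    exact Nat.mul_le_mul_right _ hX
  have hX7 : 4 * X ^ 6 ≤ X ^ 7 := hfour 6
  have hX8 : 4 * X ^ 7 ≤ X ^ 8 := hfour 7
  have hself : X ≤ X ^ 6 := Nat.le_self_pow (by norm_num) X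
  have hN7 : trials n k + 1 ≤ X ^ 7 := by omega
  exact
    { const_le := (by omega : 1600 ≤ X ^ 6).trans (hpow (by norm_num))
      memory_le := (by omega : 4 * n + trials n k + 3 ≤ X ^ 8).trans (hpow (by norm_num))
      base_le := by
        calc trials n k * m ≤ X ^ 6 * X := by gcongr
          _ ≤ X ^ 20 := by rw [← pow_succ]; exact hpow (by norm_num)
      input_le := (by omega : n + 4 + 4 * m ≤ X ^ 8).trans (hpow (by norm_num))
      product_le := by
        calc 2 * precision n k * (trials n k + 1) + 1 ≤ 2 * X ^ 10 * X ^ 7 + X ^ 17 := by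
              gcongr
              exact Nat.one_le_pow _ _ (by omega)
          _ = 3 * X ^ 17 := by ring
          _ ≤ 4 * X ^ 17 := by omega
          _ ≤ X ^ 20 := (hfour 17).trans (hpow (by norm_num))
      fuel_le := by
        calc fuel n k ≤ X * X ^ 6 * X ^ 6 := by
              rw [fuel]
              gcongr
              omega
          _ ≤ X ^ 20 := by ring_nf; exact hpow (by norm_num)
      rounds_le := by
        calc rounds n k ≤ X ^ 7 * X := by rw [rounds]; gcongr
          _ ≤ X ^ 20 := by rw [← pow_succ]; exact hpow (by norm_num) }

theorem rounds_le_fuel (hn : 0 < n) (hk : 0 < k) : rounds n k ≤ fuel n k := by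
  have hN := trials_pos hn hk
  calc rounds n k ≤ (trials n k + trials n k) * n := by rw [rounds]; gcongr; exact hN
    _ = n * trials n k * 2 := by ring
    _ ≤ fuel n k := by rw [fuel]; gcongr; norm_num

theorem fuel_le {a b : ℕ} {ε : ℝ} (hn : 2 ≤ n) (ha : 0 < a) (hab : a < b) (hε : ε = (a : ℝ) / b) :
    (fuel n (b / a + 1) : ℝ) ≤ 819200 * (((n : ℝ) / ε) ^ 2 * Real.log ((n : ℝ) / ε)) := by
  have ha' : (0 : ℝ) < a := Nat.cast_pos.2 ha
  have hn' : (2 : ℝ) ≤ n := by exact_mod_cast hn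
  have hba : 1 ≤ (b : ℝ) / a := (one_le_div ha').2 (Nat.cast_le.2 hab.le)
  have hinv : (n : ℝ) / ε = n * (b / a) := by rw [hε, div_div_eq_mul_div, mul_div_assoc]
  rw [hinv]
  have hk : (((b / a + 1 : ℕ)) : ℝ) ≤ 2 * (b / a) := by
    push_cast
    linarith [Nat.cast_div_le (α := ℝ) (m := b) (n := a)]
  have htwo : 2 ≤ (n : ℝ) * (b / a) := by nlinarith
  have hlog : 1 / 2 ≤ Real.log (n * (b / a)) := by
    linarith [Real.log_le_log two_pos htwo, Real.log_two_gt_d9]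
  calc (fuel n (b / a + 1) : ℝ) = 102400 * ((n : ℝ) * (b / a + 1 : ℕ)) ^ 2 := by
        rw [fuel, trials]
        push_cast
        ring
    _ ≤ 102400 * ((n : ℝ) * (2 * (b / a))) ^ 2 := by gcongr
    _ = 819200 * ((n * (b / a)) ^ 2 * (1 / 2)) := by ring
    _ ≤ _ := by gcongr

theorem one_le_mul_div_add_one {a b : ℕ} {ε : ℝ} (ha : 0 < a) (hb : 0 < b) (hε : ε = (a : ℝ) / b) :
    1 ≤ ε * (b / a + 1 : ℕ) := by
  have hle : b ≤ a * (b / a + 1) := by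
    rw [mul_add, mul_one, mul_comm]
    exact (Nat.lt_div_mul_add ha).le
  rw [hε, div_mul_eq_mul_div, one_le_div (Nat.cast_pos.2 hb)]
  exact_mod_cast hle

theorem AdjList.getD_encode_le_pow {G : Multigraph (Fin n) (Fin m)} (L : AdjList G) {a b : ℕ}
    (hn : 2 ≤ n) (ha : 0 < a) (hab : a < b) (i : ℕ) :
    (L.encode a b).getD i 0 ≤ (n + m + b) ^ 20 := by
  calc (L.encode a b).getD i 0 ≤ n + 4 + 4 * m + b := L.getD_encode_le hab.le i
    _ ≤ (n + m + b) ^ 2 := by nlinarith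
    _ ≤ (n + m + b) ^ 20 := Nat.pow_le_pow_right (by omega) (by norm_num)

end Bounds

/-! ### The run of the program -/

/-- A bound for the number of steps of the program for each round of the sampling loop. -/
def stepCost : ℕ := Program.init.cost + Program.sampleRound.cost + Program.productStep.cost + 12

theorem stepCost_mul_fuel_le {n a b : ℕ} {ε : ℝ} (hn : 2 ≤ n) (ha : 0 < a) (hab : a < b)
    (hε : ε = (a : ℝ) / b) :
    ((stepCost * fuel n (b / a + 1) : ℕ) : ℝ) ≤
      (819200 * stepCost + 20 * 2 ^ stepCost : ℕ) *
        (((n : ℝ) / ε) ^ 2 * Real.log ((n : ℝ) / ε)) := by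
  have hfuel := fuel_le hn ha hab hε
  have hnonneg : 0 ≤ ((n : ℝ) / ε) ^ 2 * Real.log ((n : ℝ) / ε) := by
    linarith [(Nat.cast_nonneg _ : (0 : ℝ) ≤ fuel n (b / a + 1))]
  calc ((stepCost * fuel n (b / a + 1) : ℕ) : ℝ)
      ≤ stepCost * (819200 * (((n : ℝ) / ε) ^ 2 * Real.log ((n : ℝ) / ε))) := by
        rw [Nat.cast_mul]
        gcongr
    _ = (819200 * stepCost : ℕ) * (((n : ℝ) / ε) ^ 2 * Real.log ((n : ℝ) / ε)) := by
        push_cast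
        ring
    _ ≤ _ := by
        gcongr
        exact Nat.le_add_right _ _

section Run

open Program

variable {n m : ℕ} {G : Multigraph (Fin n) (Fin m)} {L : AdjList G} {N Q R F B W k a b : ℕ} {ε : ℝ}
  {σ : Store} {s : Ctl n} {π : Fin m → Option Bool} {x : List ℕ}

theorem AtRest.holdsProduct (h : AtRest L N Q R 0 σ s π) (hB : WordBound n m N Q R F B)
    (hQ : 0 < Q) :
    HoldsProduct n m N Q B R s.countAt (σ.setReg rStage 0) ⟨1, 0, 0⟩ where
  reg i hi := by
    rcases hi with hi | rfl | ⟨hi, hi'⟩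
    · interval_cases i <;> simp [h.reg, registers, productRegisters]
    · simp [productRegisters]
    · interval_cases i <;> simp [h.reg, registers, productRegisters]
  count i hi := by
    rw [Ctl.countAt_of_lt s hi]
    exact h.data.count ⟨i, hi⟩
  count_le i hi := by
    rw [Ctl.countAt_of_lt s hi]
    exact h.inBounds.count_le _
  mantissa_le := by change 1 ≤ 2 * Q; omega
  index_le := Nat.zero_le n
  shift_add_le := by simpa using hB.rounds_le
  bounded := (h.boundedBy hB (Nat.zero_le _)).setReg (Nat.zero_le _)

theorem AtRest.reaches_productLoop
    (h : AtRest L (trials n k) (precision n k) (rounds n k) 0 σ s π)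
    (hB : WordBound n m (trials n k) (precision n k) (rounds n k) F B)
    (hxB : ∀ i, x.getD i 0 ≤ B) (hW : B ^ 2 ^ productStep.cost ≤ W) (hBW : B ≤ W)
    (hdeg : ∀ v, 3 ≤ G.degree v) (hn : 0 < n) (hk : 0 < k) (hε : ε < 1) (hεk : 1 ≤ ε * k) :
    Config.Reaches x {y | IsApprox ε G.numSinkFree y} W
      (1 + rounds n k * (productStep.cost + 1) + 1 + 1) (accuracy G (trials n k) ε s)
      ⟨[.seq rewindStage productLoop], σ⟩ := by
  have hσ : σ.BoundedBy W := (h.boundedBy hB (Nat.zero_le _)).mono hBW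
  have hQ : 0 < precision n k := (trials_pos hn hk).trans_le (trials_le_precision hn hk)
  have hq : accuracy G (trials n k) ε s ≤ Set.indicator {y | IsApprox ε G.numSinkFree y} 1
      (2 ^ m * (FloatProduct.ofCounts n k s.countAt).value) := by
    refine Set.indicator_apply_le' (fun hs => ?_)
      fun _ => Set.indicator_nonneg (fun _ _ => zero_le_one) _
    have hy : 2 ^ m * (FloatProduct.ofCounts n k s.countAt).value ∈
        {y | IsApprox ε G.numSinkFree y} :=
      Ctl.Accurate.isApprox hdeg hs h.inBounds.count_le hn hk hε hεk
    exact (Set.indicator_of_mem hy (1 : ℝ → ℝ)).ge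
  have hproduct := (h.holdsProduct hB hQ).reaches_productLoop hB hxB hW hq
  exact .of_step (c := ⟨[.seq rewindStage productLoop], σ⟩) rfl hσ
    (.of_step (c := ⟨[rewindStage, productLoop], σ⟩) (PMF.pure_map _ _) hσ hproduct)

theorem run_time_le (c₁ c₂ c₃ : ℕ) (hn : 0 < n) (hk : 0 < k) :
    1 + rounds n k * (c₃ + 1) + 1 + 1 + 1 + fuel n k * (c₂ + 3) + 1 + c₁ + 1 ≤
      (c₁ + c₂ + c₃ + 12) * fuel n k := by
  have hrounds := Nat.mul_le_mul_right (c₃ + 1) (rounds_le_fuel hn hk)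
  have hone := Nat.mul_le_mul_left (c₁ + 7) (fuel_pos hn hk)
  linarith

theorem reaches_approxSinkFree [NeZero n] (hdeg : ∀ v, 3 ≤ G.degree v) (hx : Encodes x L)
    (hn : x.getD 0 0 = n) (ha : x.getD 1 0 = a) (hb : x.getD 2 0 = b) (hk : k = b / a + 1)
    (hε : ε < 1) (hεk : 1 ≤ ε * k)
    (hB : WordBound n m (trials n k) (precision n k) (rounds n k) (fuel n k) B)
    (hxB : ∀ i, x.getD i 0 ≤ B) (hW : B ^ 2 ^ stepCost ≤ W) :
    Config.Reaches x {y | IsApprox ε G.numSinkFree y} W (stepCost * fuel n k) (3 / 4)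
      ⟨[approxSinkFree], Store.zero⟩ := by
  have hn0 : 0 < n := NeZero.pos n
  have hk0 : 0 < k := hk ▸ Nat.succ_pos _
  have hε0 : 0 < ε := pos_of_mul_pos_left (one_pos.trans_le hεk) (Nat.cast_nonneg k)
  have htwo : 2 ≤ B := le_trans (by norm_num) hB.const_le
  have hpow {c : ℕ} (hc : c ≤ stepCost) : B ^ 2 ^ c ≤ W :=
    (Nat.pow_le_pow_right (by omega) (Nat.pow_le_pow_right two_pos hc)).trans hW
  have hBW : B ≤ W := by simpa using hpow (Nat.zero_le _)
  have hzero : Store.zero.Fits x 1600 B := ⟨htwo, hB.const_le, hxB, .zero B⟩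
  have hinit := atRest_init hx hn ha hb hk
  have hloop := hinit.reaches_sampleLoop hx hB hxB (hpow (by rw [stepCost]; omega))
    (accuracy_nonneg (G := G) (N := trials n k) (ε := ε))
    (fun σ s π hs => hs.reaches_productLoop hB hxB (hpow (by rw [stepCost]; omega)) hBW hdeg hn0
      hk0 hε hεk) le_rfl
  have hprob := hloop.mono_prob (three_quarters_le_lazyValue_accuracy hdeg hε0 hk0 hεk)
  have hseq := Config.Reaches.of_step
    (c := ⟨[.seq sampleLoop (.seq rewindStage productLoop)], init.eval x Store.zero⟩) rfl
    ((hinit.boundedBy hB le_rfl).mono hBW) hprob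
  have hrun := Config.Reaches.of_eval isStraight_init hzero (hpow (by rw [stepCost]; omega)) hseq
  exact (Config.Reaches.of_step (c := ⟨[approxSinkFree], Store.zero⟩) rfl
    (hzero.bounded.mono hBW) hrun).mono (run_time_le _ _ _ hn0 hk0)

end Run

end SFO

theorem theorem3 :
    ∃ (P : SFO.Program) (C : ℕ),
      ∀ (n m : ℕ) (G : SFO.Multigraph (Fin n) (Fin m)) (L : SFO.AdjList G) (a b : ℕ) (ε : ℝ),
        2 ≤ n → (∀ v, 3 ≤ G.degree v) →
        0 < a → a < b → ε = (a : ℝ) / (b : ℝ) →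
        ∃ T : ℕ,
          (T : ℝ) ≤ (C : ℝ) * (((n : ℝ) / ε) ^ 2 * Real.log ((n : ℝ) / ε)) ∧
          P.HaltsWithin (L.encode a b) T ∧
          P.WordsBoundedBy (L.encode a b) ((n + m + b) ^ C) ∧
          3 / 4 ≤ P.probOutput (L.encode a b) T
            {y : ℝ | SFO.IsApprox ε (G.numSinkFree : ℝ) y} := by
  refine ⟨SFO.Program.approxSinkFree, 819200 * SFO.stepCost + 20 * 2 ^ SFO.stepCost, ?_⟩
  intro n m G L a b ε hn hdeg ha hab hε
  have : NeZero n := ⟨by omega⟩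
  have hε1 : ε < 1 := by
    rw [hε, div_lt_one (Nat.cast_pos.2 (ha.trans hab))]
    exact Nat.cast_lt.2 hab
  have hk : b / a + 1 ≤ n + m + b := by
    have := Nat.div_le_self b a
    omega
  have hrun := SFO.reaches_approxSinkFree hdeg (L.encodes_encode a b) rfl rfl rfl rfl hε1
    (SFO.one_le_mul_div_add_one ha (ha.trans hab) hε)
    (SFO.wordBound_pow (by omega) (by omega) (by omega) hk) (L.getD_encode_le_pow hn ha hab)
    (W := (n + m + b) ^ (819200 * SFO.stepCost + 20 * 2 ^ SFO.stepCost)) (by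
      rw [← pow_mul]
      exact Nat.pow_le_pow_right (by omega) (Nat.le_add_left _ _))
  refine ⟨_, SFO.stepCost_mul_fuel_le hn ha hab hε, hrun.halts, hrun.bounded, ?_⟩
  have hthree : ENNReal.ofReal (3 / 4) = 3 / 4 := by
    rw [ENNReal.ofReal_div_of_pos (by norm_num)]
    norm_num
  exact hthree ▸ hrun.prob
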